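/- Let $m\ge 1$ and $N\geq n\geq 1$ be integers. Let $\{H_j\}_{j=1}^q$ be hyperplanes in $\mathbb{P}^n=\mathbb{P}^n(\mathbb{C})$ in general position and $\{H'_j\}_{j=1}^q$ be hyperplanes in $\mathbb{P}^N$ in general position; that is, the linear forms defining any $k$ of the $H_j$ with distinct indices are linearly independent for $k\le n+1$ (respectively for $k\le N+1$ in the case of the $H'_j$). Let $f:\mathbb{C}^m\to\mathbb{P}^n$ and $g:\mathbb{C}^m\to\mathbb{P}^N$ be meromorphic maps such that, for every $1\leq j\leq q$, $f(\mathbb{C}^m)\not\subseteq H_j$, $g(\mathbb{C}^m)\not\subseteq H'_j$ and $f^*(H_j)=g^*(H'_j)$ as divisors. Here the pullback divisor $f^*(H)$ of a hyperplane $H=\{a_0x_0+\dots+a_nx_n=0\}$ is the zero divisor (with multiplicities) of the holomorphic function $a_0f_0+\dots+a_nf_n$, where $(f_0,\dots,f_n)$ is a reduced representation of $f$: holomorphic functions whose common zero set is the indeterminacy locus of $f$ (an analytic set of codimension at least $2$) and which satisfy $f=[f_0:\dots:f_n]$ off that set. Assume that $g$ is linearly non-degenerate, i.e. its image is not contained in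 any hyperplane of $\mathbb{P}^N$, and that $$q\geq \min\bigl\{N+2n+2,\ \max\{2N+1,\,3n+2\}\bigr\}.$$ Then $N=n$, and there are a projective linear transformation $L$ of $\mathbb{P}^n$ and $n+2$ distinct indices $k_1,\dots,k_{n+2}\in\{1,\dots,q\}$ such that $f=L(g)$ and $$L(H'_{k_i})=H_{k_i},\qquad 1\leq i\leq n+2.$$ -/

import Mathlib

open Filter Topology

/-- The complex projective space of dimension `n`: lines through the origin of `ℂ^(n+1)`. -/
abbrev ProjSpace (n : ℕ) : Type := Projectivization ℂ (Fin (n + 1) → ℂ)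

/-- Linear forms `a₀X₀ + ⋯ + aₙXₙ` in the homogeneous coordinates of `ℙⁿ`. -/
abbrev LinForm (n : ℕ) : Type := Module.Dual ℂ (Fin (n + 1) → ℂ)

/-- The subset of `ℙⁿ` defined by the vanishing of a linear form
(a hyperplane when the form is nonzero). -/
def hyperplane {n : ℕ} (l : LinForm n) : Set (ProjSpace n) :=
  {p | p.submodule ≤ LinearMap.ker l}

/-- The hyperplanes defined by the forms `l j` are in general position: any at most `n + 1` of
the forms (with distinct indices) are linearly independent. In particular each form is nonzero. -/
def InGeneralPosition {n q : ℕ} (l : Fin q → LinForm n) : Prop :=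
  ∀ s : Finset (Fin q), s.card ≤ n + 1 → LinearIndependent ℂ (fun j : s => l j)

/-- The set `A` has codimension at least `c` at its point `a`: some `c`-dimensional complex affine
plane through `a` meets `A` near `a` only in `a`. (For analytic sets `A` this is the usual
codimension.) -/
def CodimAtLeastAt {m : ℕ} (c : ℕ) (A : Set (Fin m → ℂ)) (a : Fin m → ℂ) : Prop :=
  ∃ W : Submodule ℂ (Fin m → ℂ), Module.finrank ℂ W = c ∧
    ∀ᶠ z in 𝓝[≠] a, z - a ∈ W → z ∉ A

/-- `F = (F₀, …, Fₙ)` represents the partial map `f` near `a`: it is holomorphic near `a`, and for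
all `z` near `a`, `f` is undefined at `z` if `F z = 0`, and `f z = [F₀ z : ⋯ : Fₙ z]` if `F z ≠ 0`. -/
def RepresentsNear {m n : ℕ} (f : (Fin m → ℂ) →. ProjSpace n)
    (F : (Fin m → ℂ) → (Fin (n + 1) → ℂ)) (a : Fin m → ℂ) : Prop :=
  AnalyticAt ℂ F a ∧
    ∀ᶠ z in 𝓝 a, (F z = 0 → z ∉ f.Dom) ∧
      ∀ h : F z ≠ 0, Projectivization.mk ℂ (F z) h ∈ f z

/-- A meromorphic map of `ℂ^m` into `ℙⁿ`: a partial map, defined off the indeterminacy locus,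
which near every point is given by holomorphic homogeneous coordinates whose common zero set is
the indeterminacy locus, and this locus has codimension at least two. -/
structure MeromorphicMap (m n : ℕ) where
  /-- The underlying partial map; its domain is the complement of the indeterminacy locus. -/
  toPFun : (Fin m → ℂ) →. ProjSpace n
  exists_rep : ∀ a, ∃ F, RepresentsNear toPFun F a
  codim_two : ∀ a ∈ toPFun.Domᶜ, CodimAtLeastAt 2 toPFun.Domᶜ a

/-- The order of vanishing of a holomorphic function at a point: the smallest degree of a nonzero
homogeneous term of its Taylor expansion there (`⊤` if there is none). -/
noncomputable def vanishingOrder {m : ℕ} (φ : (Fin m → ℂ) → ℂ) (a : Fin m → ℂ) : ℕ∞ :=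
  ⨅ (k : ℕ) (_ : iteratedFDeriv ℂ k φ a ≠ 0), (k : ℕ∞)

namespace MeromorphicMap

variable {m n : ℕ}

/-- The image of a meromorphic map (of the complement of its indeterminacy locus). -/
def image (f : MeromorphicMap m n) : Set (ProjSpace n) := f.toPFun.ran

/-- The image is not contained in any hyperplane. -/
def LinearlyNondegenerate (f : MeromorphicMap m n) : Prop :=
  ∀ l : LinForm n, l ≠ 0 → ¬ f.image ⊆ hyperplane l

/-- A reduced representation of `f` near `a`; any two differ near `a` by a nowhere vanishing
holomorphic factor. -/
noncomputable def reducedRep (f : MeromorphicMap m n) (a : Fin m → ℂ) :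
    (Fin m → ℂ) → (Fin (n + 1) → ℂ) :=
  (f.exists_rep a).choose

/-- The pullback divisor of the hyperplane defined by `l` under `f` (whose image should not lie in
that hyperplane), as a multiplicity function on `ℂ^m`: at `a` it is the order of vanishing of
`a₀f₀ + ⋯ + aₙfₙ`, where `(f₀, …, fₙ)` is a reduced representation of `f` near `a` and
`a₀X₀ + ⋯ + aₙXₙ` is the form `l`. -/
noncomputable def pullbackDivisor (f : MeromorphicMap m n) (l : LinForm n) :
    (Fin m → ℂ) → ℕ∞ :=
  fun a => vanishingOrder (fun z => l (f.reducedRep a z)) a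

end MeromorphicMap

/-- The projective linear isomorphism induced by a linear isomorphism `ℂ^(N+1) ≃ ℂ^(n+1)`. -/
noncomputable def projectiveLinearMap {N n : ℕ} (L : (Fin (N + 1) → ℂ) ≃ₗ[ℂ] (Fin (n + 1) → ℂ)) :
    ProjSpace N → ProjSpace n :=
  Projectivization.map L.toLinearMap L.injective

/-! Fix a line on which no `H j` vanishes identically along f and no `H' j` along g, and a reference
index 0. Since the divisors agree, the cross ratios U_j = (H_j(f)/H_0(f))·(H'_0(g)/H'_j(g)) extend
along the line to entire functions without zeros
(`MeromorphicMap.exists_differentiable_eq_crossRatio`). Normalised coordinates X of f and Y of g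
satisfy H_j X = U_j H'_j Y, so for any n+N+2 indices the square matrix with rows (H_j, U_j H'_j) is
singular. Its determinant expands into a linear relation between the products of N+1 of the U_j, in
which general position makes every coefficient nonzero. By Borel's theorem
(`exists_eq_const_mul_of_sum_eq_zero`) each such product is proportional to a different one.

Only the real weights log|U_j(z₀)/U_j(z₁)| at two points of the line are needed. No set of N+1 among
n+N+2 of them is determined by its sum, and sorting them shows that the bound on q forces n+2 equal
weights (`exists_injective_of_sum_eq`). The points are chosen beforehand so that a cross ratio with
equal moduli at both is constant (`exists_forall_eq_of_norm_eq`).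

Hence H_{k_i}(f) = u·c_i·H'_{k_i}(g) for n+2 indices, with constants c_i and a common factor u. The
linear relation between the forms H_{k_i} becomes one between the H'_{k_i} on the image of g, hence
between the forms themselves, as g is nondegenerate. For N > n this contradicts general position;
for N = n the two relations match and define L.

Two analytic facts carry the weight. Borel's theorem rests on Cramer's rule, Jensen's formula and a
growth lemma (`eq_apply_zero_of_sum_exp_eq_one`). Equality of multiplicities point by point yields
mutually bounded local equations by restriction to generic parallel lines
(`exists_eventually_norm_le_mul_norm`). -/

/-! ### Growth estimates for entire functions. -/

open Complex ComplexConjugate Metric Real in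
/-- Schwarz's integral estimate: an entire function is controlled by the circle averages of the
absolute value of its real part. -/
theorem norm_sub_apply_zero_le_circleAverage_abs_re {g : ℂ → ℂ} (hg : Differentiable ℂ g)
    {R : ℝ} {w : ℂ} (hw : ‖w‖ < R) :
    ‖g w - g 0‖ ≤ 2 * ‖w‖ / (R - ‖w‖) * circleAverage (fun z => |(g z).re|) 0 R := by
  have hR : 0 < R := (norm_nonneg w).trans_lt hw
  have hwb : w ∈ ball (0 : ℂ) |R| := by simpa [abs_of_pos hR] using hw
  have hne : ∀ ζ ∈ sphere (0 : ℂ) |R|, ζ - w ≠ 0 := by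
    intro ζ hζ h
    rw [mem_sphere_zero_iff_norm, abs_of_pos hR, sub_eq_zero.1 h] at hζ
    linarith
  have hcont : ContinuousOn (fun ζ : ℂ => ζ / (ζ - w)) (sphere 0 |R|) :=
    continuousOn_id.div (by fun_prop) hne
  have hgc : Continuous g := hg.continuous
  have h1 : circleAverage (fun ζ => ζ / (ζ - w) * g ζ) 0 R = g w := by
    simpa using (hg.diffContOnCl (s := ball 0 |R|)).circleAverage_smul_div hwb
  have hden : ∀ ζ ∈ closedBall (0 : ℂ) |R|, (R : ℂ) ^ 2 - conj w * ζ ≠ 0 := by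
    intro ζ hζ h
    rw [mem_closedBall_zero_iff, abs_of_pos hR] at hζ
    have h2 : ‖(R : ℂ) ^ 2‖ = ‖conj w * ζ‖ := by rw [sub_eq_zero.1 h]
    simp [abs_of_pos hR] at h2
    nlinarith [norm_nonneg w, norm_nonneg ζ]
  -- This kernel is holomorphic on the disc with value 1 at the origin, and on the circle it is the
  -- conjugate of ζ/(ζ − w). Conjugating its mean value property evaluates the Cauchy kernel against
  -- conj g.
  have h2 : circleAverage (fun ζ => (R : ℂ) ^ 2 / ((R : ℂ) ^ 2 - conj w * ζ) * g ζ) 0 R = g 0 := by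
    have hd : DifferentiableOn ℂ (fun ζ => (R : ℂ) ^ 2 / ((R : ℂ) ^ 2 - conj w * ζ) * g ζ)
        (closedBall 0 |R|) := by
      refine DifferentiableOn.mul (DifferentiableOn.div (by fun_prop) (by fun_prop) hden)
        hg.differentiableOn
    have := (hd.diffContOnCl_ball subset_rfl).circleAverage
    rw [this]
    have : (R : ℂ) ≠ 0 := by exact_mod_cast hR.ne'
    simp [this]
  have h3 : circleAverage (fun ζ => ζ / (ζ - w) * conj (g ζ)) 0 R = conj (g 0) := by
    rw [← h2]
    have hi : CircleIntegrable (fun ζ => (R : ℂ) ^ 2 / ((R : ℂ) ^ 2 - conj w * ζ) * g ζ) 0 R := by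
      apply ContinuousOn.circleIntegrable'
      refine ContinuousOn.mul (ContinuousOn.div (by fun_prop) (by fun_prop)
        fun ζ hζ => hden ζ (sphere_subset_closedBall hζ)) hgc.continuousOn
    have := (conjCLE : ℂ →L[ℝ] ℂ).circleAverage_comp_comm hi
    simp only [ContinuousLinearEquiv.coe_coe, conjCLE_apply] at this
    rw [← this]
    apply circleAverage_congr_sphere
    intro ζ hζ
    have h0 : ζ * conj ζ = (R : ℂ) ^ 2 := by
      rw [mul_conj, normSq_eq_norm_sq, mem_sphere_zero_iff_norm.1 hζ]
      simp
    have hζ0 : ζ ≠ 0 := by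
      rintro rfl
      exact hR.ne (by simpa [abs_of_pos hR] using hζ)
    have h5 : (R : ℂ) ^ 2 - w * conj ζ ≠ 0 := by
      have := hden ζ (sphere_subset_closedBall hζ)
      intro h
      apply this
      have := congrArg conj h
      simpa using this
    have h6 := hne ζ hζ
    simp only [Function.comp_apply, map_mul, map_div₀, map_sub, map_pow, conj_ofReal, conj_conj,
      conjCLE_apply]
    congr 1
    rw [div_eq_div_iff h6 h5, ← h0]
    ring
  have hre : ∀ ζ, g ζ + conj (g ζ) = 2 * ((g ζ).re : ℂ) := fun ζ => by
    rw [add_conj]; push_cast; ring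
  have hgi : CircleIntegrable g 0 R := hgc.continuousOn.circleIntegrable'
  have hci : CircleIntegrable (fun ζ => conj (g ζ)) 0 R :=
    (continuous_conj.comp hgc).continuousOn.circleIntegrable'
  have h4 : circleAverage g 0 R = g 0 := by
    simpa using (hg.diffContOnCl (s := ball 0 |R|)).circleAverage
  have h5 : circleAverage (fun ζ => conj (g ζ)) 0 R = conj (g 0) := by
    rw [← h4]
    exact (conjCLE : ℂ →L[ℝ] ℂ).circleAverage_comp_comm hgi
  -- Subtracting the mean of 2 Re g replaces ζ/(ζ − w) by w/(ζ − w), of modulus at most ‖w‖/(R −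
  -- ‖w‖) on the circle.
  have key : g w - g 0 = circleAverage (fun ζ => w / (ζ - w) * (2 * ((g ζ).re : ℂ))) 0 R := by
    have i1 : CircleIntegrable (fun ζ => ζ / (ζ - w) * g ζ) 0 R :=
      (hcont.mul hgc.continuousOn).circleIntegrable'
    have i2 : CircleIntegrable (fun ζ => ζ / (ζ - w) * conj (g ζ)) 0 R :=
      (hcont.mul (continuous_conj.comp hgc).continuousOn).circleIntegrable'
    have : g w - g 0 = (circleAverage (fun ζ => ζ / (ζ - w) * g ζ) 0 R
        + circleAverage (fun ζ => ζ / (ζ - w) * conj (g ζ)) 0 R)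
        - (circleAverage g 0 R + circleAverage (fun ζ => conj (g ζ)) 0 R) := by
      rw [h1, h3, h4, h5]; ring
    rw [this, ← circleAverage_fun_add i1 i2, ← circleAverage_fun_add hgi hci,
      ← circleAverage_fun_sub]
    · apply circleAverage_congr_sphere
      intro ζ hζ
      have h6 := hne ζ hζ
      simp only []
      rw [← hre]
      field_simp
      ring
    · exact ((hcont.mul hgc.continuousOn).add
        (hcont.mul (continuous_conj.comp hgc).continuousOn)).circleIntegrable'
    · exact (hgc.add (continuous_conj.comp hgc)).continuousOn.circleIntegrable'
  have hreal : Continuous fun ζ => |(g ζ).re| := (continuous_re.comp hgc).abs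
  rw [key, ← smul_eq_mul (2 * ‖w‖ / (R - ‖w‖)), ← circleAverage_fun_smul]
  have hnorm : ‖circleAverage (fun ζ => w / (ζ - w) * (2 * ((g ζ).re : ℂ))) 0 R‖ ≤
      circleAverage (fun ζ => ‖w / (ζ - w) * (2 * ((g ζ).re : ℂ))‖) 0 R := by
    rw [circleAverage, circleAverage, norm_smul, smul_eq_mul, norm_of_nonneg (by positivity)]
    gcongr
    exact intervalIntegral.norm_integral_le_integral_norm (by positivity)
  refine hnorm.trans (circleAverage_mono ?_ ?_ ?_)
  · refine ContinuousOn.circleIntegrable' (ContinuousOn.norm (ContinuousOn.mul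
      (continuousOn_const.div (by fun_prop) hne) ?_))
    exact (continuous_const.mul (continuous_ofReal.comp (continuous_re.comp hgc))).continuousOn
  · exact (continuous_const.mul hreal).continuousOn.circleIntegrable'
  · intro ζ hζ
    rw [mem_sphere_zero_iff_norm, abs_of_pos hR] at hζ
    have h7 : R - ‖w‖ ≤ ‖ζ - w‖ := by
      rw [← hζ]; exact norm_sub_norm_le ζ w
    simp only [norm_mul, norm_div, norm_real, Real.norm_eq_abs, smul_eq_mul, Complex.norm_ofNat]
    rw [← mul_assoc, div_mul_eq_mul_div, mul_comm ‖w‖ 2]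
    gcongr


-- Jensen's formula: without poles, the divisor terms are nonnegative.
open Complex Metric Real in
theorem log_norm_le_circleAverage_log_norm {f : ℂ → ℂ} (hf : Differentiable ℂ f) (h0 : f 0 ≠ 0)
    {R : ℝ} (hR : 0 < R) :
    Real.log ‖f 0‖ ≤ circleAverage (fun z => Real.log ‖f z‖) 0 R := by
  have ha : AnalyticOnNhd ℂ f (closedBall 0 |R|) := fun z _ => hf.analyticAt z
  rw [ha.circleAverage_log_norm hR.ne' h0]
  refine le_add_of_nonneg_left (finsum_nonneg fun u => ?_)
  by_cases hu : u ∈ closedBall (0 : ℂ) |R|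
  · refine mul_nonneg (by exact_mod_cast MeromorphicOn.AnalyticOnNhd.divisor_nonneg ha u) ?_
    by_cases hu0 : u = 0
    · simp [hu0]
    · apply Real.log_nonneg
      rw [mem_closedBall_zero_iff, abs_of_pos hR] at hu
      rw [zero_sub, norm_neg, ← div_eq_mul_inv, one_le_div (norm_pos_iff.2 hu0)]
      exact hu
  · simp [Function.locallyFinsuppWithin.apply_eq_zero_of_notMem _ hu]

/-- A Borel type growth lemma. -/
theorem exists_le_mul_one_add_log_of_le {A : ℝ → ℝ} (hA : Continuous A) (hA0 : ∀ r, 0 ≤ A r)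
    {C : ℝ} (hC : 1 ≤ C)
    (h : ∀ r ≥ 1, ∀ δ > 0, δ ≤ 1 →
      A r ≤ C * (1 + Real.log ((2 + r) * (1 + A (r + δ)) / δ ^ 2))) :
    ∃ K : ℝ, ∀ r ≥ 1, A r ≤ K * (1 + Real.log (2 + r)) := by
  refine ⟨2 * (1 + 10 * C + C * Real.log (2 * C)), fun r₀ hr₀ => ?_⟩
  -- At a maximum s of this weighted function, with δ half the distance from s to r₀ + 1, one gets 1
  -- + A(s+δ) ≤ 4(1 + A(s)). The hypothesis at s then bounds A(s) by its own logarithm, and no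
  -- exceptional set of radii arises.
  have hcont : ContinuousOn (fun r => (1 + A r) * (r₀ + 1 - r) ^ 2) (Set.Icc r₀ (r₀ + 1)) := by
    fun_prop
  obtain ⟨s, ⟨hs1, hs2⟩, hmax⟩ := isCompact_Icc.exists_isMaxOn
    (Set.nonempty_Icc.2 (by linarith : r₀ ≤ r₀ + 1)) hcont
  set Y := (1 + A s) * (r₀ + 1 - s) ^ 2 with hY
  have hY0 : 1 + A r₀ ≤ Y := by
    have := hmax (Set.left_mem_Icc.2 (by linarith : r₀ ≤ r₀ + 1))
    simpa using this
  have hY1 : 1 ≤ Y := by linarith [hA0 r₀]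
  have hs3 : s < r₀ + 1 := by
    rcases hs2.lt_or_eq with h1 | h1
    · exact h1
    · rw [hY, h1] at hY1; norm_num at hY1
  set δ := (r₀ + 1 - s) / 2 with hδ
  have hδ0 : 0 < δ := by rw [hδ]; linarith
  have hδ1 : δ ≤ 1 / 2 := by rw [hδ]; linarith
  have hYd : Y = 4 * δ ^ 2 * (1 + A s) := by rw [hY, hδ]; ring
  have h1 : (1 + A (s + δ)) ≤ Y / δ ^ 2 := by
    rw [le_div_iff₀ (by positivity)]
    have := hmax (show s + δ ∈ Set.Icc r₀ (r₀ + 1) from ⟨by linarith, by rw [hδ]; linarith⟩)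
    have h2 : r₀ + 1 - (s + δ) = δ := by rw [hδ]; ring
    simpa [h2] using this
  have h2 := h s (by linarith) δ hδ0 (by linarith)
  have h3 : Real.log ((2 + s) * (1 + A (s + δ)) / δ ^ 2) ≤
      Real.log (3 + r₀) + Real.log Y + 4 * Real.log (1 / δ) := by
    have hp : 0 < 1 + A (s + δ) := by linarith [hA0 (s + δ)]
    have hs0 : 0 < 2 + s := by linarith
    have : (2 + s) * (1 + A (s + δ)) / δ ^ 2 ≤ (3 + r₀) * Y * (1 / δ) ^ 4 := by
      calc (2 + s) * (1 + A (s + δ)) / δ ^ 2 ≤ (3 + r₀) * (Y / δ ^ 2) / δ ^ 2 := by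
            have hs4 : 2 + s ≤ 3 + r₀ := by linarith
            gcongr
        _ = _ := by field_simp
    refine (Real.log_le_log (by positivity) this).trans_eq ?_
    rw [Real.log_mul (by positivity) (by positivity), Real.log_mul (by positivity) (by positivity),
      Real.log_pow]
    norm_num
  have h4 : Real.log (1 / δ) ≤ 1 / δ := (Real.log_le_sub_one_of_pos (by positivity)).trans (by linarith)
  have h5 : Real.log (3 + r₀) ≤ 1 + Real.log (2 + r₀) := by
    have : (3 + r₀) = (2 + r₀) * ((3 + r₀) / (2 + r₀)) := by field_simp
    rw [this, Real.log_mul (by positivity) (by positivity)]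
    have h6 := Real.log_le_sub_one_of_pos (show 0 < (3 + r₀) / (2 + r₀) by positivity)
    have h7 : (3 + r₀) / (2 + r₀) ≤ 2 := by rw [div_le_iff₀ (by positivity)]; linarith
    linarith
  -- Half of Y absorbs the logarithm.
  have h6 : C * Real.log Y ≤ Y / 2 + C * Real.log (2 * C) := by
    have : Y = (Y / (2 * C)) * (2 * C) := by field_simp
    have h7 : Real.log Y = Real.log (Y / (2 * C)) + Real.log (2 * C) := by
      rw [← Real.log_mul (by positivity) (by positivity)]
      congr 1
    have h8 := Real.log_le_sub_one_of_pos (show 0 < Y / (2 * C) by positivity)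
    have h9 : C * (Y / (2 * C)) = Y / 2 := by field_simp
    rw [h7]
    nlinarith
  have hl2 : 0 ≤ Real.log (2 + r₀) := Real.log_nonneg (by linarith)
  have hlY : 0 ≤ Real.log Y := Real.log_nonneg hY1
  have hl2C : 0 ≤ Real.log (2 * C) := Real.log_nonneg (by linarith)
  have hd2 : 4 * δ ^ 2 ≤ 1 := by nlinarith
  have h7 : Y ≤ 1 + C * (2 + Real.log (2 + r₀)) + C * Real.log Y + 8 * C := by
    have e1 : A s ≤ C * (2 + Real.log (2 + r₀)) + C * Real.log Y + 4 * C * (1 / δ) := by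
      have : C * (1 + Real.log ((2 + s) * (1 + A (s + δ)) / δ ^ 2)) ≤
          C * (1 + (1 + Real.log (2 + r₀) + Real.log Y + 4 * (1 / δ))) := by
        gcongr
        linarith
      linarith
    -- The weight δ² in Y outweighs log(1/δ) ≤ 1/δ, so s may lie arbitrarily close to the endpoint.
    have e2 : 4 * δ ^ 2 * (1 / δ) ≤ 2 := by
      have : 4 * δ ^ 2 * (1 / δ) = 4 * δ := by field_simp
      linarith
    have e3 : 0 ≤ 1 + C * (2 + Real.log (2 + r₀)) + C * Real.log Y := by positivity
    calc Y = 4 * δ ^ 2 * (1 + A s) := hYd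
      _ ≤ 4 * δ ^ 2 * (1 + (C * (2 + Real.log (2 + r₀)) + C * Real.log Y + 4 * C * (1 / δ))) := by
          gcongr
      _ = 4 * δ ^ 2 * (1 + C * (2 + Real.log (2 + r₀)) + C * Real.log Y)
          + 4 * C * (4 * δ ^ 2 * (1 / δ)) := by ring
      _ ≤ 1 * (1 + C * (2 + Real.log (2 + r₀)) + C * Real.log Y) + 4 * C * 2 := by gcongr
      _ = _ := by ring
  have h8 : Y ≤ 2 * (1 + 10 * C + C * Real.log (2 * C)) + 2 * C * Real.log (2 + r₀) := by
    nlinarith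
  have h9 : 2 * C * Real.log (2 + r₀) ≤
      2 * (1 + 10 * C + C * Real.log (2 * C)) * Real.log (2 + r₀) := by
    gcongr
    nlinarith
  nlinarith [hA0 r₀]

/-! ### Derivatives of exponentials, and exponentials with sum one. -/

/-- The functions `Pₖ` with `(exp ∘ g)⁽ᵏ⁾ = Pₖ * (exp ∘ g)`. -/
noncomputable def expDerivFactor (g : ℂ → ℂ) : ℕ → ℂ → ℂ
  | 0 => fun _ => 1
  | k + 1 => fun z => deriv (expDerivFactor g k) z + deriv g z * expDerivFactor g k z

theorem differentiable_expDerivFactor {g : ℂ → ℂ} (hg : Differentiable ℂ g) (k : ℕ) :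
    Differentiable ℂ (expDerivFactor g k) := by
  induction k with
  | zero => exact differentiable_const _
  | succ k ih => exact ih.deriv.add (hg.deriv.mul ih)

theorem iteratedDeriv_exp_comp {g : ℂ → ℂ} (hg : Differentiable ℂ g) (k : ℕ) :
    iteratedDeriv k (fun z => Complex.exp (g z)) =
      fun z => expDerivFactor g k z * Complex.exp (g z) := by
  induction k with
  | zero => simp [expDerivFactor]
  | succ k ih =>
    rw [iteratedDeriv_succ, ih]
    ext z
    have h1 := (differentiable_expDerivFactor hg k z).hasDerivAt
    have h2 := ((hg z).hasDerivAt).cexp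
    rw [(h1.fun_mul h2).deriv]
    simp only [expDerivFactor]
    ring

/-- Each step of the recursion costs one Cauchy estimate on a disc of radius δ; hence the loss of kδ
in the radius. -/
theorem norm_expDerivFactor_le {g : ℂ → ℂ} (hg : Differentiable ℂ g) {δ B : ℝ} (hδ : 0 < δ)
    (k : ℕ) (ρ : ℝ) (hB : ∀ z, ‖z‖ ≤ ρ + k * δ → ‖deriv g z‖ ≤ B) {z : ℂ} (hz : ‖z‖ ≤ ρ) :
    ‖expDerivFactor g k z‖ ≤ (1 / δ + B) ^ k := by
  induction k generalizing ρ z with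
  | zero => simp [expDerivFactor]
  | succ k ih =>
    have hB' : ∀ w, ‖w‖ ≤ (ρ + δ) + k * δ → ‖deriv g w‖ ≤ B := fun w hw =>
      hB w (by push_cast; linarith)
    have hkδ : 0 ≤ k * δ := by positivity
    have hgz : ‖deriv g z‖ ≤ B := hB' z (by linarith)
    have hB0 : 0 ≤ B := (norm_nonneg _).trans hgz
    have h1 : ‖deriv (expDerivFactor g k) z‖ ≤ (1 / δ + B) ^ k / δ := by
      apply Complex.norm_deriv_le_of_forall_mem_sphere_norm_le hδ
        (differentiable_expDerivFactor hg k).diffContOnCl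
      intro w hw
      refine ih (ρ + δ) hB' ?_
      have : ‖w‖ ≤ ‖w - z‖ + ‖z‖ := by simpa using norm_add_le (w - z) z
      rw [mem_sphere_iff_norm] at hw
      linarith
    have h2 : ‖expDerivFactor g k z‖ ≤ (1 / δ + B) ^ k := ih (ρ + δ) hB' (by linarith)
    calc ‖expDerivFactor g (k + 1) z‖ ≤ ‖deriv (expDerivFactor g k) z‖
          + ‖deriv g z‖ * ‖expDerivFactor g k z‖ := by
          rw [← norm_mul]; exact norm_add_le _ _
      _ ≤ (1 / δ + B) ^ k / δ + B * (1 / δ + B) ^ k := by gcongr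
      _ = _ := by ring


-- Off the zeros of D, both log‖D‖ and log‖D‖ + Re g = log‖W‖ are at most log B, so max(Re g, 0) ≤
-- log B − log‖D‖. Jensen's formula bounds the average of log‖D‖ from below.
open Complex Metric Real in
theorem circleAverage_max_re_le {g D W : ℂ → ℂ} (hg : Differentiable ℂ g)
    (hD : Differentiable ℂ D) (hD0 : D 0 ≠ 0) (hW : ∀ z, D z * Complex.exp (g z) = W z)
    {r B : ℝ} (hr : 0 < r) (hB : 1 ≤ B) (hDB : ∀ z, ‖z‖ = r → ‖D z‖ ≤ B)
    (hWB : ∀ z, ‖z‖ = r → ‖W z‖ ≤ B) :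
    circleAverage (fun z => max (g z).re 0) 0 r ≤ Real.log B - Real.log ‖D 0‖ := by
  classical
  have hlB : 0 ≤ Real.log B := Real.log_nonneg hB
  have hcod : ∀ᶠ z in codiscreteWithin (sphere (0 : ℂ) |r|), D z ≠ 0 := by
    have h1 : D ⁻¹' {0}ᶜ ∈ codiscreteWithin (Set.univ : Set ℂ) :=
      AnalyticOnNhd.preimage_zero_mem_codiscreteWithin (x := 0)
        (fun z _ => hD.analyticAt z) hD0 trivial isConnected_univ
    exact codiscreteWithin_mono (Set.subset_univ _) h1
  -- At zeros of D the convention log 0 = 0 would spoil the pointwise bound; the integrand is set to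
  -- 0 there, which does not change the average.
  set φ : ℂ → ℝ := fun z => if D z = 0 then 0 else max (g z).re 0 with hφ
  have hcongr : (fun z => max (g z).re 0) =ᶠ[codiscreteWithin (sphere (0 : ℂ) |r|)] φ := by
    filter_upwards [hcod] with z hz
    simp [hφ, hz]
  have hmax : CircleIntegrable (fun z => max (g z).re 0) 0 r :=
    ((continuous_re.comp hg.continuous).max continuous_const).continuousOn.circleIntegrable'
  have hφi : CircleIntegrable φ 0 r := hmax.congr_codiscreteWithin hcongr
  have hlog : CircleIntegrable (fun z => Real.log ‖D z‖) 0 r :=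
    MeromorphicOn.circleIntegrable_log_norm fun z _ => (hD.analyticAt z).meromorphicAt
  rw [circleAverage_congr_codiscreteWithin hcongr hr.ne']
  have hconst : CircleIntegrable (fun _ : ℂ => Real.log B) 0 r :=
    continuousOn_const.circleIntegrable'
  have h1 : circleAverage φ 0 r ≤
      circleAverage (fun z => Real.log B - Real.log ‖D z‖) 0 r := by
    refine circleAverage_mono hφi (hconst.sub hlog) fun z hz => ?_
    have hz' : ‖z‖ = r := by simpa [abs_of_pos hr] using hz
    by_cases hDz : D z = 0
    · simp [hφ, hDz, hlB]
    · simp only [hφ, hDz, if_false]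
      have hpos : 0 < ‖D z‖ := norm_pos_iff.2 hDz
      refine max_le ?_ (sub_nonneg.2 (Real.log_le_log hpos (hDB z hz')))
      have h2 : ‖D z‖ * Real.exp (g z).re ≤ B := by
        rw [← Complex.norm_exp, ← norm_mul, hW]
        exact hWB z hz'
      have h3 := Real.log_le_log (by positivity) h2
      rw [Real.log_mul hpos.ne' (Real.exp_ne_zero _), Real.log_exp] at h3
      linarith
  rw [circleAverage_fun_sub hconst hlog, circleAverage_const] at h1
  linarith [log_norm_le_circleAverage_log_norm hD hD0 hr]

-- This is |x| = 2 max(x, 0) − x together with the mean value property of Re g.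
open Complex Metric Real in
theorem circleAverage_abs_re_eq {g : ℂ → ℂ} (hg : Differentiable ℂ g) (r : ℝ) :
    circleAverage (fun z => |(g z).re|) 0 r =
      2 * circleAverage (fun z => max (g z).re 0) 0 r - (g 0).re := by
  have h1 : circleAverage (fun z => (g z).re) 0 r = (g 0).re := by
    have h2 : circleAverage g 0 r = g 0 := by
      simpa using (hg.diffContOnCl (s := ball 0 |r|)).circleAverage
    have h3 := reCLM.circleAverage_comp_comm
      (hg.continuous.continuousOn.circleIntegrable' : CircleIntegrable g 0 r)
    rw [h2] at h3
    exact h3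
  have hc : Continuous fun z => (g z).re := continuous_re.comp hg.continuous
  rw [← h1, ← smul_eq_mul, ← circleAverage_fun_smul, ← circleAverage_fun_sub]
  · congr 1
    ext z
    rcases le_total 0 (g z).re with h | h
    · simp only [abs_of_nonneg h, max_eq_left h, smul_eq_mul]; ring
    · simp only [abs_of_nonpos h, max_eq_right h, smul_eq_mul]; ring
  · exact (continuous_const.mul (hc.max continuous_const)).continuousOn.circleIntegrable'
  · exact hc.continuousOn.circleIntegrable'

/-- If the Taylor coefficients at the origin of finitely many linearly independent entire
functions are arranged in vectors, some of these vectors form a nonsingular matrix. -/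
theorem exists_det_iteratedDeriv_ne_zero {ι : Type} [Fintype ι] [DecidableEq ι] {V : ι → ℂ → ℂ}
    (hV : ∀ i, Differentiable ℂ (V i)) (hli : LinearIndependent ℂ V) :
    ∃ k : ι → ℕ, (Matrix.of fun l i => iteratedDeriv (k l) (V i) 0).det ≠ 0 := by
  set v : ℕ → ι → ℂ := fun k i => iteratedDeriv k (V i) 0 with hv
  -- A functional killing all Taylor vectors gives a combination of the V i with zero Taylor series,
  -- against independence.
  have hspan : Submodule.span ℂ (Set.range v) = ⊤ := by
    by_contra hne
    obtain ⟨φ, hφ0, hφ⟩ := Submodule.exists_le_ker_of_lt_top _ (lt_top_iff_ne_top.2 hne)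
    have hker : ∀ k, ∑ i, φ (Pi.single i 1) * iteratedDeriv k (V i) 0 = 0 := by
      intro k
      have h1 : φ (v k) = 0 := hφ (Submodule.subset_span ⟨k, rfl⟩)
      rw [LinearMap.pi_apply_eq_sum_univ φ (v k)] at h1
      rw [← h1]
      refine Finset.sum_congr rfl fun i _ => ?_
      rw [smul_eq_mul, mul_comm]
      congr 2
      ext j
      simp [Pi.single_apply, eq_comm]
    have hF : ∀ z, ∑ i, φ (Pi.single i 1) * V i z = 0 := by
      intro z
      have hd : Differentiable ℂ fun z => ∑ i, φ (Pi.single i 1) * V i z := by fun_prop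
      rw [← Complex.taylorSeries_eq_of_entire' 0 z hd]
      have : ∀ n, iteratedDeriv n (fun z => ∑ i, φ (Pi.single i 1) * V i z) 0 = 0 := by
        intro n
        rw [iteratedDeriv_fun_sum fun i _ =>
          (((hV i).const_mul _).contDiff (n := n)).contDiffAt]
        refine (Finset.sum_congr rfl fun i _ => ?_).trans (hker n)
        rw [iteratedDeriv_const_mul_field]
      simp [this]
    have h0 := Fintype.linearIndependent_iff.1 hli (fun i => φ (Pi.single i 1)) (by
      ext z; simpa using hF z)
    apply hφ0
    ext i
    simpa using h0 i
  obtain ⟨κ, a, -, hspan', hli'⟩ := exists_linearIndependent' ℂ v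
  rw [hspan] at hspan'
  let b : Module.Basis κ ℂ (ι → ℂ) := Module.Basis.mk hli' hspan'.ge
  let e : ι ≃ κ := (Pi.basisFun ℂ ι).indexEquiv b
  refine ⟨a ∘ e, ?_⟩
  have hli'' : LinearIndependent ℂ (fun l => v (a (e l))) := hli'.comp e e.injective
  have : IsUnit (Matrix.of fun l i => iteratedDeriv ((a ∘ e) l) (V i) 0) :=
    Matrix.linearIndependent_rows_iff_isUnit.1 hli''
  exact (Matrix.isUnit_iff_isUnit_det _ |>.1 this).ne_zero


open Complex Metric Real in
/-- An entire function whose real part has logarithmically growing circle averages is constant. -/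
theorem eq_apply_zero_of_circleAverage_abs_re_le {g : ℂ → ℂ} (hg : Differentiable ℂ g) {K : ℝ}
    (hK : ∀ r ≥ 1, circleAverage (fun z => |(g z).re|) 0 r ≤ K * (1 + Real.log (2 + r))) (z : ℂ) :
    g z = g 0 := by
  rw [← sub_eq_zero, ← norm_le_zero_iff]
  have hlim : Tendsto (fun x : ℝ => 2 * ‖z‖ * K * ((1 + Real.log x) / (x - (2 + ‖z‖)))) atTop
      (𝓝 (2 * ‖z‖ * K * 0)) := by
    refine Tendsto.const_mul _ (Asymptotics.IsLittleO.tendsto_div_nhds_zero ?_)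
    have h1 : (fun x : ℝ => 1 + Real.log x) =o[atTop] (id : ℝ → ℝ) :=
      (Asymptotics.isLittleO_const_id_atTop 1).add Real.isLittleO_log_id_atTop
    refine h1.trans_isBigO (Asymptotics.IsBigO.of_bound 2 ?_)
    filter_upwards [eventually_ge_atTop (2 * (2 + ‖z‖)), eventually_ge_atTop 0] with x hx hx0
    have h2 : 0 ≤ x - (2 + ‖z‖) := by linarith [norm_nonneg z]
    rw [Real.norm_of_nonneg h2, id, Real.norm_of_nonneg hx0]
    linarith
  rw [mul_zero] at hlim
  refine ge_of_tendsto hlim ?_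
  filter_upwards [eventually_ge_atTop (3 + ‖z‖)] with x hx
  have hz0 := norm_nonneg z
  have h1 := norm_sub_apply_zero_le_circleAverage_abs_re hg (R := x - 2) (w := z) (by linarith)
  have h2 := hK (x - 2) (by linarith)
  have h3 : 0 ≤ 2 * ‖z‖ / (x - 2 - ‖z‖) := div_nonneg (by positivity) (by linarith)
  refine h1.trans ((mul_le_mul_of_nonneg_left h2 h3).trans_eq ?_)
  rw [show 2 + (x - 2) = x by ring, show x - 2 - ‖z‖ = x - (2 + ‖z‖) by ring]
  ring

open Complex Metric Real in
/-- Cauchy estimates for the derivative of an entire function in terms of its real part. -/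
theorem norm_deriv_le_circleAverage_abs_re {g : ℂ → ℂ} (hg : Differentiable ℂ g) {R δ : ℝ}
    (hδ : 0 < δ) {z : ℂ} (hz : ‖z‖ ≤ R - 2 * δ) :
    ‖deriv g z‖ ≤ 2 * R * circleAverage (fun z => |(g z).re|) 0 R / δ ^ 2 := by
  have hA : 0 ≤ circleAverage (fun z => |(g z).re|) 0 R :=
    circleAverage_nonneg_of_nonneg fun z _ => abs_nonneg _
  have hz0 := norm_nonneg z
  have h1 : ‖deriv (fun w => g w - g 0) z‖ ≤
      (2 * R / δ * circleAverage (fun z => |(g z).re|) 0 R) / δ := by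
    apply norm_deriv_le_of_forall_mem_sphere_norm_le hδ
      (hg.sub_const _).diffContOnCl
    intro w hw
    have hw' : ‖w‖ ≤ R - δ := by
      have : ‖w‖ ≤ ‖w - z‖ + ‖z‖ := by simpa using norm_add_le (w - z) z
      rw [mem_sphere_iff_norm] at hw
      linarith
    refine (norm_sub_apply_zero_le_circleAverage_abs_re hg (R := R) (by linarith)).trans ?_
    gcongr <;> linarith
  rw [deriv_sub_const] at h1
  refine h1.trans_eq ?_
  field_simp

-- Differentiating the relation gives a linear system for the exp(g i) with matrix entries
-- `expDerivFactor`. By Cramer's rule det M · exp(g i) is again a determinant of such entries and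
-- constants. Both determinants are polynomially bounded in the derivatives of the g j, hence in the
-- averages of |Re g j| over a slightly larger circle. Jensen's formula then gives A(r) ≤ C(1 +
-- log(…A(r+δ)…)), so A grows logarithmically and the g i are constant.
open Complex Metric Real in
theorem eq_apply_zero_of_sum_exp_eq_one {ι : Type} [Fintype ι] {g : ι → ℂ → ℂ}
    (hg : ∀ i, Differentiable ℂ (g i)) (hsum : ∀ z, ∑ i, Complex.exp (g i z) = 1)
    (hli : LinearIndependent ℂ fun i z => Complex.exp (g i z)) (i : ι) (z : ℂ) :
    g i z = g i 0 := by
  classical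
  have hV : ∀ i, Differentiable ℂ fun z => Complex.exp (g i z) := fun i => (hg i).cexp
  obtain ⟨k, hk⟩ := exists_det_iteratedDeriv_ne_zero hV hli
  set M : ℂ → Matrix ι ι ℂ := fun z => Matrix.of fun l i => expDerivFactor (g i) (k l) z with hM
  -- The derivatives of order k l of the constant 1.
  set e : ι → ℂ := fun l => if k l = 0 then 1 else 0 with he
  have hMd : ∀ l i, Differentiable ℂ fun z => M z l i := fun l i =>
    differentiable_expDerivFactor (hg i) (k l)
  have hMV : ∀ z, (M z).mulVec (fun i => Complex.exp (g i z)) = e := by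
    intro z
    ext l
    have h1 := iteratedDeriv_fun_sum (n := k l) (x := z) (I := Finset.univ)
      (f := fun i z => Complex.exp (g i z)) fun i _ => ((hV i).contDiff (n := k l)).contDiffAt
    simp only [hsum, iteratedDeriv_const, iteratedDeriv_exp_comp (hg _)] at h1
    exact h1.symm
  have hD : Differentiable ℂ fun z => (M z).det := by
    simp only [Matrix.det_apply]
    refine Differentiable.fun_sum fun σ _ => ?_
    refine Differentiable.const_smul ?_ _
    exact Differentiable.fun_finsetProd fun j _ => hMd _ _
  have hD0 : (M 0).det ≠ 0 := by
    intro h0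
    apply hk
    have h2 : (Matrix.of fun l i => iteratedDeriv (k l) (fun z => Complex.exp (g i z)) 0) =
        Matrix.of fun l i => Complex.exp (g i 0) * M 0 l i := by
      ext l i
      simp [iteratedDeriv_exp_comp (hg i), hM, mul_comm]
    rw [h2, Matrix.det_mul_row, h0, mul_zero]
  have hcramer : ∀ i z, (M z).det * Complex.exp (g i z) = (M z).cramer e i := by
    intro i z
    rw [Matrix.cramer_eq_adjugate_mulVec, ← hMV z, Matrix.mulVec_mulVec, Matrix.adjugate_mul,
      Matrix.smul_mulVec, Matrix.one_mulVec]
    rfl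
  set K : ℕ := ∑ l, k l with hKdef
  have hkK : ∀ l, k l ≤ K := fun l => Finset.single_le_sum (fun _ _ => Nat.zero_le _)
    (Finset.mem_univ l)
  set s : ℕ := Fintype.card ι with hs
  -- The gap δ is cut into K + 2 parts: up to K for the Cauchy estimates of `expDerivFactor`, two
  -- for bounding the derivatives of the g i.
  set c : ℝ := K + 2 with hc
  have hc1 : 1 ≤ c := by rw [hc]; linarith [(Nat.cast_nonneg K : (0 : ℝ) ≤ K)]
  set Ai : ι → ℝ → ℝ := fun i r => circleAverage (fun z => |(g i z).re|) 0 r with hAi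
  have hAi0 : ∀ i r, 0 ≤ Ai i r := fun i r => circleAverage_nonneg_of_nonneg fun z _ => abs_nonneg _
  set A : ℝ → ℝ := fun r => ∑ i, Ai i r with hA
  have hA0 : ∀ r, 0 ≤ A r := fun r => Finset.sum_nonneg fun i _ => hAi0 i r
  have hAiA : ∀ i r, Ai i r ≤ A r := fun i r =>
    Finset.single_le_sum (fun i _ => hAi0 i r) (Finset.mem_univ i)
  have hAc : Continuous A := by
    refine continuous_finsetSum _ fun i _ => Continuous.circleAverage ?_
    exact (continuous_re.comp (hg i).continuous).abs
  have hmain : ∀ r ≥ 1, ∀ δ > 0, δ ≤ 1 → ∀ i, Ai i r ≤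
      2 * (Real.log s.factorial + K * s * (Real.log (2 * c ^ 2) +
        Real.log ((2 + r) * (1 + A (r + δ)) / δ ^ 2)) - Real.log ‖(M 0).det‖) + |(g i 0).re| := by
    intro r hr δ hδ hδ1 i
    set δ' := δ / c with hδ'
    have hδ'0 : 0 < δ' := by positivity
    have hcδ : c * δ' = δ := by rw [hδ']; field_simp
    set B := 2 * (r + δ) * A (r + δ) / δ' ^ 2 with hB
    have hB0 : 0 ≤ B := by have := hA0 (r + δ); positivity
    set X := 1 + 1 / δ' + B with hX
    have hX1 : 1 ≤ X := by
      have : 0 ≤ 1 / δ' := by positivity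
      linarith
    have hderiv : ∀ i w, ‖w‖ ≤ r + K * δ' → ‖deriv (g i) w‖ ≤ B := by
      intro i w hw
      have h1 : ‖w‖ ≤ (r + δ) - 2 * δ' := by
        rw [← hcδ, hc]; linarith
      refine (norm_deriv_le_circleAverage_abs_re (hg i) hδ'0 h1).trans ?_
      have := hAiA i (r + δ)
      rw [hB]
      gcongr
    have hent : ∀ l i z, ‖z‖ = r → ‖M z l i‖ ≤ X ^ K := by
      intro l i z hz
      have h1 : ‖M z l i‖ ≤ (1 / δ' + B) ^ k l := by
        refine norm_expDerivFactor_le (hg i) hδ'0 (k l) r (fun w hw => hderiv i w ?_) hz.le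
        refine hw.trans ?_
        have : (k l : ℝ) ≤ K := by exact_mod_cast hkK l
        gcongr
      refine h1.trans ?_
      calc (1 / δ' + B) ^ k l ≤ X ^ k l := by
            gcongr
            linarith
        _ ≤ X ^ K := pow_le_pow_right₀ hX1 (hkK l)
    set Bd : ℝ := s.factorial * (X ^ K) ^ s with hBd
    have hXK : 1 ≤ X ^ K := one_le_pow₀ hX1
    have hfac : (1 : ℝ) ≤ s.factorial := by exact_mod_cast Nat.one_le_iff_ne_zero.2 s.factorial_ne_zero
    have hBd1 : 1 ≤ Bd := one_le_mul_of_one_le_of_one_le hfac (one_le_pow₀ hXK)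
    have hdet : ∀ N : Matrix ι ι ℂ, (∀ l i, ‖N l i‖ ≤ X ^ K) → ‖N.det‖ ≤ Bd := by
      intro N hN
      have := Matrix.det_le (A := N) (abv := NormedField.toAbsoluteValue ℂ) hN
      rwa [nsmul_eq_mul] at this
    have h1 := circleAverage_max_re_le (hg i) hD hD0 (hcramer i) (by linarith : 0 < r) hBd1
      (fun z hz => hdet _ fun l i => hent l i z hz) (by
        intro z hz
        rw [Matrix.cramer_apply]
        refine hdet _ fun l j => ?_
        rw [Matrix.updateCol_apply]
        split_ifs
        · rw [he]
          dsimp only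
          split_ifs
          · simpa using hXK
          · simpa using zero_le_one.trans hXK
        · exact hent l j z hz)
    have h2 := circleAverage_abs_re_eq (hg i) r
    have hXle : X ≤ 2 * c ^ 2 * ((2 + r) * (1 + A (r + δ)) / δ ^ 2) := by
      have e0 := hA0 (r + δ)
      have e1 : 1 ≤ c ^ 2 / δ ^ 2 := by
        rw [one_le_div (by positivity)]
        gcongr
        linarith
      have e2 : 1 / δ' ≤ c ^ 2 / δ ^ 2 := by
        have h3 : 1 ≤ c / δ := by rw [one_le_div hδ]; linarith
        have h4 : 1 / δ' = c / δ := by rw [hδ']; field_simp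
        rw [h4, ← div_pow]
        nlinarith
      have e3 : B ≤ c ^ 2 / δ ^ 2 * (2 * (r + 1) * A (r + δ)) := by
        have : B = c ^ 2 / δ ^ 2 * (2 * (r + δ) * A (r + δ)) := by
          rw [hB, hδ']; field_simp
        rw [this]
        gcongr
      have e4 : 2 * c ^ 2 * ((2 + r) * (1 + A (r + δ)) / δ ^ 2) =
          c ^ 2 / δ ^ 2 * (2 * (2 + r) * (1 + A (r + δ))) := by field_simp
      rw [e4]
      have e5 : X ≤ c ^ 2 / δ ^ 2 * (2 + 2 * (r + 1) * A (r + δ)) := by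
        rw [hX]; linarith
      refine e5.trans ?_
      gcongr
      nlinarith
    have hQ : 0 < (2 + r) * (1 + A (r + δ)) / δ ^ 2 := by
      have e0 := hA0 (r + δ)
      have : 0 < 2 + r := by linarith
      positivity
    have h3 : Real.log Bd ≤ Real.log s.factorial + K * s * (Real.log (2 * c ^ 2) +
        Real.log ((2 + r) * (1 + A (r + δ)) / δ ^ 2)) := by
      rw [hBd, Real.log_mul (by positivity) (by positivity), ← pow_mul, Real.log_pow,
        ← Real.log_mul (by positivity) hQ.ne']
      push_cast
      gcongr
    have h4 : -(g i 0).re ≤ |(g i 0).re| := neg_le_abs _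
    have h5 : Ai i r = 2 * circleAverage (fun z => max (g i z).re 0) 0 r - (g i 0).re := h2
    linarith
  set C₁ : ℝ := |Real.log s.factorial| + K * s * Real.log (2 * c ^ 2) + |Real.log ‖(M 0).det‖|
    with hC₁
  have hlc : 0 ≤ Real.log (2 * c ^ 2) := Real.log_nonneg (by nlinarith)
  have hC₁0 : 0 ≤ C₁ := by positivity
  set C : ℝ := 1 + s * (2 * C₁ + 2 * (K * s)) + ∑ i, |(g i 0).re| with hC
  have hS0 : 0 ≤ ∑ i, |(g i 0).re| := Finset.sum_nonneg fun i _ => abs_nonneg _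
  have hC1 : 1 ≤ C := by
    have : 0 ≤ s * (2 * C₁ + 2 * (K * s)) := by positivity
    linarith
  have hgrowth : ∀ r ≥ 1, ∀ δ > 0, δ ≤ 1 →
      A r ≤ C * (1 + Real.log ((2 + r) * (1 + A (r + δ)) / δ ^ 2)) := by
    intro r hr δ hδ hδ1
    set Q := Real.log ((2 + r) * (1 + A (r + δ)) / δ ^ 2) with hQ
    have hQ0 : 0 ≤ Q := by
      apply Real.log_nonneg
      rw [one_le_div (by positivity)]
      have : δ ^ 2 ≤ 1 := pow_le_one₀ hδ.le hδ1
      nlinarith [hA0 (r + δ)]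
    calc A r ≤ ∑ i, ((2 * C₁ + 2 * (K * s) * Q) + |(g i 0).re|) := by
          refine Finset.sum_le_sum fun i _ => ?_
          have h1 := hmain r hr δ hδ hδ1 i
          have h2 := le_abs_self (Real.log s.factorial)
          have h3 := neg_le_abs (Real.log ‖(M 0).det‖)
          rw [hC₁]
          linarith
      _ = s * (2 * C₁ + 2 * (K * s) * Q) + ∑ i, |(g i 0).re| := by
          rw [Finset.sum_add_distrib, Finset.sum_const, Finset.card_univ, nsmul_eq_mul]
      _ ≤ C * (1 + Q) := by
          have e1 : 0 ≤ (s : ℝ) * (2 * C₁) * Q := by positivity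
          have e2 : 0 ≤ (s : ℝ) * (2 * (K * s)) := by positivity
          have e3 : 0 ≤ (∑ i, |(g i 0).re|) * Q := by positivity
          rw [hC]
          linarith
  obtain ⟨K', hK'⟩ := exists_le_mul_one_add_log_of_le hAc hA0 hC1 hgrowth
  exact eq_apply_zero_of_circleAverage_abs_re_le (hg i) (fun r hr => (hAiA i r).trans (hK' r hr)) z


/-! ### Borel's theorem. -/

theorem exists_differentiable_exp_eq {V : ℂ → ℂ} (hV : Differentiable ℂ V) (h0 : ∀ z, V z ≠ 0) :
    ∃ g : ℂ → ℂ, Differentiable ℂ g ∧ ∀ z, Complex.exp (g z) = V z := by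
  have hq : Differentiable ℂ fun z => deriv V z / V z := hV.deriv.div hV h0
  obtain ⟨g, hg⟩ := hq.isExactOn_univ
  have hg' : ∀ z, HasDerivAt g (deriv V z / V z) z := fun z => hg z trivial
  have hconst : ∀ z, V z * Complex.exp (-g z) = V 0 * Complex.exp (-g 0) := by
    intro z
    refine is_const_of_deriv_eq_zero (f := fun z => V z * Complex.exp (-g z)) ?_ ?_ z 0
    · exact hV.mul (Differentiable.cexp fun z => (hg' z).differentiableAt.neg)
    · intro w
      have := (hV w).hasDerivAt.fun_mul (hg' w).fun_neg.cexp
      rw [this.deriv]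
      have := h0 w
      field_simp
      ring
  obtain ⟨a, ha⟩ : ∃ a, Complex.exp a = V 0 * Complex.exp (-g 0) :=
    ⟨_, Complex.exp_log (mul_ne_zero (h0 0) (Complex.exp_ne_zero _))⟩
  refine ⟨fun z => g z + a, fun z => (hg' z).differentiableAt.add_const a, fun z => ?_⟩
  rw [Complex.exp_add, ha, ← hconst z, mul_comm, mul_assoc, ← Complex.exp_add]
  simp

/-- **Borel's theorem** on linear relations between entire functions without zeros. -/
theorem exists_eq_const_mul_of_sum_eq_zero {ι : Type} [Fintype ι] {U : ι → ℂ → ℂ}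
    (hU : ∀ i, Differentiable ℂ (U i)) (hU0 : ∀ i z, U i z ≠ 0) {c : ι → ℂ}
    (hsum : ∀ z, ∑ i, c i * U i z = 0) {i₀ : ι} (hi₀ : c i₀ ≠ 0) :
    ∃ i, i ≠ i₀ ∧ c i ≠ 0 ∧ ∃ a : ℂ, ∀ z, U i z = a * U i₀ z := by
  classical
  let S := {i : ι // i ≠ i₀ ∧ c i ≠ 0}
  let V : S → ℂ → ℂ := fun i z => U i z / U i₀ z
  obtain ⟨κ, a, hainj, hspan, hli⟩ := exists_linearIndependent' ℂ V
  have : Finite κ := Finite.of_injective a hainj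
  have := Fintype.ofFinite κ
  -- Dividing the relation by its i₀ term writes 1 as a combination of the quotients, hence of an
  -- independent subfamily. The terms with nonzero coefficients are exponentials with sum 1, so each
  -- is constant; at least one occurs, since an empty sum is not 1.
  have hone : (fun _ => 1 : ℂ → ℂ) ∈ Submodule.span ℂ (Set.range (V ∘ a)) := by
    rw [hspan]
    have h1 : (fun _ => 1 : ℂ → ℂ) = ∑ i : S, (-c i / c i₀) • V i := by
      ext z
      have h2 := hsum z
      rw [← Finset.add_sum_erase _ _ (Finset.mem_univ i₀)] at h2
      have h3 : ∑ i ∈ Finset.univ.erase i₀, c i * U i z = ∑ i : S, c i * U i z := by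
        rw [← Finset.sum_subtype {i | i ≠ i₀ ∧ c i ≠ 0} (by simp) fun i => c i * U i z]
        refine (Finset.sum_subset ?_ ?_).symm
        · intro i hi
          simpa using (Finset.mem_filter.1 hi).2.1
        · intro i hi hi'
          simp only [Finset.mem_erase, Finset.mem_univ, and_true] at hi
          have : c i = 0 := by
            by_contra h
            exact hi' (by simp [hi, h])
          simp [this]
      simp only [Finset.sum_apply, Pi.smul_apply, smul_eq_mul, V]
      have h4 : ∀ i : S, -c i / c i₀ * (U i z / U i₀ z) = -(c i * U i z) / (c i₀ * U i₀ z) :=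
        fun i => by rw [div_mul_div_comm]; ring
      rw [Finset.sum_congr rfl fun i _ => h4 i, ← Finset.sum_div, Finset.sum_neg_distrib]
      rw [eq_div_iff (mul_ne_zero hi₀ (hU0 _ _))]
      rw [h3] at h2
      linear_combination h2
    rw [h1]
    exact Submodule.sum_mem _ fun i _ => Submodule.smul_mem _ _ (Submodule.subset_span ⟨i, rfl⟩)
  obtain ⟨d, hd⟩ := (Submodule.mem_span_range_iff_exists_fun ℂ).1 hone
  let T := {j : κ // d j ≠ 0}
  have hex : ∀ j : T, ∃ g : ℂ → ℂ, Differentiable ℂ g ∧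
      ∀ z, Complex.exp (g z) = d j * V (a j) z := by
    intro j
    refine exists_differentiable_exp_eq (((hU _).div (hU _) (hU0 _)).const_mul _) fun z => ?_
    exact mul_ne_zero j.2 (div_ne_zero (hU0 _ _) (hU0 _ _))
  choose g hg hgV using hex
  have hsumT : ∀ z, ∑ j : T, Complex.exp (g j z) = 1 := by
    intro z
    have h1 := congrFun hd z
    simp only [Finset.sum_apply, Pi.smul_apply, smul_eq_mul, Function.comp_apply] at h1
    simp only [hgV]
    rw [← h1]
    rw [← Finset.sum_subtype {j | d j ≠ 0} (by simp) fun j => d j * V (a j) z]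
    refine Finset.sum_subset (Finset.subset_univ _) fun j _ hj => ?_
    simp only [Finset.mem_filter, Finset.mem_univ, true_and, not_not] at hj
    simp [hj]
  have hliT : LinearIndependent ℂ fun (j : T) z => Complex.exp (g j z) := by
    have h1 : LinearIndependent ℂ ((V ∘ a) ∘ (Subtype.val : T → κ)) :=
      hli.comp _ Subtype.val_injective
    have h2 := h1.units_smul fun j => Units.mk0 (d j) j.2
    convert h2 using 1
    ext j z
    simp [hgV, Units.smul_def]
  have hne : Nonempty T := by
    by_contra h
    rw [not_nonempty_iff] at h
    simpa using hsumT 0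
  obtain ⟨j⟩ := hne
  refine ⟨a j, (a j).2.1, (a j).2.2, Complex.exp (g j 0) / d j, fun z => ?_⟩
  have h1 := eq_apply_zero_of_sum_exp_eq_one hg hsumT hliT j z
  have h2 := hgV j z
  rw [h1] at h2
  have := hU0 i₀ z
  have := j.2
  rw [h2]
  simp only [V]
  field_simp


/-! ### Combinatorics of real weights. -/

/-- Exchange argument: the differences of the two sets have equal size, and every weight in one
exceeds the largest weight in the other. -/
theorem sum_lt_sum_of_forall_lt_of_card_eq {κ : Type} [DecidableEq κ] {P : κ → ℝ}
    {s₀ s : Finset κ} (hlt : ∀ i ∈ s₀, ∀ j ∉ s₀, P i < P j) (hne : s ≠ s₀)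
    (hcard : s.card = s₀.card) : ∑ i ∈ s₀, P i < ∑ i ∈ s, P i := by
  have hc : (s₀ \ s).card = (s \ s₀).card := Finset.card_sdiff_comm hcard.symm
  have hne1 : (s \ s₀).Nonempty := by
    rw [Finset.sdiff_nonempty]
    exact fun h => hne (Finset.eq_of_subset_of_card_le h hcard.ge)
  have hne2 : (s₀ \ s).Nonempty := by rw [← Finset.card_pos, hc]; exact hne1.card_pos
  obtain ⟨m, hm, hmax⟩ := (s₀ \ s).exists_max_image P hne2
  have h1 : ∑ i ∈ s₀ \ s, P i ≤ (s₀ \ s).card • P m := Finset.sum_le_card_nsmul _ _ _ hmax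
  have h2 : (s \ s₀).card • P m < ∑ i ∈ s \ s₀, P i := by
    rw [← Finset.sum_const]
    refine Finset.sum_lt_sum_of_nonempty hne1 fun i hi => ?_
    exact hlt m (Finset.mem_sdiff.1 hm).1 i (Finset.mem_sdiff.1 hi).2
  rw [← Finset.sum_inter_add_sum_sdiff s₀ s, ← Finset.sum_inter_add_sum_sdiff s s₀,
    Finset.inter_comm s s₀]
  rw [hc] at h1
  linarith

/-- Given real weights such that the weights of `N + 1` indices among `n + N + 2` never determine
these indices, sufficiently many of the weights coincide. -/
theorem exists_injective_of_sum_eq {n N q : ℕ} (hnN : n ≤ N)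
    (hq : min (N + 2 * n + 2) (max (2 * N + 1) (3 * n + 2)) ≤ q) (p : Fin q → ℝ)
    (h : ∀ e : Fin (n + 1) ⊕ Fin (N + 1) → Fin q, Function.Injective e →
      ∀ s₀ : Finset (Fin (n + 1) ⊕ Fin (N + 1)), s₀.card = N + 1 →
      ∃ s ≠ s₀, s.card = N + 1 ∧ ∑ r ∈ s, p (e r) = ∑ r ∈ s₀, p (e r)) :
    ∃ k : Fin (n + 2) → Fin q, Function.Injective k ∧ ∀ i j, p (k i) = p (k j) := by
  classical
  set σ := Tuple.sort p
  have hσ : ∀ a b : Fin q, a ≤ b → p (σ a) ≤ p (σ b) := fun a b hab => Tuple.monotone_sort p hab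
  have hqn : n + N + 2 ≤ q := by omega
  set s₀ : Finset (Fin (n + 1) ⊕ Fin (N + 1)) := Finset.univ.map ⟨Sum.inr, Sum.inr_injective⟩
  have hs₀ : s₀.card = N + 1 := by simp [s₀]
  have hinr : ∀ j, Sum.inr j ∈ s₀ := fun j => by simp [s₀]
  have hinl : ∀ j, Sum.inl j ∉ s₀ := fun j => by simp [s₀]
  have key1 : ∀ e : Fin (n + 1) ⊕ Fin (N + 1) → Fin q, Function.Injective e →
      ¬ ∀ i j, p (e (Sum.inr j)) < p (e (Sum.inl i)) := by
    intro e he hlt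
    obtain ⟨s, hs, hcard, hsum⟩ := h e he s₀ hs₀
    refine (sum_lt_sum_of_forall_lt_of_card_eq (P := fun r => p (e r)) (s₀ := s₀) (s := s) ?_ hs
      (hcard.trans hs₀.symm)).ne' hsum
    rintro (i | i) hi (j | j) hj
    · exact absurd hi (hinl i)
    · exact absurd hi (hinl i)
    · exact hlt j i
    · exact absurd (hinr j) hj
  have key2 : ∀ e : Fin (n + 1) ⊕ Fin (N + 1) → Fin q, Function.Injective e →
      ¬ ∀ i j, p (e (Sum.inl i)) < p (e (Sum.inr j)) := by
    intro e he hlt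
    obtain ⟨s, hs, hcard, hsum⟩ := h e he s₀ hs₀
    have := sum_lt_sum_of_forall_lt_of_card_eq (P := fun r => -p (e r)) (s₀ := s₀) (s := s) ?_ hs
      (hcard.trans hs₀.symm)
    · simp only [Finset.sum_neg_distrib, neg_lt_neg_iff] at this
      exact this.ne hsum
    rintro (i | i) hi (j | j) hj
    · exact absurd hi (hinl i)
    · exact absurd hi (hinl i)
    · exact neg_lt_neg (hlt j i)
    · exact absurd (hinr j) hj
  -- If the N + 1 smallest weights were all below the n + 1 largest, their sum would be attained
  -- only once among these indices. Hence the sorted weights at positions N, …, q − n − 1 (counted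
  -- from 0) coincide.
  have h1 : p (σ ⟨q - n - 1, by omega⟩) ≤ p (σ ⟨N, by omega⟩) := by
    by_contra! hlt
    refine key1 (σ ∘ Sum.elim (fun i => ⟨q - n - 1 + i, by omega⟩) fun j => ⟨j, by omega⟩)
      (σ.injective.comp ?_) ?_
    · rintro (i | i) (j | j) hij <;> (simp [Fin.ext_iff] at hij ⊢; omega)
    · intro i j
      refine ((hσ _ _ ?_).trans_lt hlt).trans_le (hσ _ _ ?_) <;> simp [Fin.le_def] <;> omega
  -- Likewise for the N + 1 largest against the n + 1 smallest: positions n, …, q − N − 1 coincide.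
  have h2 : p (σ ⟨q - N - 1, by omega⟩) ≤ p (σ ⟨n, by omega⟩) := by
    by_contra! hlt
    refine key2 (σ ∘ Sum.elim (fun i => ⟨i, by omega⟩) fun j => ⟨q - N - 1 + j, by omega⟩)
      (σ.injective.comp ?_) ?_
    · rintro (i | i) (j | j) hij <;> (simp [Fin.ext_iff] at hij ⊢; omega)
    · intro i j
      refine ((hσ _ _ ?_).trans_lt hlt).trans_le (hσ _ _ ?_) <;> simp [Fin.le_def] <;> omega
  obtain ⟨st, hst, hle⟩ : ∃ st, ∃ hst : st + (n + 2) ≤ q,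
      p (σ ⟨st + (n + 1), by omega⟩) ≤ p (σ ⟨st, by omega⟩) := by
    -- For q ≥ N + 2n + 2 the first block alone has n + 2 members. Otherwise q ≥ 2N + 1 makes the
    -- two blocks overlap, and their union n, …, q − n − 1 has q − 2n ≥ n + 2 members.
    by_cases hcase : N + 2 * n + 2 ≤ q
    · refine ⟨N, by omega, (hσ _ _ ?_).trans h1⟩
      simp [Fin.le_def]; omega
    · have h3 : 2 * N + 1 ≤ q ∧ 3 * n + 2 ≤ q := by omega
      refine ⟨n, by omega, (hσ _ _ ?_).trans ((h1.trans (hσ _ _ ?_)).trans h2)⟩ <;>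
        (simp [Fin.le_def]; omega)
  have hall : ∀ i : Fin (n + 2), p (σ ⟨st + i, by omega⟩) = p (σ ⟨st, by omega⟩) := by
    intro i
    refine le_antisymm ((hσ _ _ ?_).trans hle) (hσ _ _ ?_) <;> simp [Fin.le_def]; omega
  refine ⟨fun i => σ ⟨st + i, by omega⟩, ?_, fun i j => (hall i).trans (hall j).symm⟩
  intro i j hij
  have := σ.injective hij
  simpa [Fin.ext_iff] using this

/-! ### General position and the determinant relation. -/

/-- At least `n + 1` forms in general position have no common nontrivial zero. -/
theorem eq_zero_of_forall_apply_eq_zero {κ : Type} {n : ℕ} {a : κ → LinForm n}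
    (ha : ∀ s : Finset κ, s.card ≤ n + 1 → LinearIndependent ℂ fun j : s => a j)
    {t : Finset κ} (ht : n + 1 ≤ t.card) {x : Fin (n + 1) → ℂ} (hx : ∀ r ∈ t, a r x = 0) :
    x = 0 := by
  obtain ⟨u, hut, hu⟩ := Finset.exists_subset_card_eq ht
  have hli := ha u hu.le
  have hspan : Submodule.span ℂ (Set.range fun j : u => a j) = ⊤ := by
    apply hli.span_eq_top_of_card_eq_finrank'
    simp [hu, Subspace.dual_finrank_eq]
  have hall : ∀ φ : LinForm n, φ x = 0 := by
    intro φ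
    have hφ : φ ∈ Submodule.span ℂ (Set.range fun j : u => a j) := hspan ▸ Submodule.mem_top
    have hle : Submodule.span ℂ (Set.range fun j : u => a j) ≤
        LinearMap.ker (Module.Dual.eval ℂ (Fin (n + 1) → ℂ) x) := by
      rw [Submodule.span_le]
      rintro _ ⟨j, rfl⟩
      exact hx j (hut j.2)
    exact hle hφ
  ext i
  exact hall (LinearMap.proj i)

theorem exists_ne_zero_forall_apply_eq_zero {κ : Type} {n : ℕ} (a : κ → LinForm n)
    {t : Finset κ} (ht : t.card < n + 1) : ∃ x : Fin (n + 1) → ℂ, x ≠ 0 ∧ ∀ r ∈ t, a r x = 0 := by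
  have h1 : LinearMap.ker (LinearMap.pi fun r : t => a r) ≠ ⊥ := by
    apply LinearMap.ker_ne_bot_of_finrank_lt
    simpa using ht
  obtain ⟨x, hx, hx0⟩ := Submodule.exists_mem_ne_zero_of_ne_bot h1
  refine ⟨x, hx0, fun r hr => ?_⟩
  exact congrFun (LinearMap.mem_ker.1 hx) ⟨r, hr⟩

theorem apply_eq_sum_single {n : ℕ} (l : LinForm n) (x : Fin (n + 1) → ℂ) :
    l x = ∑ i, l (Pi.single i 1) * x i := by
  rw [LinearMap.pi_apply_eq_sum_univ l x]
  refine Finset.sum_congr rfl fun i _ => ?_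
  rw [smul_eq_mul, mul_comm]
  congr 2
  ext j
  simp [Pi.single_apply, eq_comm]

/-- The coordinates of a pair of linear forms, as a form in two groups of variables. -/
noncomputable def pairCoeffs {n N : ℕ} (l : LinForm n) (l' : LinForm N) :
    Fin (n + 1) ⊕ Fin (N + 1) → ℂ :=
  Sum.elim (fun i => l (Pi.single i 1)) fun j => l' (Pi.single j 1)

theorem sum_pairCoeffs_mul {n N : ℕ} (l : LinForm n) (l' : LinForm N)
    (v : Fin (n + 1) ⊕ Fin (N + 1) → ℂ) :
    ∑ c, pairCoeffs l l' c * v c = l (v ∘ Sum.inl) + l' (v ∘ Sum.inr) := by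
  rw [Fintype.sum_sum_type, apply_eq_sum_single l, apply_eq_sum_single l']
  rfl

-- Rows in s see only the last N + 1 variables, the others only the first n + 1. If the blocks are
-- not square, one of them has fewer equations than unknowns; if they are, general position leaves
-- only the zero solution.
open Finset in
theorem det_piecewise_ne_zero_iff {n N : ℕ} {a : Fin (n + 1) ⊕ Fin (N + 1) → LinForm n}
    {b : Fin (n + 1) ⊕ Fin (N + 1) → LinForm N}
    (ha : ∀ s : Finset (Fin (n + 1) ⊕ Fin (N + 1)), s.card ≤ n + 1 →
      LinearIndependent ℂ fun j : s => a j)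
    (hb : ∀ s : Finset (Fin (n + 1) ⊕ Fin (N + 1)), s.card ≤ N + 1 →
      LinearIndependent ℂ fun j : s => b j)
    (s : Finset (Fin (n + 1) ⊕ Fin (N + 1))) :
    (Matrix.of (s.piecewise (fun r => pairCoeffs 0 (b r)) fun r => pairCoeffs (a r) 0)).det ≠ 0 ↔
      s.card = N + 1 := by
  classical
  set M := Matrix.of (s.piecewise (fun r => pairCoeffs 0 (b r)) fun r => pairCoeffs (a r) 0)
  have hM1 : ∀ r ∈ s, ∀ v, M.mulVec v r = b r (v ∘ Sum.inr) := by
    intro r hr v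
    have := sum_pairCoeffs_mul 0 (b r) v
    simp only [LinearMap.zero_apply, zero_add] at this
    rw [← this]
    simp [M, Matrix.mulVec, dotProduct, hr]
  have hM2 : ∀ r ∉ s, ∀ v, M.mulVec v r = a r (v ∘ Sum.inl) := by
    intro r hr v
    have := sum_pairCoeffs_mul (a r) 0 v
    simp only [LinearMap.zero_apply, add_zero] at this
    rw [← this]
    simp [M, Matrix.mulVec, dotProduct, hr]
  have hcard : s.card + sᶜ.card = n + N + 2 := by
    rw [card_add_card_compl]; simp; ring
  constructor
  · intro hdet
    by_contra hne
    apply hdet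
    rw [← Matrix.exists_mulVec_eq_zero_iff]
    rcases lt_or_gt_of_ne hne with hlt | hgt
    · obtain ⟨y, hy, hyb⟩ := exists_ne_zero_forall_apply_eq_zero b hlt
      refine ⟨Sum.elim 0 y, fun h => hy ?_, ?_⟩
      · simpa using congrArg (· ∘ Sum.inr) h
      · ext r
        by_cases hr : r ∈ s
        · rw [hM1 r hr]; simpa using hyb r hr
        · rw [hM2 r hr]; simp
    · obtain ⟨x, hx, hxa⟩ := exists_ne_zero_forall_apply_eq_zero a (t := sᶜ) (by omega)
      refine ⟨Sum.elim x 0, fun h => hx ?_, ?_⟩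
      · simpa using congrArg (· ∘ Sum.inl) h
      · ext r
        by_cases hr : r ∈ s
        · rw [hM1 r hr]; simp
        · rw [hM2 r hr]; simpa using hxa r (by simpa using hr)
  · intro hs hdet
    obtain ⟨v, hv, hMv⟩ := Matrix.exists_mulVec_eq_zero_iff.2 hdet
    apply hv
    have h1 : v ∘ Sum.inr = 0 := eq_zero_of_forall_apply_eq_zero hb hs.ge fun r hr => by
      rw [← hM1 r hr, hMv]; rfl
    have h2 : v ∘ Sum.inl = 0 := eq_zero_of_forall_apply_eq_zero ha (t := sᶜ) (by omega)
      fun r hr => by rw [← hM2 r (by simpa using hr), hMv]; rfl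
    ext (i | i)
    · exact congrFun h2 i
    · exact congrFun h1 i

-- Multilinearity in the rows, each split as (a r, 0) + x r · (0, b r).
open Finset in
theorem det_add_smul_eq_sum {n N : ℕ} (a : Fin (n + 1) ⊕ Fin (N + 1) → LinForm n)
    (b : Fin (n + 1) ⊕ Fin (N + 1) → LinForm N) (x : Fin (n + 1) ⊕ Fin (N + 1) → ℂ) :
    (Matrix.of fun r => pairCoeffs (a r) (x r • b r)).det = ∑ s : Finset _,
      (Matrix.of (s.piecewise (fun r => pairCoeffs 0 (b r)) fun r => pairCoeffs (a r) 0)).det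
        * ∏ r ∈ s, x r := by
  classical
  have h1 : (Matrix.of fun r => pairCoeffs (a r) (x r • b r)) =
      Matrix.of ((fun r => x r • pairCoeffs 0 (b r)) + fun r => pairCoeffs (a r) 0) := by
    ext r (c | c) <;> simp [pairCoeffs]
  have h2 := MultilinearMap.map_add_univ (Matrix.detRowAlternating (R := ℂ)
    (n := Fin (n + 1) ⊕ Fin (N + 1))).toMultilinearMap
    (fun r => x r • pairCoeffs 0 (b r)) fun r => pairCoeffs (a r) 0
  rw [h1]
  refine h2.trans (sum_congr rfl fun s _ => ?_)
  have h3 : s.piecewise (fun r => x r • pairCoeffs 0 (b r)) (fun r => pairCoeffs (a r) 0) =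
      fun r => (if r ∈ s then x r else 1) •
        s.piecewise (fun r => pairCoeffs 0 (b r)) (fun r => pairCoeffs (a r) 0) r := by
    ext r c
    by_cases hr : r ∈ s <;> simp [hr]
  rw [h3, MultilinearMap.map_smul_univ, smul_eq_mul, mul_comm, prod_ite_mem, univ_inter]
  rfl

theorem InGeneralPosition.linearIndependent_comp {n q : ℕ} {l : Fin q → LinForm n}
    (hl : InGeneralPosition l) {κ : Type} {e : κ → Fin q} (he : Function.Injective e)
    {s : Finset κ} (hs : s.card ≤ n + 1) : LinearIndependent ℂ fun j : s => l (e j) := by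
  have h1 := hl (s.map ⟨e, he⟩) (by simpa using hs)
  have hmem : ∀ j : s, e j ∈ s.map ⟨e, he⟩ := fun j => Finset.mem_map_of_mem ⟨e, he⟩ j.2
  exact h1.comp (fun j : s => ⟨e j, hmem j⟩) fun i j hij => Subtype.ext (he (Subtype.ext_iff.1 hij))

/-- The vector (X, −Y) lies in the kernel of the matrix with rows (H, U·H'), so its determinant
vanishes on a dense set and by continuity everywhere. Borel's theorem applies to the expansion,
where exactly the products of N + 1 factors have nonzero coefficients. -/
theorem exists_prod_eq_const_mul_prod {n N q : ℕ} {H : Fin q → LinForm n} {H' : Fin q → LinForm N}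
    (hH : InGeneralPosition H) (hH' : InGeneralPosition H') {U : Fin q → ℂ → ℂ}
    (hU : ∀ j, Differentiable ℂ (U j)) (hU0 : ∀ j z, U j z ≠ 0)
    (hdense : Dense {t | ∃ X Y, X ≠ 0 ∧ ∀ j, H j X = U j t * H' j Y})
    {e : Fin (n + 1) ⊕ Fin (N + 1) → Fin q} (he : Function.Injective e)
    {s₀ : Finset (Fin (n + 1) ⊕ Fin (N + 1))} (hs₀ : s₀.card = N + 1) :
    ∃ s ≠ s₀, s.card = N + 1 ∧ ∃ a : ℂ, ∀ t, ∏ r ∈ s, U (e r) t = a * ∏ r ∈ s₀, U (e r) t := by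
  have hiff := det_piecewise_ne_zero_iff (a := fun r => H (e r))
    (b := fun r => H' (e r)) (fun _ hs => hH.linearIndependent_comp he hs)
    fun _ hs => hH'.linearIndependent_comp he hs
  have hUc : ∀ j, Continuous (U j) := fun j => (hU j).continuous
  have hzero : ∀ t, (Matrix.of fun r => pairCoeffs (H (e r)) (U (e r) t • H' (e r))).det = 0 := by
    have hcont : Continuous fun t =>
        (Matrix.of fun r => pairCoeffs (H (e r)) (U (e r) t • H' (e r))).det := by
      simp only [det_add_smul_eq_sum]
      fun_prop
    refine fun t => congrFun (hcont.ext_on hdense (continuous_const (y := (0 : ℂ))) ?_) t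
    rintro t ⟨X, Y, hX, hXY⟩
    refine Matrix.exists_mulVec_eq_zero_iff.1 ⟨Sum.elim X (-Y), fun h => hX ?_, ?_⟩
    · simpa using congrArg (· ∘ Sum.inl) h
    · ext r
      have := sum_pairCoeffs_mul (H (e r)) (U (e r) t • H' (e r)) (Sum.elim X (-Y))
      refine this.trans ?_
      simp [hXY]
  obtain ⟨c, hc, hsum⟩ : ∃ c : Finset (Fin (n + 1) ⊕ Fin (N + 1)) → ℂ,
      (∀ s, c s ≠ 0 ↔ s.card = N + 1) ∧ ∀ t, ∑ s, c s * ∏ r ∈ s, U (e r) t = 0 :=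
    ⟨_, hiff, fun t => (det_add_smul_eq_sum _ _ _).symm.trans (hzero t)⟩
  obtain ⟨s, hs, hcs, a, ha⟩ := exists_eq_const_mul_of_sum_eq_zero
    (U := fun (s : Finset (Fin (n + 1) ⊕ Fin (N + 1))) t => ∏ r ∈ s, U (e r) t)
    (fun s => Differentiable.fun_finsetProd fun r _ => hU (e r))
    (fun s z => Finset.prod_ne_zero_iff.2 fun r _ => hU0 _ _) hsum ((hc s₀).2 hs₀)
  exact ⟨s, hs, (hc s).1 hcs, a, ha⟩

/-- Among nowhere vanishing entire functions relating two families of hyperplanes in general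
position, sufficiently many have the same growth between two given points. -/
theorem exists_injective_norm_div_eq {n N q : ℕ} (hnN : n ≤ N)
    (hq : min (N + 2 * n + 2) (max (2 * N + 1) (3 * n + 2)) ≤ q)
    {H : Fin q → LinForm n} {H' : Fin q → LinForm N}
    (hH : InGeneralPosition H) (hH' : InGeneralPosition H') {U : Fin q → ℂ → ℂ}
    (hU : ∀ j, Differentiable ℂ (U j)) (hU0 : ∀ j z, U j z ≠ 0)
    (hdense : Dense {t | ∃ X Y, X ≠ 0 ∧ ∀ j, H j X = U j t * H' j Y}) (t₀ t₁ : ℂ) :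
    ∃ k : Fin (n + 2) → Fin q, Function.Injective k ∧
      ∀ i j, ‖U (k i) t₀‖ / ‖U (k i) t₁‖ = ‖U (k j) t₀‖ / ‖U (k j) t₁‖ := by
  have hpos : ∀ j t, 0 < ‖U j t‖ := fun j t => norm_pos_iff.2 (hU0 j t)
  -- Ratios at two points cancel the constant of proportionality; logarithms turn products into sums
  -- of weights.
  obtain ⟨k, hk, hkp⟩ := exists_injective_of_sum_eq hnN hq
    (fun j => Real.log (‖U j t₀‖ / ‖U j t₁‖)) (fun e he s₀ hs₀ => by
      obtain ⟨s, hs, hcard, a, ha⟩ := exists_prod_eq_const_mul_prod hH hH' hU hU0 hdense he hs₀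
      refine ⟨s, hs, hcard, ?_⟩
      rw [← Real.log_prod fun r _ => (div_pos (hpos _ _) (hpos _ _)).ne',
        ← Real.log_prod fun r _ => (div_pos (hpos _ _) (hpos _ _)).ne']
      simp only [Finset.prod_div_distrib, ← norm_prod, ha, norm_mul]
      congr 1
      have h1 : a ≠ 0 := by
        rintro rfl
        have := ha t₀
        rw [zero_mul, Finset.prod_eq_zero_iff] at this
        obtain ⟨r, -, hr⟩ := this
        exact hU0 _ _ hr
      rw [mul_div_mul_left _ _ (norm_ne_zero_iff.2 h1)])
  exact ⟨k, hk, fun i j => Real.log_injOn_pos (Set.mem_Ioi.2 (div_pos (hpos _ _) (hpos _ _)))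
    (Set.mem_Ioi.2 (div_pos (hpos _ _) (hpos _ _))) (hkp i j)⟩


/-! ### Order of vanishing as a growth condition. -/

section VanishingOrder

variable {E : Type*} [NormedAddCommGroup E] [NormedSpace ℂ E]

open Asymptotics in
theorem AnalyticAt.isBigO_norm_pow_of_iteratedFDeriv_eq_zero {φ : E → ℂ} {x : E}
    (hφ : AnalyticAt ℂ φ x) {k : ℕ} (h : ∀ j < k, iteratedFDeriv ℂ j φ x = 0) :
    (fun y => φ (x + y)) =O[𝓝 0] fun y => ‖y‖ ^ k := by
  obtain ⟨p, r, hp⟩ := hφ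
  have h1 := hp.hasFPowerSeriesAt.isBigO_sub_partialSum_pow k
  refine h1.congr_left fun y => ?_
  rw [sub_eq_self, FormalMultilinearSeries.partialSum]
  refine Finset.sum_eq_zero fun j hj => ?_
  have h2 := hp.factorial_smul y j
  rw [h j (Finset.mem_range.1 hj), zero_apply] at h2
  exact (smul_eq_zero.1 h2).resolve_left j.factorial_ne_zero

-- By induction each lower Taylor term is a homogeneous polynomial too small for its degree, so it
-- vanishes on the diagonal. Symmetry of the iterated derivative and polarization then kill the
-- whole multilinear map.
open Asymptotics in
theorem AnalyticAt.iteratedFDeriv_eq_zero_of_isBigO_norm_pow {φ : E → ℂ} {x : E}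
    (hφ : AnalyticAt ℂ φ x) {k : ℕ} (h : (fun y => φ (x + y)) =O[𝓝 0] fun y => ‖y‖ ^ k)
    {j : ℕ} (hj : j < k) : iteratedFDeriv ℂ j φ x = 0 := by
  obtain ⟨p, r, hp⟩ := id hφ
  have hdiag : ∀ j < k, ∀ y, (p j fun _ => y) = 0 := by
    intro j
    induction j using Nat.strong_induction_on with
    | _ j ih =>
      intro hj
      have psum_eq : p.partialSum (j + 1) = fun y => p j fun _ => y := by
        funext z
        refine Finset.sum_eq_single _ (fun b hb hnb => ?_) fun hn => ?_
        · have := Finset.mem_range_succ_iff.mp hb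
          exact ih b (this.lt_of_ne hnb) ((this.lt_of_ne hnb).trans hj) z
        · exact (hn (Finset.mem_range.mpr (lt_add_one j))).elim
      have h1 := hp.hasFPowerSeriesAt.isBigO_sub_partialSum_pow (j + 1)
      rw [psum_eq] at h1
      have h2 : (fun y => φ (x + y)) =O[𝓝 0] fun y => ‖y‖ ^ (j + 1) := by
        refine h.trans (IsBigO.of_bound 1 ?_)
        filter_upwards [Metric.ball_mem_nhds (0 : E) one_pos] with y hy
        rw [mem_ball_zero_iff] at hy
        rw [one_mul, norm_pow, norm_pow, norm_norm]
        exact pow_le_pow_of_le_one (norm_nonneg _) hy.le hj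
      have h3 : (fun y => p j fun _ => y) =O[𝓝 0] fun y => ‖y‖ ^ (j + 1) :=
        (h2.sub h1).congr_left fun y => by ring
      exact h3.continuousMultilinearMap_apply_eq_zero
  set S := iteratedFDeriv ℂ j φ x with hS
  have hSdiag : (fun y => S fun _ => y) = fun _ => 0 := by
    ext y
    rw [hS, ← hp.factorial_smul y j, hdiag j hj, smul_zero]
  ext v
  have h1 := S.iteratedFDeriv_comp_diagonal x v
  rw [hSdiag] at h1
  have h2 : ∀ σ : Equiv.Perm (Fin j), S (fun i => v (σ i)) = S v := fun σ =>
    (hφ.contDiffAt (n := ⊤)).iteratedFDeriv_comp_perm v σ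
  simp only [h2, Finset.sum_const, Finset.card_univ] at h1
  have h3 : Fintype.card (Equiv.Perm (Fin j)) • S v = 0 := by
    rw [← h1]
    have : (fun _ : E => (0 : ℂ)) = 0 := rfl
    rw [this, iteratedFDeriv_zero]
    rfl
  exact (smul_eq_zero.1 h3).resolve_left (by rw [Fintype.card_perm]; exact Nat.factorial_ne_zero _)

end VanishingOrder

theorem natCast_le_vanishingOrder_iff {m k : ℕ} {φ : (Fin m → ℂ) → ℂ} {x : Fin m → ℂ} :
    (k : ℕ∞) ≤ vanishingOrder φ x ↔ ∀ j < k, iteratedFDeriv ℂ j φ x = 0 := by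
  simp only [vanishingOrder, le_iInf_iff, Nat.cast_le]
  exact ⟨fun h j hj => by_contra fun hne => absurd (h j hne) hj.not_ge,
    fun h j hne => le_of_not_gt fun hj => hne (h j hj)⟩

open Asymptotics in
theorem isBigO_norm_pow_iff_natCast_le_vanishingOrder {m k : ℕ} {φ : (Fin m → ℂ) → ℂ}
    {x : Fin m → ℂ} (hφ : AnalyticAt ℂ φ x) :
    ((fun y => φ (x + y)) =O[𝓝 0] fun y => ‖y‖ ^ k) ↔ (k : ℕ∞) ≤ vanishingOrder φ x := by
  rw [natCast_le_vanishingOrder_iff]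
  exact ⟨fun h j hj => hφ.iteratedFDeriv_eq_zero_of_isBigO_norm_pow h hj,
    hφ.isBigO_norm_pow_of_iteratedFDeriv_eq_zero⟩

open Asymptotics in
theorem AnalyticAt.natCast_le_analyticOrderAt_of_isBigO {h : ℂ → ℂ} {t : ℂ} (hh : AnalyticAt ℂ h t)
    {k : ℕ} (hO : (fun s => h (t + s)) =O[𝓝 0] fun s => ‖s‖ ^ k) : (k : ℕ∞) ≤ analyticOrderAt h t := by
  rw [natCast_le_analyticOrderAt_iff_iteratedDeriv_eq_zero hh]
  intro j hj
  rw [iteratedDeriv_eq_iteratedFDeriv, hh.iteratedFDeriv_eq_zero_of_isBigO_norm_pow hO hj]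
  rfl

/-! ### Quotients and Taylor estimates in one variable. -/

theorem MeromorphicOn.toMeromorphicNFOn_apply_of_analyticAt {f : ℂ → ℂ} {s : Set ℂ}
    (hf : MeromorphicOn f s) {z : ℂ} (hz : z ∈ s) (ha : AnalyticAt ℂ f z) :
    toMeromorphicNFOn f s z = f z := by
  rw [toMeromorphicNFOn_eq_toMeromorphicNFAt hf hz, toMeromorphicNFAt_eq_self.2 ha.meromorphicNFAt]

theorem AnalyticAt.meromorphicOrderAt_div_nonneg {φ χ : ℂ → ℂ} {z : ℂ} (hφ : AnalyticAt ℂ φ z)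
    (hχ : AnalyticAt ℂ χ z) (h : analyticOrderAt φ z ≤ analyticOrderAt χ z)
    (hfin : analyticOrderAt φ z ≠ ⊤) : 0 ≤ meromorphicOrderAt (χ / φ) z := by
  rw [meromorphicOrderAt_div hχ.meromorphicAt hφ.meromorphicAt, hχ.meromorphicOrderAt_eq,
    hφ.meromorphicOrderAt_eq]
  lift analyticOrderAt φ z to ℕ using hfin with k
  by_cases htop : analyticOrderAt χ z = ⊤
  · simp [htop]
  · lift analyticOrderAt χ z to ℕ using htop with l
    simp only [ENat.map_natCast, Nat.cast_le] at h ⊢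
    norm_cast
    simp

open Metric in
/-- The maximum principle for a quotient without poles. -/
theorem norm_le_mul_norm_of_analyticOrderAt_le {φ χ : ℂ → ℂ} {r C : ℝ} (hr : 0 < r)
    (hφ : AnalyticOnNhd ℂ φ (closedBall 0 r)) (hχ : AnalyticOnNhd ℂ χ (closedBall 0 r))
    (hφ0 : ∀ t ∈ sphere (0 : ℂ) r, φ t ≠ 0)
    (hord : ∀ t ∈ ball (0 : ℂ) r, analyticOrderAt φ t ≤ analyticOrderAt χ t)
    (hC : ∀ t ∈ sphere (0 : ℂ) r, ‖χ t‖ ≤ C * ‖φ t‖) {t : ℂ} (ht : t ∈ closedBall (0 : ℂ) r) :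
    ‖χ t‖ ≤ C * ‖φ t‖ := by
  have hfin : ∀ s ∈ closedBall (0 : ℂ) r, analyticOrderAt φ s ≠ ⊤ := by
    intro s hs htop
    rw [analyticOrderAt_eq_top] at htop
    have h1 := hφ.eqOn_zero_of_preconnected_of_eventuallyEq_zero
      (convex_closedBall 0 r).isPreconnected hs htop
    have h2 : (r : ℂ) ∈ sphere (0 : ℂ) r := by simp [abs_of_pos hr]
    exact hφ0 _ h2 (h1 (sphere_subset_closedBall h2))
  have hord' : ∀ s ∈ closedBall (0 : ℂ) r, analyticOrderAt φ s ≤ analyticOrderAt χ s := by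
    intro s hs
    by_cases h : s ∈ ball (0 : ℂ) r
    · exact hord s h
    · have h1 : φ s ≠ 0 := hφ0 s (by
        rw [mem_sphere]; exact le_antisymm (mem_closedBall.1 hs) (not_lt.1 h))
      rw [(hφ s hs).analyticOrderAt_eq_zero.2 h1]
      exact zero_le
  have hmer : MeromorphicOn (χ / φ) (closedBall 0 r) := fun s hs =>
    (hχ s hs).meromorphicAt.div (hφ s hs).meromorphicAt
  -- The normal form replaces the conventional value 0 at zeros of φ by the analytic extension.
  set Q := toMeromorphicNFOn (χ / φ) (closedBall 0 r)
  have hQ : AnalyticOnNhd ℂ Q (closedBall 0 r) := by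
    intro s hs
    have h1 : MeromorphicNFAt Q s := meromorphicNFOn_toMeromorphicNFOn (χ / φ) (closedBall 0 r) hs
    refine h1.meromorphicOrderAt_nonneg_iff_analyticAt.1 ?_
    rw [meromorphicOrderAt_toMeromorphicNFOn hmer hs]
    exact (hφ s hs).meromorphicOrderAt_div_nonneg (hχ s hs) (hord' s hs) (hfin s hs)
  have hQeq : ∀ s ∈ closedBall (0 : ℂ) r, φ s ≠ 0 → Q s = χ s / φ s := fun s hs h0 =>
    hmer.toMeromorphicNFOn_apply_of_analyticAt hs ((hχ s hs).div (hφ s hs) h0)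
  by_cases h0 : φ t = 0
  · have h1 : χ t = 0 := by
      by_contra h1
      have h2 := hord' t ht
      rw [(hχ t ht).analyticOrderAt_eq_zero.2 h1, nonpos_iff_eq_zero,
        (hφ t ht).analyticOrderAt_eq_zero] at h2
      exact h2 h0
    simp [h0, h1]
  · have hmax : ‖Q t‖ ≤ C := by
      refine Complex.norm_le_of_forall_mem_frontier_norm_le (U := ball (0 : ℂ) r) isBounded_ball
        (hQ.differentiableOn.diffContOnCl_ball subset_rfl) ?_
        (by rwa [closure_ball _ hr.ne'])
      intro s hs
      rw [frontier_ball _ hr.ne'] at hs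
      rw [hQeq s (sphere_subset_closedBall hs) (hφ0 s hs), norm_div,
        div_le_iff₀ (norm_pos_iff.2 (hφ0 s hs))]
      exact hC s hs
    rwa [hQeq t ht h0, norm_div, div_le_iff₀ (norm_pos_iff.2 h0)] at hmax

open Metric in
/-- A quantitative Taylor estimate at a zero of order at least `k`. -/
theorem norm_le_mul_norm_pow_of_iteratedDeriv_eq_zero {ρ M : ℝ} (k : ℕ) {h : ℂ → ℂ}
    (hh : AnalyticOnNhd ℂ h (ball 0 ρ)) (h0 : ∀ j < k, iteratedDeriv j h 0 = 0)
    (hM : ∀ s ∈ ball (0 : ℂ) ρ, ‖iteratedDeriv k h s‖ ≤ M) {s : ℂ} (hs : s ∈ ball (0 : ℂ) ρ) :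
    ‖h s‖ ≤ M * ‖s‖ ^ k := by
  induction k generalizing h s with
  | zero => simpa using hM s hs
  | succ k ih =>
    have hd : ∀ t ∈ ball (0 : ℂ) ρ, ‖deriv h t‖ ≤ M * ‖t‖ ^ k := by
      intro t ht
      refine ih hh.deriv (fun j hj => ?_) (fun t ht => ?_) ht
      · rw [← iteratedDeriv_succ']; exact h0 _ (by omega)
      · rw [← iteratedDeriv_succ']; exact hM t ht
    have hM0 : 0 ≤ M := (norm_nonneg _).trans (hM s hs)
    have hsub : closedBall (0 : ℂ) ‖s‖ ⊆ ball 0 ρ := closedBall_subset_ball (by simpa using hs)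
    have h1 := (convex_closedBall (0 : ℂ) ‖s‖).norm_image_sub_le_of_norm_deriv_le (f := h) (x := 0)
      (y := s) (C := M * ‖s‖ ^ k) (fun t ht => (hh t (hsub ht)).differentiableAt) (fun t ht => by
        refine (hd t (hsub ht)).trans ?_
        have : ‖t‖ ≤ ‖s‖ := by simpa using ht
        gcongr) (by simp) (by simp)
    have h2 : h 0 = 0 := by simpa using h0 0 (by omega)
    rw [h2, sub_zero, sub_zero] at h1
    rw [pow_succ, ← mul_assoc]
    exact h1


/-! ### Restriction to lines, and hypersurfaces transversal to them. -/

section DirectionalDerivative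

variable {E : Type*} [NormedAddCommGroup E] [NormedSpace ℂ E]

/-- The derivative of a function in the direction `v`. -/
noncomputable def dirDeriv (v : E) (φ : E → ℂ) : E → ℂ := fun x => fderiv ℂ φ x v

theorem AnalyticOnNhd.iterate_dirDeriv {φ : E → ℂ} {O : Set E} (hφ : AnalyticOnNhd ℂ φ O) (v : E)
    (j : ℕ) : AnalyticOnNhd ℂ ((dirDeriv v)^[j] φ) O := by
  induction j with
  | zero => exact hφ
  | succ j ih =>
    rw [Function.iterate_succ_apply']
    intro x hx
    exact ((ContinuousLinearMap.apply ℂ ℂ v).analyticAt _).comp (ih.fderiv x hx)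

theorem analyticAt_comp_line {F : Type*} [NormedAddCommGroup F] [NormedSpace ℂ F] {φ : E → F}
    {z v : E} {t : ℂ} (hφ : AnalyticAt ℂ φ (z + t • v)) :
    AnalyticAt ℂ (fun t : ℂ => φ (z + t • v)) t :=
  AnalyticAt.comp_of_eq hφ (analyticAt_const.add (analyticAt_id.smul analyticAt_const)) rfl

theorem iteratedDeriv_comp_line {φ : E → ℂ} {O : Set E} (hO : IsOpen O) (hφ : AnalyticOnNhd ℂ φ O)
    (z v : E) (j : ℕ) {t : ℂ} (ht : z + t • v ∈ O) :
    iteratedDeriv j (fun t : ℂ => φ (z + t • v)) t = (dirDeriv v)^[j] φ (z + t • v) := by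
  induction j generalizing t with
  | zero => simp
  | succ j ih =>
    have hev : iteratedDeriv j (fun t : ℂ => φ (z + t • v)) =ᶠ[𝓝 t]
        fun t => (dirDeriv v)^[j] φ (z + t • v) := by
      have : ContinuousAt (fun t : ℂ => z + t • v) t := by fun_prop
      filter_upwards [this.preimage_mem_nhds (hO.mem_nhds ht)] with s hs using ih hs
    rw [iteratedDeriv_succ, hev.deriv_eq, Function.iterate_succ_apply']
    have h1 := ((hφ.iterate_dirDeriv v j _ ht).differentiableAt.hasFDerivAt)
    have h2 : HasDerivAt (fun t : ℂ => z + t • v) v t := by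
      simpa using ((hasDerivAt_id t).smul_const v).const_add z
    exact (h1.comp_hasDerivAt t h2).deriv

theorem natCast_le_analyticOrderAt_comp_line_iff {φ : E → ℂ} {O : Set E} (hO : IsOpen O)
    (hφ : AnalyticOnNhd ℂ φ O) {z v : E} {k : ℕ} {t : ℂ} (ht : z + t • v ∈ O) :
    (k : ℕ∞) ≤ analyticOrderAt (fun t : ℂ => φ (z + t • v)) t ↔
      ∀ j < k, (dirDeriv v)^[j] φ (z + t • v) = 0 := by
  rw [natCast_le_analyticOrderAt_iff_iteratedDeriv_eq_zero (analyticAt_comp_line (hφ _ ht))]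
  simp only [iteratedDeriv_comp_line hO hφ z v _ ht]

end DirectionalDerivative

section Graph

variable {E : Type*} [NormedAddCommGroup E] [NormedSpace ℂ E] [CompleteSpace E]

/-- The zero set of a function with nonzero derivative in the direction `v` is locally a graph over
a complement of this direction. -/
theorem AnalyticAt.exists_graph {κ : E → ℂ} {z₀ v : E} {t₀ : ℂ} (hκ : AnalyticAt ℂ κ (z₀ + t₀ • v))
    (h0 : κ (z₀ + t₀ • v) = 0) (hv : fderiv ℂ κ (z₀ + t₀ • v) v ≠ 0) :
    ∃ ϕ : E → ℂ, AnalyticAt ℂ ϕ z₀ ∧ ϕ z₀ = t₀ ∧ (∀ᶠ z in 𝓝 z₀, κ (z + ϕ z • v) = 0) ∧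
      ∀ᶠ p : E × ℂ in 𝓝 (z₀, t₀), κ (p.1 + p.2 • v) = 0 → p.2 = ϕ p.1 := by
  set Φ : E × ℂ → ℂ := fun p => κ (p.1 + p.2 • v) with hΦ
  have hlin : HasFDerivAt (fun p : E × ℂ => p.1 + p.2 • v)
      (ContinuousLinearMap.fst ℂ E ℂ + (ContinuousLinearMap.snd ℂ E ℂ).smulRight v) (z₀, t₀) :=
    hasFDerivAt_fst.add (hasFDerivAt_snd.smul_const v)
  have hΦa : AnalyticAt ℂ Φ (z₀, t₀) :=
    AnalyticAt.comp_of_eq hκ (analyticAt_fst.add (analyticAt_snd.smul analyticAt_const)) rfl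
  have hΦd : fderiv ℂ Φ (z₀, t₀) = (fderiv ℂ κ (z₀ + t₀ • v)).comp
      (ContinuousLinearMap.fst ℂ E ℂ + (ContinuousLinearMap.snd ℂ E ℂ).smulRight v) :=
    (HasFDerivAt.comp (z₀, t₀) (hκ.differentiableAt.hasFDerivAt) hlin).fderiv
  have hinv : (fderiv ℂ Φ (z₀, t₀) ∘L .inr ℂ E ℂ).IsInvertible := by
    refine ⟨ContinuousLinearEquiv.unitsEquivAut ℂ (Units.mk0 _ hv), ?_⟩
    ext
    simp [hΦd]
  have hcd : ContDiffAt ℂ ⊤ Φ (z₀, t₀) := hΦa.contDiffAt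
  refine ⟨hcd.implicitFunction (by simp) hinv, ?_, ?_, ?_, ?_⟩
  · exact (hcd.contDiffAt_implicitFunction (by simp) hinv).analyticAt
  · exact hcd.implicitFunction_apply_self (by simp) hinv
  · filter_upwards [hcd.eventually_apply_implicitFunction (by simp) hinv] with z hz
    exact hz.trans h0
  · filter_upwards [hcd.eventually_apply_eq_iff_implicitFunction (by simp) hinv] with p hp h
    exact (hp.1 (h.trans h0.symm)).symm

/-- An analytic function either vanishes on a smooth hypersurface transversal to `v`, or its zero
set on the hypersurface has a nowhere dense projection along `v`. -/
theorem AnalyticAt.eventually_eq_zero_or_isNowhereDense {F : Type*} [NormedAddCommGroup F]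
    [NormedSpace ℂ F] [CompleteSpace F] {κ : E → ℂ} {ψ : E → F} {z₀ v : E} {t₀ : ℂ}
    (hκ : AnalyticAt ℂ κ (z₀ + t₀ • v)) (h0 : κ (z₀ + t₀ • v) = 0)
    (hv : fderiv ℂ κ (z₀ + t₀ • v) v ≠ 0) (hψ : AnalyticAt ℂ ψ (z₀ + t₀ • v)) :
    (∀ᶠ x in 𝓝 (z₀ + t₀ • v), κ x = 0 → ψ x = 0) ∨
      ∃ V ∈ 𝓝 (z₀, t₀), IsNowhereDense
        {z | ∃ t, (z, t) ∈ V ∧ κ (z + t • v) = 0 ∧ ψ (z + t • v) = 0} := by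
  obtain ⟨ϕ, hϕ, hϕ0, hϕz, hϕu⟩ := hκ.exists_graph h0 hv
  have hγ : AnalyticAt ℂ (fun z => ψ (z + ϕ z • v)) z₀ :=
    AnalyticAt.comp_of_eq hψ (analyticAt_id.add (hϕ.smul analyticAt_const)) (by simp [hϕ0])
  obtain ⟨R, hR, hball⟩ := Metric.eventually_nhds_iff_ball.1 hγ.eventually_analyticAt
  have hB : AnalyticOnNhd ℂ (fun z => ψ (z + ϕ z • v)) (Metric.ball z₀ R) := hball
  by_cases hall : Set.EqOn (fun z => ψ (z + ϕ z • v)) 0 (Metric.ball z₀ R)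
  · left
    have htend : Tendsto (fun x : E => (x - t₀ • v, t₀)) (𝓝 (z₀ + t₀ • v)) (𝓝 (z₀, t₀)) := by
      have : Continuous fun x : E => (x - t₀ • v, t₀) := by fun_prop
      simpa using this.tendsto (z₀ + t₀ • v)
    have htend1 : Tendsto (fun x : E => x - t₀ • v) (𝓝 (z₀ + t₀ • v)) (𝓝 z₀) := by
      have : Continuous fun x : E => x - t₀ • v := by fun_prop
      simpa using this.tendsto (z₀ + t₀ • v)
    filter_upwards [htend.eventually hϕu, htend1.eventually (Metric.ball_mem_nhds z₀ hR)]
      with x hx hxB hκx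
    have h1 := hx (by simpa using hκx)
    have h2 := hall hxB
    simp only [Pi.zero_apply] at h1 h2
    rw [← h1] at h2
    simpa using h2
  · right
    refine ⟨{p | κ (p.1 + p.2 • v) = 0 → p.2 = ϕ p.1} ∩ (Metric.ball z₀ R ×ˢ Set.univ),
      inter_mem hϕu (prod_mem_nhds (Metric.ball_mem_nhds z₀ hR) univ_mem), ?_⟩
    set S := {z | z ∈ Metric.ball z₀ R ∧ ψ (z + ϕ z • v) = 0}
    refine IsNowhereDense.mono (s := S) ?_ ?_
    · rintro z ⟨t, ⟨h1, h2, -⟩, h3, h4⟩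
      refine ⟨h2, ?_⟩
      rw [← h1 h3]
      exact h4
    -- If the closure had interior, continuity would make ψ vanish along the graph over an open set,
    -- and the identity theorem over the whole ball.
    · rw [IsNowhereDense, Set.eq_empty_iff_forall_notMem]
      intro z hz
      obtain ⟨w, hw1, hw2⟩ := mem_closure_iff_nhds.1 (interior_subset hz) _
        (isOpen_interior.mem_nhds hz)
      apply hall
      refine hB.eqOn_zero_of_preconnected_of_eventuallyEq_zero
        (convex_ball z₀ R).isPreconnected hw2.1 ?_
      filter_upwards [isOpen_interior.mem_nhds hw1, Metric.isOpen_ball.mem_nhds hw2.1] with y hy hyB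
      have hyc := interior_subset hy
      have hcl : IsClosed ({0} : Set F) := isClosed_singleton
      have hcont : ContinuousAt (fun z => ψ (z + ϕ z • v)) y := (hB y hyB).continuousAt
      by_contra hne
      obtain ⟨u, hu1, hu2⟩ := mem_closure_iff_nhds.1 hyc _ (hcont.eventually_ne hne)
      exact hu1 hu2.2

open Asymptotics in
/-- If `φ` vanishes to order `k` in the direction `v` along a smooth hypersurface transversal to
`v`, it vanishes to order `k` there. -/
theorem isBigO_norm_pow_of_iterate_dirDeriv_eq_zero {κ φ : E → ℂ} {x₀ v : E} {k : ℕ}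
    (hκ : AnalyticAt ℂ κ x₀) (h0 : κ x₀ = 0) (hv : fderiv ℂ κ x₀ v ≠ 0) (hφ : AnalyticAt ℂ φ x₀)
    (hD : ∀ᶠ x in 𝓝 x₀, κ x = 0 → ∀ j < k, (dirDeriv v)^[j] φ x = 0) :
    ∀ᶠ x in 𝓝 x₀, κ x = 0 → (fun y => φ (x + y)) =O[𝓝 0] fun y => ‖y‖ ^ k := by
  have hx₀ : x₀ + (0 : ℂ) • v = x₀ := by simp
  obtain ⟨ϕ, hϕ, hϕ0, hϕz, hϕu⟩ := AnalyticAt.exists_graph (κ := κ) (z₀ := x₀) (t₀ := 0) (v := v)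
    (by rwa [hx₀]) (by rwa [hx₀]) (by rwa [hx₀])
  obtain ⟨R, hR, hball⟩ := Metric.eventually_nhds_iff_ball.1 hφ.eventually_analyticAt
  have hφB : AnalyticOnNhd ℂ φ (Metric.ball x₀ R) := hball
  have hk : AnalyticAt ℂ ((dirDeriv v)^[k] φ) x₀ :=
    hφB.iterate_dirDeriv v k x₀ (Metric.mem_ball_self hR)
  -- a uniform bound on short segments in the direction `v`
  obtain ⟨M, hM⟩ : ∃ M, ∀ᶠ x in 𝓝 x₀, ‖(dirDeriv v)^[k] φ x‖ ≤ M := by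
    refine ⟨‖(dirDeriv v)^[k] φ x₀‖ + 1, ?_⟩
    filter_upwards [hk.continuousAt.norm.eventually_lt continuousAt_const (lt_add_one _)]
      with x hx using hx.le
  have hline : Tendsto (fun p : E × ℂ => p.1 + p.2 • v) (𝓝 (x₀, 0)) (𝓝 x₀) := by
    have : Continuous fun p : E × ℂ => p.1 + p.2 • v := by fun_prop
    simpa using this.tendsto (x₀, (0 : ℂ))
  obtain ⟨ρ, hρ, hρM⟩ := Metric.eventually_nhds_iff_ball.1
    (hline.eventually (hM.and (Metric.ball_mem_nhds x₀ hR)))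
  have hseg : ∀ w ∈ Metric.ball x₀ ρ, (∀ j < k, (dirDeriv v)^[j] φ w = 0) → ∀ s : ℂ, ‖s‖ < ρ →
      ‖φ (w + s • v)‖ ≤ M * ‖s‖ ^ k := by
    intro w hw hwD s hs
    have hmem : ∀ s ∈ Metric.ball (0 : ℂ) ρ, (w, s) ∈ Metric.ball (x₀, (0 : ℂ)) ρ := by
      intro s hs
      rw [← ball_prod_same]
      exact ⟨hw, hs⟩
    refine norm_le_mul_norm_pow_of_iteratedDeriv_eq_zero (ρ := ρ) k
      (h := fun s => φ (w + s • v)) (fun s hs => ?_) (fun j hj => ?_) (fun s hs => ?_)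
      (mem_ball_zero_iff.2 hs)
    · exact analyticAt_comp_line (hφB _ (hρM _ (hmem s hs)).2)
    · rw [iteratedDeriv_comp_line Metric.isOpen_ball hφB]
      · simpa using hwD j hj
      · exact (hρM _ (hmem 0 (Metric.mem_ball_self hρ))).2
    · rw [iteratedDeriv_comp_line Metric.isOpen_ball hφB _ _ _ (hρM _ (hmem s hs)).2]
      exact (hρM _ (hmem s hs)).1
  have htend0 : Tendsto (fun x : E => (x, (0 : ℂ))) (𝓝 x₀) (𝓝 (x₀, 0)) := by
    have : Continuous fun x : E => (x, (0 : ℂ)) := by fun_prop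
    exact this.tendsto x₀
  have hγ : Tendsto (fun x : E => x + ϕ x • v) (𝓝 x₀) (𝓝 x₀) := by
    have : ContinuousAt (fun x : E => x + ϕ x • v) x₀ :=
      continuousAt_id.add (hϕ.continuousAt.smul continuousAt_const)
    simpa [ContinuousAt, hϕ0] using this
  have hϕt : ∀ᶠ x in 𝓝 x₀, ‖-ϕ x‖ < ρ := by
    have : ContinuousAt (fun x => ‖-ϕ x‖) x₀ := hϕ.continuousAt.neg.norm
    exact this.eventually_lt continuousAt_const (by simpa [hϕ0] using hρ)
  -- The point x is reached along v from x + ϕ(x)v on the hypersurface, with a Taylor constant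
  -- independent of x. At a zero of ϕ, differentiability gives ϕ(x + y) = O(‖y‖), so the bound has
  -- order k in all directions.
  have hnear : ∀ᶠ x in 𝓝 x₀, ‖φ x‖ ≤ M * ‖ϕ x‖ ^ k := by
    filter_upwards [hγ.eventually hD, hγ.eventually (Metric.ball_mem_nhds x₀ hρ), hϕz, hϕt]
      with x h1 h2 h3 h4
    have := hseg _ h2 (h1 h3) _ h4
    simpa using this
  filter_upwards [htend0.eventually hϕu, hnear.eventually_nhds, hϕ.eventually_analyticAt]
    with x h1 h2 h3 hκx
  have hϕx : ϕ x = 0 := (h1 (by simpa using hκx)).symm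
  have htr : Tendsto (fun y : E => x + y) (𝓝 0) (𝓝 x) := by
    have : Continuous fun y : E => x + y := by fun_prop
    simpa using this.tendsto 0
  have hO : (fun y => ϕ (x + y)) =O[𝓝 0] fun y => y := by
    have := (h3.differentiableAt.isBigO_sub).comp_tendsto htr
    simpa [Function.comp_def, hϕx] using this
  have hO2 : (fun y => ϕ (x + y) ^ k) =O[𝓝 0] fun y => ‖y‖ ^ k := hO.norm_right.pow k
  refine (IsBigO.of_bound M ?_).trans hO2
  filter_upwards [htr.eventually h2] with y hy
  rwa [norm_pow]

end Graph


/-! ### Generic lines in a given direction. -/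

/-- By second countability, countably many of the neighbourhoods cover S. -/
theorem isMeagre_image_fst_of_forall_exists_nhds {X Y : Type*} [TopologicalSpace X]
    [TopologicalSpace Y] [SecondCountableTopology X] [SecondCountableTopology Y] {S : Set (X × Y)}
    (h : ∀ p ∈ S, ∃ V ∈ 𝓝 p, IsMeagre (Prod.fst '' (S ∩ V))) : IsMeagre (Prod.fst '' S) := by
  choose! V hV hm using h
  obtain ⟨T, hTS, hT, hcov⟩ := TopologicalSpace.countable_cover_nhdsWithin
    (f := V) (s := S) fun p hp => mem_nhdsWithin_of_mem_nhds (hV p hp)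
  have : Countable T := hT
  have h1 : IsMeagre (⋃ p : T, Prod.fst '' (S ∩ V p)) := isMeagre_iUnion fun p => hm p (hTS p.2)
  refine h1.mono ?_
  rintro _ ⟨p, hp, rfl⟩
  obtain ⟨r, hr, hpr⟩ := Set.mem_iUnion₂.1 (hcov hp)
  exact Set.mem_iUnion.2 ⟨⟨r, hr⟩, p, ⟨hp, hpr⟩, rfl⟩

/-- This makes the zero set of the k-th directional derivative a smooth hypersurface transversal to
v, containing the nearby zeros of the same order along v. -/
theorem fderiv_iterate_dirDeriv_ne_zero {E : Type*} [NormedAddCommGroup E] [NormedSpace ℂ E]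
    {φ : E → ℂ} {O : Set E} (hO : IsOpen O) (hφ : AnalyticOnNhd ℂ φ O) {z₀ v : E} {t₀ : ℂ} {k : ℕ}
    (hx : z₀ + t₀ • v ∈ O)
    (hk : analyticOrderAt (fun t : ℂ => φ (z₀ + t • v)) t₀ = (k + 1 : ℕ)) :
    fderiv ℂ ((dirDeriv v)^[k] φ) (z₀ + t₀ • v) v ≠ 0 := by
  intro h0
  have h1 : ((k + 1 + 1 : ℕ) : ℕ∞) ≤ analyticOrderAt (fun t : ℂ => φ (z₀ + t • v)) t₀ := by
    rw [natCast_le_analyticOrderAt_comp_line_iff hO hφ hx]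
    intro j hj
    rcases (Nat.lt_succ_iff.1 hj).lt_or_eq with hj | rfl
    · exact (natCast_le_analyticOrderAt_comp_line_iff hO hφ hx).1 hk.ge j hj
    · rw [Function.iterate_succ_apply']; exact h0
  rw [hk, Nat.cast_le] at h1
  omega

section Generic

variable {E : Type*} [NormedAddCommGroup E] [NormedSpace ℂ E] [CompleteSpace E]
  [SecondCountableTopology E]

open Asymptotics in
/-- On a generic line in a given direction, the order of an analytic function along the line is its
order of vanishing. -/
theorem isMeagre_setOf_order_lt_order_comp_line {φ : E → ℂ} {O : Set E} (hO : IsOpen O)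
    (hφ : AnalyticOnNhd ℂ φ O) (v : E) :
    IsMeagre {z | ∃ t : ℂ, z + t • v ∈ O ∧ ∃ k : ℕ,
      analyticOrderAt (fun t : ℂ => φ (z + t • v)) t = k ∧
      ¬ (fun y => φ (z + t • v + y)) =O[𝓝 0] fun y => ‖y‖ ^ k} := by
  set S : ℕ → Set (E × ℂ) := fun k => {p | p.1 + p.2 • v ∈ O ∧
      analyticOrderAt (fun t : ℂ => φ (p.1 + t • v)) p.2 = k ∧
      ¬ (fun y => φ (p.1 + p.2 • v + y)) =O[𝓝 0] fun y => ‖y‖ ^ k} with hS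
  suffices h : ∀ k, IsMeagre (Prod.fst '' S k) by
    refine (isMeagre_iUnion h).mono ?_
    rintro z ⟨t, h1, k, h2, h3⟩
    exact Set.mem_iUnion.2 ⟨k, (z, t), ⟨h1, h2, h3⟩, rfl⟩
  intro k
  have hcont : Continuous fun p : E × ℂ => p.1 + p.2 • v := by fun_prop
  refine isMeagre_image_fst_of_forall_exists_nhds ?_
  rintro ⟨z₀, t₀⟩ ⟨hx, hk, hbad⟩
  simp only at hx hk hbad
  rcases k with - | k
  · refine absurd (IsBigO.of_bound (‖φ (z₀ + t₀ • v)‖ + 1) ?_) hbad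
    have htr : ContinuousAt (fun y : E => φ (z₀ + t₀ • v + y)) 0 :=
      ContinuousAt.comp_of_eq (hφ _ hx).continuousAt (by fun_prop) (by simp)
    have h1 : ‖φ (z₀ + t₀ • v + 0)‖ < ‖φ (z₀ + t₀ • v)‖ + 1 := by simp
    filter_upwards [htr.norm.eventually_lt continuousAt_const h1] with y hy
    simpa using hy.le
  have hDzero : ∀ p ∈ S (k + 1), ∀ j < k + 1, (dirDeriv v)^[j] φ (p.1 + p.2 • v) = 0 := fun p hp =>
    (natCast_le_analyticOrderAt_comp_line_iff hO hφ hp.1).1 hp.2.1.ge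
  have hD0 := hDzero (z₀, t₀) ⟨hx, hk, hbad⟩
  have hκ : AnalyticAt ℂ ((dirDeriv v)^[k] φ) (z₀ + t₀ • v) := hφ.iterate_dirDeriv v k _ hx
  have hv := fderiv_iterate_dirDeriv_ne_zero hO hφ hx hk
  have hdich := fun j => AnalyticAt.eventually_eq_zero_or_isNowhereDense hκ (hD0 k k.lt_succ_self)
    hv (hφ.iterate_dirDeriv v j _ hx)
  -- Nearby points of the same order along v lie on the hypersurface where the k-th directional
  -- derivative vanishes. If all lower ones vanish on it, φ has order k + 1 in all directions and no
  -- point is bad. Otherwise the bad points lie over a nowhere dense set.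
  by_cases hall : ∀ j < k + 1, ∀ᶠ x in 𝓝 (z₀ + t₀ • v), (dirDeriv v)^[k] φ x = 0 →
      (dirDeriv v)^[j] φ x = 0
  · have hD : ∀ᶠ x in 𝓝 (z₀ + t₀ • v), (dirDeriv v)^[k] φ x = 0 →
        ∀ j < k + 1, (dirDeriv v)^[j] φ x = 0 := by
      have := (Set.finite_Iio (k + 1)).eventually_all.2 hall
      filter_upwards [this] with x hx h0 j hj using hx j hj h0
    have hgood := isBigO_norm_pow_of_iterate_dirDeriv_eq_zero hκ (hD0 k k.lt_succ_self) hv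
      (hφ _ hx) hD
    refine ⟨_, (hcont.tendsto (z₀, t₀)).eventually hgood, ?_⟩
    convert IsMeagre.empty
    rw [Set.image_eq_empty, Set.eq_empty_iff_forall_notMem]
    rintro p ⟨hp, hp'⟩
    exact hp.2.2 (hp' (hDzero p hp k k.lt_succ_self))
  · simp only [not_forall] at hall
    obtain ⟨j, hj, hne⟩ := hall
    obtain ⟨V, hV, hnd⟩ := (hdich j).resolve_left hne
    refine ⟨V, hV, hnd.isMeagre.mono ?_⟩
    rintro _ ⟨⟨z, t⟩, ⟨hp, hpV⟩, rfl⟩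
    exact ⟨t, hpV, hDzero _ hp k k.lt_succ_self, hDzero _ hp j hj⟩

/-- A generic line in a given direction meets the zero set of an analytic function `φ` off the zero
set of a map `ψ` that does not vanish on a hypersurface. -/
theorem isMeagre_setOf_comp_line_eq_zero {F : Type*} [NormedAddCommGroup F] [NormedSpace ℂ F]
    [CompleteSpace F] {φ : E → ℂ} {ψ : E → F} {O : Set E} (hO : IsOpen O)
    (hφ : AnalyticOnNhd ℂ φ O) (hψ : AnalyticOnNhd ℂ ψ O)
    (hthin : ∀ x ∈ O, ψ x = 0 → ∀ κ : E → ℂ, AnalyticAt ℂ κ x → κ x = 0 →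
      ¬ ∀ᶠ x' in 𝓝 x, κ x' = 0 → ψ x' = 0) (v : E) :
    IsMeagre {z | ∃ t : ℂ, z + t • v ∈ O ∧ φ (z + t • v) = 0 ∧
      analyticOrderAt (fun t : ℂ => φ (z + t • v)) t ≠ ⊤ ∧ ψ (z + t • v) = 0} := by
  set S : ℕ → Set (E × ℂ) := fun k => {p | p.1 + p.2 • v ∈ O ∧
      analyticOrderAt (fun t : ℂ => φ (p.1 + t • v)) p.2 = (k + 1 : ℕ) ∧
      ψ (p.1 + p.2 • v) = 0} with hS
  suffices h : ∀ k, IsMeagre (Prod.fst '' S k) by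
    refine (isMeagre_iUnion h).mono ?_
    rintro z ⟨t, h1, h2, h3, h4⟩
    obtain ⟨k, hk⟩ := ENat.ne_top_iff_exists.1 h3
    rcases k with - | k
    · have h5 := (analyticAt_comp_line (hφ _ h1)).analyticOrderAt_eq_zero.1 hk.symm
      exact absurd h2 h5
    · exact Set.mem_iUnion.2 ⟨k, (z, t), ⟨h1, hk.symm, h4⟩, rfl⟩
  intro k
  refine isMeagre_image_fst_of_forall_exists_nhds ?_
  rintro ⟨z₀, t₀⟩ ⟨hx, hk, hψ0⟩
  simp only at hx hk hψ0
  have hDzero : ∀ p ∈ S k, ∀ j < k + 1, (dirDeriv v)^[j] φ (p.1 + p.2 • v) = 0 := fun p hp =>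
    (natCast_le_analyticOrderAt_comp_line_iff hO hφ hp.1).1 hp.2.1.ge
  have hD0 := hDzero (z₀, t₀) ⟨hx, hk, hψ0⟩
  have hκ : AnalyticAt ℂ ((dirDeriv v)^[k] φ) (z₀ + t₀ • v) := hφ.iterate_dirDeriv v k _ hx
  have hv := fderiv_iterate_dirDeriv_ne_zero hO hφ hx hk
  obtain ⟨V, hV, hnd⟩ := (AnalyticAt.eventually_eq_zero_or_isNowhereDense hκ
    (hD0 k k.lt_succ_self) hv (hψ _ hx)).resolve_left
      (hthin _ hx hψ0 _ hκ (hD0 k k.lt_succ_self))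
  refine ⟨V, hV, hnd.isMeagre.mono ?_⟩
  rintro _ ⟨⟨z, t⟩, ⟨hp, hpV⟩, rfl⟩
  exact ⟨t, hpV, hDzero _ hp k k.lt_succ_self, hp.2.2⟩

end Generic


/-! ### Comparison of analytic functions in several variables. -/

open Asymptotics Metric in
/-- An analytic function is locally bounded by a multiple of another one if its order of vanishing
is at least as large outside of a set containing no hypersurface. -/
theorem exists_eventually_norm_le_mul_norm {E : Type*} [NormedAddCommGroup E] [NormedSpace ℂ E]
    [CompleteSpace E] [SecondCountableTopology E] {F₁ F₂ : Type*} [NormedAddCommGroup F₁]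
    [NormedSpace ℂ F₁] [CompleteSpace F₁] [NormedAddCommGroup F₂] [NormedSpace ℂ F₂]
    [CompleteSpace F₂] {φ χ : E → ℂ} {ψ₁ : E → F₁} {ψ₂ : E → F₂} {O : Set E} (hO : IsOpen O)
    (hφ : AnalyticOnNhd ℂ φ O) (hχ : AnalyticOnNhd ℂ χ O) (hψ₁ : AnalyticOnNhd ℂ ψ₁ O)
    (hψ₂ : AnalyticOnNhd ℂ ψ₂ O)
    (hthin₁ : ∀ x ∈ O, ψ₁ x = 0 → ∀ κ : E → ℂ, AnalyticAt ℂ κ x → κ x = 0 →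
      ¬ ∀ᶠ x' in 𝓝 x, κ x' = 0 → ψ₁ x' = 0)
    (hthin₂ : ∀ x ∈ O, ψ₂ x = 0 → ∀ κ : E → ℂ, AnalyticAt ℂ κ x → κ x = 0 →
      ¬ ∀ᶠ x' in 𝓝 x, κ x' = 0 → ψ₂ x' = 0)
    (hord : ∀ x ∈ O, ψ₁ x ≠ 0 → ψ₂ x ≠ 0 → ∀ k : ℕ,
      ((fun y => φ (x + y)) =O[𝓝 0] fun y => ‖y‖ ^ k) →
        (fun y => χ (x + y)) =O[𝓝 0] fun y => ‖y‖ ^ k)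
    {a : E} (ha : a ∈ O) (hφa : ∃ᶠ x in 𝓝 a, φ x ≠ 0) :
    ∃ M : ℝ, ∀ᶠ x in 𝓝 a, ‖χ x‖ ≤ M * ‖φ x‖ := by
  obtain ⟨R, hR, hRO⟩ := Metric.isOpen_iff.1 hO a ha
  obtain ⟨b, hb0, hb⟩ := (hφa.and_eventually (ball_mem_nhds a hR)).exists
  set v := b - a with hv
  have hvR : ‖v‖ < R := by rw [← dist_eq_norm]; exact hb
  -- the restriction of `φ` to the line through `a` and `b`
  have hiso : ∀ᶠ t in 𝓝[≠] (0 : ℂ), φ (a + t • v) ≠ 0 := by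
    have hline : AnalyticOnNhd ℂ (fun t : ℂ => φ (a + t • v)) (closedBall 0 1) := by
      intro t ht
      refine analyticAt_comp_line (hφ _ (hRO ?_))
      rw [mem_ball_iff_norm, add_sub_cancel_left, norm_smul]
      have : ‖t‖ ≤ 1 := by simpa using ht
      nlinarith [norm_nonneg v]
    rcases (hline 0 (by simp)).eventually_eq_zero_or_eventually_ne_zero with h | h
    · exfalso
      have h1 := hline.eqOn_zero_of_preconnected_of_eventuallyEq_zero
        (convex_closedBall 0 1).isPreconnected (by simp) h (show (1 : ℂ) ∈ closedBall 0 1 by simp)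
      apply hb0
      simpa [hv] using h1
    · exact h
  have hOt : ∀ᶠ t in 𝓝 (0 : ℂ), a + t • v ∈ O := by
    have : ContinuousAt (fun t : ℂ => a + t • v) 0 := by fun_prop
    exact this.eventually_mem (by simpa using hO.mem_nhds ha)
  rw [eventually_nhdsWithin_iff] at hiso
  obtain ⟨r', hr', hball⟩ := Metric.eventually_nhds_iff_ball.1 (hiso.and hOt)
  set r := r' / 2 with hrdef
  have hr : 0 < r := by positivity
  have hrr' : r < r' := by rw [hrdef]; linarith
  have hrO : ∀ t ∈ closedBall (0 : ℂ) r, a + t • v ∈ O := fun t ht =>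
    (hball t (closedBall_subset_ball hrr' ht)).2
  have hr0 : ∀ t ∈ sphere (0 : ℂ) r, φ (a + t • v) ≠ 0 := fun t ht =>
    (hball t (closedBall_subset_ball hrr' (sphere_subset_closedBall ht))).1
      (by rintro rfl; simp at ht; linarith)
  have hcont : Continuous fun p : E × ℂ => p.1 + p.2 • v := by fun_prop
  have hzO : ∀ᶠ z in 𝓝 a, ∀ t ∈ closedBall (0 : ℂ) r, z + t • v ∈ O :=
    (isCompact_closedBall (0 : ℂ) r).eventually_forall_of_forall_eventually fun t ht =>
      (hcont.tendsto (a, t)).eventually (hO.mem_nhds (hrO t ht))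
  have hcφ : ∀ t ∈ closedBall (0 : ℂ) r,
      ContinuousAt (fun p : E × ℂ => φ (p.1 + p.2 • v)) (a, t) := fun t ht =>
    ContinuousAt.comp_of_eq (hφ _ (hrO t ht)).continuousAt hcont.continuousAt rfl
  have hcχ : ∀ t ∈ closedBall (0 : ℂ) r,
      ContinuousAt (fun p : E × ℂ => χ (p.1 + p.2 • v)) (a, t) := fun t ht =>
    ContinuousAt.comp_of_eq (hχ _ (hrO t ht)).continuousAt hcont.continuousAt rfl
  have hz0 : ∀ᶠ z in 𝓝 a, ∀ t ∈ sphere (0 : ℂ) r, φ (z + t • v) ≠ 0 :=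
    (isCompact_sphere (0 : ℂ) r).eventually_forall_of_forall_eventually fun t ht =>
      (hcφ t (sphere_subset_closedBall ht)).eventually_ne (hr0 t ht)
  have hquot : ContinuousOn (fun t : ℂ => ‖χ (a + t • v)‖ / ‖φ (a + t • v)‖) (sphere 0 r) := by
    intro t ht
    have ht' := sphere_subset_closedBall ht
    have h1 : ContinuousAt (fun t : ℂ => (a, t)) t := by fun_prop
    have h2 : ContinuousAt (fun t : ℂ => φ (a + t • v)) t := (hcφ t ht').comp_of_eq h1 rfl
    have h3 : ContinuousAt (fun t : ℂ => χ (a + t • v)) t := (hcχ t ht').comp_of_eq h1 rfl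
    exact (h3.norm.div h2.norm (norm_ne_zero_iff.2 (hr0 t ht))).continuousWithinAt
  obtain ⟨C, hC⟩ := (isCompact_sphere (0 : ℂ) r).bddAbove_image hquot
  -- By compactness of the circle the bound on χ/φ passes to parallel lines through nearby points,
  -- at the cost of replacing C by C + 1.
  have hzC : ∀ᶠ z in 𝓝 a, ∀ t ∈ sphere (0 : ℂ) r,
      ‖χ (z + t • v)‖ ≤ (C + 1) * ‖φ (z + t • v)‖ := by
    refine (isCompact_sphere (0 : ℂ) r).eventually_forall_of_forall_eventually fun t ht => ?_
    have ht' := sphere_subset_closedBall ht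
    have h1 : ‖χ (a + t • v)‖ / ‖φ (a + t • v)‖ ≤ C := hC (Set.mem_image_of_mem _ ht)
    have hpos : 0 < ‖φ (a + t • v)‖ := norm_pos_iff.2 (hr0 t ht)
    rw [div_le_iff₀ hpos] at h1
    have h2 : ‖χ (a + t • v)‖ < (C + 1) * ‖φ (a + t • v)‖ := by linarith
    filter_upwards [(hcχ t ht').norm.eventually_lt ((hcφ t ht').norm.const_mul (C + 1)) h2]
      with p hp using hp.le
  refine ⟨C + 1, ?_⟩
  obtain ⟨δ, hδ, hδball⟩ := Metric.eventually_nhds_iff_ball.1 (hzO.and (hz0.and hzC))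
  -- Off these meagre sets, the zeros of φ on the line avoid those of ψ₁ and ψ₂, and the order of φ
  -- along the line is its full order of vanishing. There `hord` compares orders along the line, and
  -- the maximum principle applies.
  have hres := (isMeagre_setOf_order_lt_order_comp_line hO hφ v).union
    ((isMeagre_setOf_comp_line_eq_zero hO hφ hψ₁ hthin₁ v).union
      (isMeagre_setOf_comp_line_eq_zero hO hφ hψ₂ hthin₂ v))
  have hgood : ∀ z ∈ ball a δ, z ∉ {z | ∃ t : ℂ, z + t • v ∈ O ∧ ∃ k : ℕ,
        analyticOrderAt (fun t : ℂ => φ (z + t • v)) t = k ∧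
        ¬ (fun y => φ (z + t • v + y)) =O[𝓝 0] fun y => ‖y‖ ^ k} ∪
      ({z | ∃ t : ℂ, z + t • v ∈ O ∧ φ (z + t • v) = 0 ∧
        analyticOrderAt (fun t : ℂ => φ (z + t • v)) t ≠ ⊤ ∧ ψ₁ (z + t • v) = 0} ∪
      {z | ∃ t : ℂ, z + t • v ∈ O ∧ φ (z + t • v) = 0 ∧
        analyticOrderAt (fun t : ℂ => φ (z + t • v)) t ≠ ⊤ ∧ ψ₂ (z + t • v) = 0}) →
      ‖χ z‖ ≤ (C + 1) * ‖φ z‖ := by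
    intro z hz hzg
    simp only [Set.mem_union, Set.mem_ofPred_eq, not_or, not_exists, not_and, not_not] at hzg
    obtain ⟨g1, g2, g3⟩ := hzg
    obtain ⟨b1, b2, b3⟩ := hδball z hz
    have hφz : AnalyticOnNhd ℂ (fun t : ℂ => φ (z + t • v)) (closedBall 0 r) := fun t ht =>
      analyticAt_comp_line (hφ _ (b1 t ht))
    have hχz : AnalyticOnNhd ℂ (fun t : ℂ => χ (z + t • v)) (closedBall 0 r) := fun t ht =>
      analyticAt_comp_line (hχ _ (b1 t ht))
    have key := norm_le_mul_norm_of_analyticOrderAt_le hr hφz hχz b2 ?_ b3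
      (mem_closedBall_self hr.le)
    · simpa using key
    intro t ht
    have ht' := ball_subset_closedBall ht
    have htop : analyticOrderAt (fun t : ℂ => φ (z + t • v)) t ≠ ⊤ := by
      intro htop
      rw [analyticOrderAt_eq_top] at htop
      have h1 := hφz.eqOn_zero_of_preconnected_of_eventuallyEq_zero
        (convex_closedBall 0 r).isPreconnected ht' htop
      have h2 : (r : ℂ) ∈ sphere (0 : ℂ) r := by simp [abs_of_pos hr]
      exact b2 _ h2 (h1 (sphere_subset_closedBall h2))
    by_cases h0 : φ (z + t • v) = 0
    · obtain ⟨k, hk⟩ := ENat.ne_top_iff_exists.1 htop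
      rw [← hk]
      have hOφ := g1 t (b1 t ht') k hk.symm
      have hOχ := hord _ (b1 t ht') (g2 t (b1 t ht') h0 htop) (g3 t (b1 t ht') h0 htop) k hOφ
      refine (hχz t ht').natCast_le_analyticOrderAt_of_isBigO ?_
      have htend : Tendsto (fun s : ℂ => s • v) (𝓝 0) (𝓝 0) := by
        have : Continuous fun s : ℂ => s • v := by fun_prop
        simpa using this.tendsto 0
      have h3 := hOχ.comp_tendsto htend
      simp only [Function.comp_def] at h3
      refine (h3.congr_left fun s => by rw [add_smul, add_assoc]).trans ?_
      refine IsBigO.of_bound (‖v‖ ^ k) (Eventually.of_forall fun s => ?_)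
      rw [norm_smul, norm_pow, norm_pow, norm_norm, norm_mul, norm_norm, norm_norm, mul_pow,
        mul_comm]
    · rw [(hφz t ht').analyticOrderAt_eq_zero.2 h0]
      exact zero_le
  filter_upwards [isOpen_ball.mem_nhds (mem_ball_self hδ : a ∈ ball a δ)] with z hz
  have hdense := dense_of_mem_residual hres
  have hzO : z ∈ O := by simpa using (hδball z hz).1 0 (by simpa using hr.le)
  -- Failure of the inequality is an open condition, while by Baire the good points are dense.
  refine le_of_not_gt fun hlt => ?_
  have hev := ((hφ z hzO).continuousAt.norm.const_mul (C + 1)).eventually_lt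
    (hχ z hzO).continuousAt.norm hlt
  obtain ⟨w, ⟨hw1, hw2⟩, hw3⟩ := mem_closure_iff_nhds.1 (hdense z) _
    (inter_mem hev (isOpen_ball.mem_nhds hz))
  exact absurd (hgood w hw2 hw3) (not_le.2 hw1)


/-! ### Sets of codimension two and hypersurfaces. -/

open Metric in
/-- A zero of an analytic function is not isolated in a plane. -/
theorem AnalyticAt.not_eventually_ne_zero_of_finrank_eq_two {E : Type*} [NormedAddCommGroup E]
    [NormedSpace ℂ E] {κ : E → ℂ} {a : E} (hκ : AnalyticAt ℂ κ a) (h0 : κ a = 0)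
    {W : Submodule ℂ E} (hW : Module.finrank ℂ W = 2) :
    ¬ ∀ᶠ z in 𝓝[≠] a, z - a ∈ W → κ z ≠ 0 := by
  intro hev
  have : FiniteDimensional ℂ W := Module.finite_of_finrank_pos (by omega)
  set b := Module.finBasisOfFinrankEq ℂ W hW
  set w₁ : E := ((b 0 : W) : E)
  set w₂ : E := ((b 1 : W) : E)
  have hne : ∀ s t : ℂ, (s, t) ≠ (0, 0) → a + s • w₁ + t • w₂ ≠ a := by
    intro s t hst h
    apply hst
    have h1 : s • b 0 + t • b 1 = 0 := by
      ext
      simpa [add_assoc] using h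
    have h2 := Fintype.linearIndependent_iff.1 b.linearIndependent ![s, t]
      (by simpa [Fin.sum_univ_two] using h1)
    exact Prod.ext (h2 0) (h2 1)
  have hcont : Continuous fun p : ℂ × ℂ => a + p.1 • w₁ + p.2 • w₂ := by fun_prop
  have htend : Tendsto (fun p : ℂ × ℂ => a + p.1 • w₁ + p.2 • w₂) (𝓝 (0, 0)) (𝓝 a) := by
    simpa using hcont.tendsto (0, 0)
  rw [eventually_nhdsWithin_iff] at hev
  obtain ⟨R, hR, hball⟩ := Metric.eventually_nhds_iff_ball.1
    (htend.eventually (hev.and hκ.eventually_analyticAt))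
  set r := R / 2 with hr
  have hr0 : 0 < r := by positivity
  have hrR : r < R := by rw [hr]; linarith
  have hmem : ∀ s ∈ closedBall (0 : ℂ) r, ∀ t ∈ closedBall (0 : ℂ) r,
      (s, t) ∈ ball ((0, 0) : ℂ × ℂ) R := by
    intro s hs t ht
    rw [← ball_prod_same]
    exact ⟨closedBall_subset_ball hrR hs, closedBall_subset_ball hrR ht⟩
  have hnz : ∀ s ∈ closedBall (0 : ℂ) r, ∀ t ∈ closedBall (0 : ℂ) r, (s, t) ≠ (0, 0) →
      κ (a + s • w₁ + t • w₂) ≠ 0 := by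
    intro s hs t ht hst
    refine (hball _ (hmem s hs t ht)).1 (hne s t hst) ?_
    rw [add_assoc, add_sub_cancel_left]
    exact W.add_mem (W.smul_mem _ (b 0).2) (W.smul_mem _ (b 1).2)
  have hcK : ContinuousOn (fun p : ℂ × ℂ => ‖κ (a + p.1 • w₁ + p.2 • w₂)‖)
      (closedBall 0 r ×ˢ sphere 0 r) := by
    rintro ⟨s, t⟩ ⟨hs, ht⟩
    have h1 := (hball _ (hmem s hs t (sphere_subset_closedBall ht))).2
    exact (ContinuousAt.comp_of_eq h1.continuousAt hcont.continuousAt rfl).norm.continuousWithinAt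
  have hK : IsCompact (closedBall (0 : ℂ) r ×ˢ sphere (0 : ℂ) r) :=
    (isCompact_closedBall _ _).prod (isCompact_sphere _ _)
  have hKne : (closedBall (0 : ℂ) r ×ˢ sphere (0 : ℂ) r).Nonempty :=
    ⟨(0, (r : ℂ)), by simp [hr0.le], by simp [abs_of_pos hr0]⟩
  obtain ⟨⟨s₀, t₀⟩, ⟨hs₀, ht₀⟩, hmin⟩ := hK.exists_isMinOn hKne hcK
  set δ := ‖κ (a + s₀ • w₁ + t₀ • w₂)‖ with hδ
  have hδ0 : 0 < δ := by
    refine norm_pos_iff.2 (hnz _ hs₀ _ (sphere_subset_closedBall ht₀) fun h => ?_)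
    have h1 : t₀ = 0 := (Prod.ext_iff.1 h).2
    rw [h1] at ht₀
    simp at ht₀
    linarith
  -- On the slices s ≠ 0 the function κ has no zero, so the maximum principle for 1/κ bounds |κ| at
  -- t = 0 from below by its minimum δ over the circles. This contradicts κ → 0 as s → 0.
  have hlow : ∀ s ∈ closedBall (0 : ℂ) r, s ≠ 0 → δ ≤ ‖κ (a + s • w₁)‖ := by
    intro s hs hs0
    have han : AnalyticOnNhd ℂ (fun t : ℂ => κ (a + s • w₁ + t • w₂)) (closedBall 0 r) :=
      fun t ht => analyticAt_comp_line (hball _ (hmem s hs t ht)).2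
    have hnz' : ∀ t ∈ closedBall (0 : ℂ) r, κ (a + s • w₁ + t • w₂) ≠ 0 := fun t ht =>
      hnz s hs t ht fun h => hs0 (Prod.ext_iff.1 h).1
    have key := norm_le_mul_norm_of_analyticOrderAt_le (C := δ⁻¹) hr0 han
      (χ := fun _ => 1) analyticOnNhd_const
      (fun t ht => hnz' t (sphere_subset_closedBall ht))
      (fun t ht => by
        rw [(han t (ball_subset_closedBall ht)).analyticOrderAt_eq_zero.2
          (hnz' t (ball_subset_closedBall ht))]
        exact zero_le)
      (fun t ht => by
        rw [norm_one, inv_mul_eq_div, one_le_div hδ0]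
        exact hmin (Set.mk_mem_prod hs ht))
      (mem_closedBall_self hr0.le)
    rw [norm_one, inv_mul_eq_div, one_le_div hδ0] at key
    simpa using key
  have hlim : Tendsto (fun s : ℂ => ‖κ (a + s • w₁)‖) (𝓝[≠] 0) (𝓝 0) := by
    have h1 : ContinuousAt (fun s : ℂ => κ (a + s • w₁)) 0 :=
      ContinuousAt.comp_of_eq hκ.continuousAt (by fun_prop) (by simp)
    have h2 := h1.norm.tendsto
    simp only [zero_smul, add_zero, h0, norm_zero] at h2
    exact h2.mono_left nhdsWithin_le_nhds
  have hge : ∀ᶠ s in 𝓝[≠] (0 : ℂ), δ ≤ ‖κ (a + s • w₁)‖ := by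
    filter_upwards [nhdsWithin_le_nhds (closedBall_mem_nhds (0 : ℂ) hr0), self_mem_nhdsWithin]
      with s hs hs0 using hlow s hs hs0
  exact absurd (ge_of_tendsto hlim hge) (not_le.2 hδ0)

/-- A set of codimension at least two contains no hypersurface. -/
theorem CodimAtLeastAt.not_eventually_mem {m : ℕ} {A : Set (Fin m → ℂ)} {a : Fin m → ℂ}
    (h : CodimAtLeastAt 2 A a) {κ : (Fin m → ℂ) → ℂ} (hκ : AnalyticAt ℂ κ a) (h0 : κ a = 0) :
    ¬ ∀ᶠ z in 𝓝 a, κ z = 0 → z ∈ A := by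
  obtain ⟨W, hW, hev⟩ := h
  intro hA
  refine hκ.not_eventually_ne_zero_of_finrank_eq_two h0 hW ?_
  filter_upwards [hev, nhdsWithin_le_nhds hA] with z h1 h2 h3 h4 using h1 h3 (h2 h4)

section LocallyPrincipal

variable {E : Type*} [NormedAddCommGroup E] [NormedSpace ℂ E]

/-- A set which is locally the zero set of one analytic function. -/
def LocallyPrincipal (Z : Set E) : Prop :=
  ∀ a, ∃ φ : E → ℂ, AnalyticAt ℂ φ a ∧ ∀ᶠ z in 𝓝 a, z ∈ Z ↔ φ z = 0

theorem LocallyPrincipal.isOpen_compl {Z : Set E} (h : LocallyPrincipal Z) : IsOpen Zᶜ := by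
  rw [isOpen_iff_mem_nhds]
  intro a ha
  obtain ⟨φ, hφ, hZ⟩ := h a
  have h1 : φ a ≠ 0 := fun h1 => ha (hZ.self_of_nhds.2 h1)
  filter_upwards [hZ, hφ.continuousAt.eventually_ne h1] with z hz h2 h3 using h2 (hz.1 h3)

/-- By the identity theorem on balls the interior of Z is also closed, and the space is connected.
-/
theorem LocallyPrincipal.dense_compl {Z : Set E} (h : LocallyPrincipal Z) (hZ : Z ≠ Set.univ) :
    Dense Zᶜ := by
  rw [← interior_eq_empty_iff_dense_compl]
  by_contra hne
  have hclosed : IsClosed (interior Z) := by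
    rw [← closure_subset_iff_isClosed]
    intro a ha
    obtain ⟨φ, hφ, hev⟩ := h a
    obtain ⟨R, hR, hball⟩ := Metric.eventually_nhds_iff_ball.1 (hφ.eventually_analyticAt.and hev)
    obtain ⟨b, hb, hbi⟩ := mem_closure_iff.1 ha _ Metric.isOpen_ball (Metric.mem_ball_self hR)
    have hb0 : φ =ᶠ[𝓝 b] 0 := by
      filter_upwards [mem_interior_iff_mem_nhds.1 hbi, Metric.isOpen_ball.mem_nhds hb]
        with z hz hzb using (hball z hzb).2.1 hz
    have h1 := AnalyticOnNhd.eqOn_zero_of_preconnected_of_eventuallyEq_zero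
      (fun z hz => (hball z hz).1) (convex_ball a R).isPreconnected hb hb0
    rw [mem_interior_iff_mem_nhds]
    filter_upwards [Metric.ball_mem_nhds a hR] with z hz using (hball z hz).2.2 (h1 hz)
  rcases isClopen_iff.1 ⟨hclosed, isOpen_interior⟩ with h1 | h1
  · exact hne h1
  · exact hZ (interior_eq_univ.1 h1)

theorem LocallyPrincipal.comp_line {Z : Set E} (h : LocallyPrincipal Z) (z v : E) :
    LocallyPrincipal {t : ℂ | z + t • v ∈ Z} := by
  intro t
  obtain ⟨φ, hφ, hZ⟩ := h (z + t • v)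
  have : ContinuousAt (fun t : ℂ => z + t • v) t := by fun_prop
  exact ⟨_, analyticAt_comp_line hφ, this.eventually hZ⟩

theorem LocallyPrincipal.union {Z Z' : Set E} (h : LocallyPrincipal Z) (h' : LocallyPrincipal Z') :
    LocallyPrincipal (Z ∪ Z') := by
  intro a
  obtain ⟨φ, hφ, hZ⟩ := h a
  obtain ⟨φ', hφ', hZ'⟩ := h' a
  refine ⟨fun z => φ z * φ' z, hφ.mul hφ', ?_⟩
  filter_upwards [hZ, hZ'] with z h1 h2
  rw [mul_eq_zero, Set.mem_union, h1, h2]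

theorem LocallyPrincipal.iUnion {ι : Type*} [Finite ι] {Z : ι → Set E}
    (h : ∀ i, LocallyPrincipal (Z i)) : LocallyPrincipal (⋃ i, Z i) := by
  cases nonempty_fintype ι
  intro a
  choose φ hφ hZ using fun i => h i a
  refine ⟨fun z => ∏ i, φ i z, Finset.analyticAt_fun_prod _ fun i _ => hφ i, ?_⟩
  filter_upwards [eventually_all.2 hZ] with z hz
  simp [Finset.prod_eq_zero_iff, hz]

end LocallyPrincipal


/-! ### Local representations and equality of divisors. -/

section Representation

variable {m n : ℕ} {f : (Fin m → ℂ) →. ProjSpace n} {F G : (Fin m → ℂ) → (Fin (n + 1) → ℂ)}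
  {a : Fin m → ℂ}

theorem RepresentsNear.eventually_eq_zero_iff (hF : RepresentsNear f F a) :
    ∀ᶠ z in 𝓝 a, F z = 0 ↔ z ∉ f.Dom := by
  filter_upwards [hF.2] with z hz
  exact ⟨hz.1, fun h => by_contra fun h0 => h (Part.dom_iff_mem.2 ⟨_, hz.2 h0⟩)⟩

theorem RepresentsNear.eventually (hF : RepresentsNear f F a) :
    ∀ᶠ b in 𝓝 a, RepresentsNear f F b :=
  hF.1.eventually_analyticAt.and (eventually_eventually_nhds.2 hF.2)

theorem RepresentsNear.eventually_exists_eq_smul (hF : RepresentsNear f F a)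
    (hG : RepresentsNear f G a) : ∀ᶠ z in 𝓝 a, ∃ c : ℂ, c ≠ 0 ∧ G z = c • F z := by
  filter_upwards [hF.2, hG.2, hF.eventually_eq_zero_iff, hG.eventually_eq_zero_iff]
    with z h1 h2 h3 h4
  by_cases h0 : F z = 0
  · exact ⟨1, one_ne_zero, by rw [h0, smul_zero]; exact h4.2 (h3.1 h0)⟩
  · have h0' : G z ≠ 0 := fun h => h0 (h3.2 (h4.1 h))
    obtain ⟨c, hc⟩ := (Projectivization.mk_eq_mk_iff' ℂ _ _ h0' h0).1
      (Part.mem_unique (h2.2 h0') (h1.2 h0))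
    refine ⟨c, ?_, hc.symm⟩
    rintro rfl
    exact h0' (by rw [← hc, zero_smul])

-- The two representations are proportional, with factor of modulus ‖G‖/‖F‖, bounded near a because
-- F a ≠ 0.
open Asymptotics in
theorem RepresentsNear.isBigO_apply (hF : RepresentsNear f F a) (hG : RepresentsNear f G a)
    (h0 : F a ≠ 0) (l : LinForm n) : (fun z => l (G z)) =O[𝓝 a] fun z => l (F z) := by
  have hFa : 0 < ‖F a‖ := norm_pos_iff.2 h0
  refine IsBigO.of_bound ((‖G a‖ + 1) / (‖F a‖ / 2)) ?_
  filter_upwards [hF.eventually_exists_eq_smul hG,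
    hF.1.continuousAt.norm.eventually_const_lt (half_lt_self hFa),
    hG.1.continuousAt.norm.eventually_lt_const (lt_add_one _)] with z ⟨c, hc, h1⟩ h2 h3
  rw [h1, map_smul, norm_smul]
  gcongr
  rw [le_div_iff₀ (by positivity)]
  rw [h1, norm_smul] at h3
  nlinarith [norm_nonneg c]

theorem RepresentsNear.analyticAt_apply (hF : RepresentsNear f F a) (l : LinForm n) :
    AnalyticAt ℂ (fun z => l (F z)) a :=
  (LinearMap.toContinuousLinearMap l).analyticAt _ |>.comp hF.1

end Representation

namespace MeromorphicMap

variable {m n N : ℕ}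

theorem representsNear_reducedRep (f : MeromorphicMap m n) (a : Fin m → ℂ) :
    RepresentsNear f.toPFun (f.reducedRep a) a :=
  (f.exists_rep a).choose_spec

/-- Homogeneous coordinates of the values of `f`, zero at the points of indeterminacy. -/
noncomputable def homCoord (f : MeromorphicMap m n) (z : Fin m → ℂ) : Fin (n + 1) → ℂ :=
  f.reducedRep z z

theorem homCoord_eq_zero_iff (f : MeromorphicMap m n) {z : Fin m → ℂ} :
    f.homCoord z = 0 ↔ z ∉ f.toPFun.Dom :=
  (f.representsNear_reducedRep z).eventually_eq_zero_iff.self_of_nhds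

theorem mk_homCoord_mem (f : MeromorphicMap m n) {z : Fin m → ℂ} (h : f.homCoord z ≠ 0) :
    Projectivization.mk ℂ (f.homCoord z) h ∈ f.toPFun z :=
  (f.representsNear_reducedRep z).2.self_of_nhds.2 h

theorem eventually_exists_homCoord_eq_smul (f : MeromorphicMap m n)
    {F : (Fin m → ℂ) → (Fin (n + 1) → ℂ)} {a : Fin m → ℂ} (hF : RepresentsNear f.toPFun F a) :
    ∀ᶠ z in 𝓝 a, ∃ c : ℂ, c ≠ 0 ∧ f.homCoord z = c • F z := by
  filter_upwards [hF.eventually] with z hz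
  exact (hz.eventually_exists_eq_smul (f.representsNear_reducedRep z)).self_of_nhds

/-- The common zeros of the coordinates form the indeterminacy locus, of codimension two. This is
the thinness required by `exists_eventually_norm_le_mul_norm`. -/
theorem not_eventually_rep_eq_zero (f : MeromorphicMap m n)
    {F : (Fin m → ℂ) → (Fin (n + 1) → ℂ)} {a : Fin m → ℂ} (hF : RepresentsNear f.toPFun F a)
    (h0 : F a = 0) {κ : (Fin m → ℂ) → ℂ} (hκ : AnalyticAt ℂ κ a) (hκ0 : κ a = 0) :
    ¬ ∀ᶠ z in 𝓝 a, κ z = 0 → F z = 0 := by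
  intro h
  refine (f.codim_two a (hF.eventually_eq_zero_iff.self_of_nhds.1 h0)).not_eventually_mem hκ hκ0 ?_
  filter_upwards [h, hF.eventually_eq_zero_iff] with z h1 h2 h3 using h2.1 (h1 h3)

theorem locallyPrincipal_setOf_apply_homCoord_eq_zero (f : MeromorphicMap m n) (l : LinForm n) :
    LocallyPrincipal {z | l (f.homCoord z) = 0} := by
  intro a
  have hF := f.representsNear_reducedRep a
  refine ⟨_, hF.analyticAt_apply l, ?_⟩
  filter_upwards [f.eventually_exists_homCoord_eq_smul hF] with z ⟨c, hc, h⟩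
  simp [h, hc]

theorem mem_hyperplane_mk_iff {l : LinForm n} {v : Fin (n + 1) → ℂ} (hv : v ≠ 0) :
    Projectivization.mk ℂ v hv ∈ hyperplane l ↔ l v = 0 := by
  rw [hyperplane, Set.mem_ofPred_eq, Projectivization.submodule_mk, Submodule.span_singleton_le_iff_mem,
    LinearMap.mem_ker]

theorem exists_apply_homCoord_ne_zero (f : MeromorphicMap m n) {l : LinForm n}
    (h : ¬ f.image ⊆ hyperplane l) : ∃ z, l (f.homCoord z) ≠ 0 := by
  by_contra! h0
  refine h ?_
  rintro p ⟨z, hz⟩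
  have hne : f.homCoord z ≠ 0 := fun h1 =>
    f.homCoord_eq_zero_iff.1 h1 (Part.dom_iff_mem.2 ⟨p, hz⟩)
  rw [Part.mem_unique hz (f.mk_homCoord_mem hne), mem_hyperplane_mk_iff]
  exact h0 z

open Asymptotics in
/-- If `f^*(l) = g^*(l')`, then the local equation of `g^*(l')` is bounded by a multiple of the one
of `f^*(l)`. -/
theorem isBigO_of_pullbackDivisor_eq (f : MeromorphicMap m n) (g : MeromorphicMap m N)
    {l : LinForm n} {l' : LinForm N} (h : f.pullbackDivisor l = g.pullbackDivisor l')
    {F : (Fin m → ℂ) → (Fin (n + 1) → ℂ)} {G : (Fin m → ℂ) → (Fin (N + 1) → ℂ)} {a : Fin m → ℂ}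
    (hF : RepresentsNear f.toPFun F a) (hG : RepresentsNear g.toPFun G a)
    (h0 : ∃ᶠ z in 𝓝 a, l (F z) ≠ 0) :
    (fun z => l' (G z)) =O[𝓝 a] fun z => l (F z) := by
  obtain ⟨R, hR, hball⟩ := Metric.eventually_nhds_iff_ball.1 (hF.eventually.and hG.eventually)
  have hord : ∀ z ∈ Metric.ball a R, F z ≠ 0 → G z ≠ 0 → ∀ k : ℕ,
      ((fun y => l (F (z + y))) =O[𝓝 0] fun y => ‖y‖ ^ k) →
        (fun y => l' (G (z + y))) =O[𝓝 0] fun y => ‖y‖ ^ k := by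
    intro z hz hF0 hG0 k hk
    obtain ⟨hFz, hGz⟩ := hball z hz
    have hF' := f.representsNear_reducedRep z
    have hG' := g.representsNear_reducedRep z
    have htend : Tendsto (fun y => z + y) (𝓝 0) (𝓝 z) := by
      simpa using (continuous_const_add z).tendsto 0
    have hG0' : g.reducedRep z z ≠ 0 := fun h0 => hG0 (hGz.eventually_eq_zero_iff.self_of_nhds.2
      (hG'.eventually_eq_zero_iff.self_of_nhds.1 h0))
    -- The divisor at z is computed in the representation chosen at z, which is comparable with F
    -- and G where these do not vanish; their zeros are the thin sets to be ignored.
    have h1 := ((hFz.isBigO_apply hF' hF0 l).comp_tendsto htend).trans hk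
    have h2 := (isBigO_norm_pow_iff_natCast_le_vanishingOrder (hF'.analyticAt_apply l)).1 h1
    have h3 := congrFun h z
    rw [pullbackDivisor, pullbackDivisor] at h3
    rw [h3] at h2
    have h4 := (isBigO_norm_pow_iff_natCast_le_vanishingOrder (hG'.analyticAt_apply l')).2 h2
    exact ((hG'.isBigO_apply hGz hG0' l').comp_tendsto htend).trans h4
  obtain ⟨M, hM⟩ := exists_eventually_norm_le_mul_norm (φ := fun z => l (F z))
    (χ := fun z => l' (G z)) (ψ₁ := F) (ψ₂ := G) (O := Metric.ball a R) Metric.isOpen_ball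
    (fun z hz => (hball z hz).1.analyticAt_apply l) (fun z hz => (hball z hz).2.analyticAt_apply l')
    (fun z hz => (hball z hz).1.1) (fun z hz => (hball z hz).2.1)
    (fun z hz hz0 κ hκ hκ0 => f.not_eventually_rep_eq_zero (hball z hz).1 hz0 hκ hκ0)
    (fun z hz hz0 κ hκ hκ0 => g.not_eventually_rep_eq_zero (hball z hz).2 hz0 hκ hκ0)
    hord (Metric.mem_ball_self hR) h0
  exact IsBigO.of_bound M hM

end MeromorphicMap


/-! ### Cross ratios. -/

theorem AnalyticAt.analyticOrderAt_le_of_isBigO {a b : ℂ → ℂ} {t : ℂ} (ha : AnalyticAt ℂ a t)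
    (hb : AnalyticAt ℂ b t) (h : b =O[𝓝 t] a) : analyticOrderAt a t ≤ analyticOrderAt b t := by
  refine ENat.forall_natCast_le_iff_le.1 fun k hk => ?_
  refine hb.natCast_le_analyticOrderAt_of_isBigO ?_
  have htend : Tendsto (fun s => t + s) (𝓝 0) (𝓝 t) := by
    simpa using (continuous_const_add t).tendsto 0
  refine (h.comp_tendsto htend).trans (ha.isBigO_norm_pow_of_iteratedFDeriv_eq_zero fun j hj => ?_)
  have h1 := (natCast_le_analyticOrderAt_iff_iteratedDeriv_eq_zero ha).1 hk j hj
  refine ContinuousMultilinearMap.ext fun v => ?_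
  rw [iteratedFDeriv_apply_eq_iteratedDeriv_mul_prod, h1]
  simp

open Asymptotics in
/-- Cross ratios of functions that are locally given, up to common nonvanishing factors, by
analytic functions with the same zeros extend to entire functions without zeros. -/
theorem exists_differentiable_eq_div {α α₀ β β₀ : ℂ → ℂ}
    (h : ∀ t, ∃ a a₀ b b₀ : ℂ → ℂ, AnalyticAt ℂ a t ∧ AnalyticAt ℂ a₀ t ∧ AnalyticAt ℂ b t ∧
      AnalyticAt ℂ b₀ t ∧ (∀ᶠ s in 𝓝 t, ∃ c : ℂ, c ≠ 0 ∧ α s = c * a s ∧ α₀ s = c * a₀ s) ∧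
      (∀ᶠ s in 𝓝 t, ∃ d : ℂ, d ≠ 0 ∧ β s = d * b s ∧ β₀ s = d * b₀ s) ∧
      (∃ᶠ s in 𝓝 t, a s ≠ 0) ∧ (∃ᶠ s in 𝓝 t, a₀ s ≠ 0) ∧
      a =O[𝓝 t] b ∧ b =O[𝓝 t] a ∧ a₀ =O[𝓝 t] b₀ ∧ b₀ =O[𝓝 t] a₀) :
    ∃ U : ℂ → ℂ, Differentiable ℂ U ∧ (∀ t, U t ≠ 0) ∧
      ∀ t, α₀ t ≠ 0 → β t ≠ 0 → U t = α t * β₀ t / (α₀ t * β t) := by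
  set ρ : ℂ → ℂ := fun t => α t * β₀ t / (α₀ t * β t) with hρ
  have key : ∀ t, MeromorphicAt ρ t ∧ meromorphicOrderAt ρ t = 0 ∧
      (α₀ t ≠ 0 → β t ≠ 0 → AnalyticAt ℂ ρ t) := by
    intro t
    obtain ⟨a, a₀, b, b₀, ha, ha₀, hb, hb₀, hα, hβ, hfa, hfa₀, hab, hba, hab₀, hba₀⟩ := h t
    have heq : ρ =ᶠ[𝓝 t] (a * b₀) / (a₀ * b) := by
      filter_upwards [hα, hβ] with s ⟨c, hc, h1, h2⟩ ⟨d, hd, h3, h4⟩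
      simp only [hρ, h1, h2, h3, h4, Pi.div_apply, Pi.mul_apply]
      rw [mul_mul_mul_comm c (a s), mul_mul_mul_comm c (a₀ s), mul_div_mul_left _ _ (mul_ne_zero hc hd)]
    have hm := ((ha.mul hb₀).meromorphicAt.div (ha₀.mul hb).meromorphicAt)
    have heq' := heq.filter_mono (nhdsWithin_le_nhds (s := {t}ᶜ))
    refine ⟨hm.congr heq'.symm, ?_, ?_⟩
    -- Mutual bounds mean equal orders, so numerator and denominator have the same order.
    · have hoa : analyticOrderAt a t = analyticOrderAt b t :=
        le_antisymm (ha.analyticOrderAt_le_of_isBigO hb hba) (hb.analyticOrderAt_le_of_isBigO ha hab)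
      have hoa₀ : analyticOrderAt a₀ t = analyticOrderAt b₀ t :=
        le_antisymm (ha₀.analyticOrderAt_le_of_isBigO hb₀ hba₀)
          (hb₀.analyticOrderAt_le_of_isBigO ha₀ hab₀)
      have hta : analyticOrderAt a t ≠ ⊤ := fun htop => by
        rw [analyticOrderAt_eq_top] at htop
        exact hfa (htop.mono fun s hs => not_not.2 hs)
      have hta₀ : analyticOrderAt a₀ t ≠ ⊤ := fun htop => by
        rw [analyticOrderAt_eq_top] at htop
        exact hfa₀ (htop.mono fun s hs => not_not.2 hs)
      rw [meromorphicOrderAt_congr heq', meromorphicOrderAt_div (ha.mul hb₀).meromorphicAt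
        (ha₀.mul hb).meromorphicAt, (ha.mul hb₀).meromorphicOrderAt_eq,
        (ha₀.mul hb).meromorphicOrderAt_eq, analyticOrderAt_mul ha hb₀, analyticOrderAt_mul ha₀ hb,
        ← hoa, ← hoa₀]
      lift analyticOrderAt a t to ℕ using hta with k
      lift analyticOrderAt a₀ t to ℕ using hta₀ with k₀
      rw [add_comm (k₀ : ℕ∞)]
      norm_cast
      simp
    · intro h1 h2
      refine AnalyticAt.congr ?_ heq.symm
      refine (ha.mul hb₀).div (ha₀.mul hb) ?_
      obtain ⟨c, hc, -, h3⟩ := hα.self_of_nhds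
      obtain ⟨d, hd, h4, -⟩ := hβ.self_of_nhds
      exact mul_ne_zero (fun h5 => h1 (by rw [h3, h5, mul_zero]))
        (fun h5 => h2 (by rw [h4, h5, mul_zero]))
  have hmer : MeromorphicOn ρ Set.univ := fun t _ => (key t).1
  have hnf : ∀ t, MeromorphicNFAt (toMeromorphicNFOn ρ Set.univ) t := fun t =>
    meromorphicNFOn_toMeromorphicNFOn ρ Set.univ (Set.mem_univ t)
  have hord : ∀ t, meromorphicOrderAt (toMeromorphicNFOn ρ Set.univ) t = 0 := fun t => by
    rw [meromorphicOrderAt_toMeromorphicNFOn hmer (Set.mem_univ t), (key t).2.1]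
  refine ⟨toMeromorphicNFOn ρ Set.univ, fun t => ?_, fun t => ?_, fun t h1 h2 => ?_⟩
  · exact ((hnf t).meromorphicOrderAt_nonneg_iff_analyticAt.1 (hord t).ge).differentiableAt
  · exact (hnf t).meromorphicOrderAt_eq_zero_iff.1 (hord t)
  · exact hmer.toMeromorphicNFOn_apply_of_analyticAt (Set.mem_univ t) ((key t).2.2 h1 h2)

/-- Finitely many functions on a dense open set, which along lines extend to entire functions
without zeros, have different absolute values at suitable points `z₀` and `z₁`, unless they are
constant. -/
theorem exists_forall_eq_of_norm_eq {E κ : Type*} [NormedAddCommGroup E] [NormedSpace ℂ E]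
    [CompleteSpace E] [Finite κ] {Ω : Set E} (hΩ : IsOpen Ω) (hΩd : Dense Ω) {ρ : κ → E → ℂ}
    (hcont : ∀ i, ContinuousOn (ρ i) Ω)
    (hline : ∀ i, ∀ p ∈ Ω, ∀ v : E, ∃ U : ℂ → ℂ, Differentiable ℂ U ∧
      ∀ t : ℂ, p + t • v ∈ Ω → U t = ρ i (p + t • v)) :
    ∃ z₀ ∈ Ω, ∃ z₁ ∈ Ω, ∀ i, ‖ρ i z₀‖ = ‖ρ i z₁‖ → ∀ z ∈ Ω, ∀ z' ∈ Ω, ρ i z = ρ i z' := by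
  obtain ⟨z₁, hz₁⟩ := hΩd.nonempty
  set T : κ → Set E := fun i => {z | z ∈ Ω ∧ (‖ρ i z‖ = ‖ρ i z₁‖ →
    ∀ z ∈ Ω, ∀ z' ∈ Ω, ρ i z = ρ i z')} with hT
  have hTo : ∀ i, IsOpen (T i) := by
    intro i
    by_cases hc : ∀ z ∈ Ω, ∀ z' ∈ Ω, ρ i z = ρ i z'
    · convert hΩ using 1
      ext z
      exact ⟨fun h => h.1, fun h => ⟨h, fun _ => hc⟩⟩
    · have : T i = Ω ∩ ρ i ⁻¹' {w | ‖w‖ ≠ ‖ρ i z₁‖} := by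
        ext z
        exact ⟨fun h => ⟨h.1, fun h1 => hc (h.2 h1)⟩, fun h => ⟨h.1, fun h1 => absurd h1 h.2⟩⟩
      rw [this]
      exact (hcont i).isOpen_inter_preimage hΩ (isOpen_ne_fun continuous_norm continuous_const)
  have hTd : ∀ i, Dense (T i) := by
    intro i y'
    by_cases hc : ∀ z ∈ Ω, ∀ z' ∈ Ω, ρ i z = ρ i z'
    · exact closure_mono (fun z hz => show z ∈ T i from ⟨hz, fun _ => hc⟩) (hΩd y')
    rw [mem_closure_iff]
    intro O hO hy'
    obtain ⟨y, hyO, hyΩ⟩ := mem_closure_iff.1 (hΩd y') O hO hy'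
    by_contra hne
    have hmod : ∀ z ∈ O ∩ Ω, ‖ρ i z‖ = ‖ρ i z₁‖ := by
      intro z hz
      by_contra h1
      exact hne ⟨z, hz.1, hz.2, fun h2 => absurd h2 h1⟩
    -- Constant modulus on an open set makes U locally constant by the maximum principle, hence
    -- constant on each line through y. So for nonconstant ρ i the points with another modulus than
    -- at z₁ are dense.
    have hconst : ∀ z ∈ Ω, ρ i z = ρ i y := by
      intro z hz
      obtain ⟨U, hU, hUe⟩ := hline i y hyΩ (z - y)
      have hnear : ∀ᶠ t in 𝓝 (0 : ℂ), ‖U t‖ = ‖ρ i z₁‖ := by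
        have : ContinuousAt (fun t : ℂ => y + t • (z - y)) 0 := by fun_prop
        filter_upwards [this.preimage_mem_nhds ((hO.inter hΩ).mem_nhds
          (show y + (0 : ℂ) • (z - y) ∈ O ∩ Ω by simpa using ⟨hyO, hyΩ⟩))] with t ht
        rw [hUe t ht.2, hmod _ ht]
      have h1 : ∀ᶠ t in 𝓝 (0 : ℂ), U t = U 0 := by
        refine Complex.eventually_eq_of_isLocalMax_norm (Eventually.of_forall fun t => hU t) ?_
        filter_upwards [hnear] with t ht
        simp only [Function.comp_apply]
        rw [ht, hnear.self_of_nhds]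
      have h2 : U = fun _ => U 0 :=
        AnalyticOnNhd.eq_of_eventuallyEq (z₀ := 0) (fun t _ => hU.analyticAt t)
          analyticOnNhd_const h1
      have h3 := hUe 0 (by simpa using hyΩ)
      have h4 := hUe 1 (by simpa using hz)
      rw [zero_smul, add_zero] at h3
      rw [h2, one_smul, add_sub_cancel] at h4
      exact h4.symm.trans h3
    exact hc fun z hz z' hz' => (hconst z hz).trans (hconst z' hz').symm
  have hd : Dense (Ω ∩ ⋂ i, T i) :=
    (hΩd.inter_of_isOpen_left (dense_iInter_of_isOpen hTo hTd) hΩ)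
  obtain ⟨z₀, h0, h1⟩ := hd.nonempty
  exact ⟨z₀, h0, z₁, hz₁, fun i => (Set.mem_iInter.1 h1 i).2⟩


theorem Dense.frequently_mem {X : Type*} [TopologicalSpace X] {S : Set X} (hS : Dense S) (x : X) :
    ∃ᶠ y in 𝓝 x, y ∈ S :=
  mem_closure_iff_frequently.1 (hS x)

namespace MeromorphicMap

variable {m n N q : ℕ}

theorem isBigO_and_isBigO_of_pullbackDivisor_eq (f : MeromorphicMap m n) (g : MeromorphicMap m N)
    {l : LinForm n} {l' : LinForm N} (h : f.pullbackDivisor l = g.pullbackDivisor l')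
    (hl : ∃ z, l (f.homCoord z) ≠ 0) (hl' : ∃ z, l' (g.homCoord z) ≠ 0) (a : Fin m → ℂ) :
    (fun z => l (f.reducedRep a z)) =O[𝓝 a] (fun z => l' (g.reducedRep a z)) ∧
      (fun z => l' (g.reducedRep a z)) =O[𝓝 a] (fun z => l (f.reducedRep a z)) := by
  have hF := f.representsNear_reducedRep a
  have hG := g.representsNear_reducedRep a
  obtain ⟨z, hz⟩ := hl
  obtain ⟨z', hz'⟩ := hl'
  have hd := (f.locallyPrincipal_setOf_apply_homCoord_eq_zero l).dense_compl
    (fun h => hz (h ▸ Set.mem_univ z : z ∈ {z | l (f.homCoord z) = 0}))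
  have hd' := (g.locallyPrincipal_setOf_apply_homCoord_eq_zero l').dense_compl
    (fun h => hz' (h ▸ Set.mem_univ z' : z' ∈ {z | l' (g.homCoord z) = 0}))
  refine ⟨g.isBigO_of_pullbackDivisor_eq f h.symm hG hF ?_,
    f.isBigO_of_pullbackDivisor_eq g h hF hG ?_⟩
  · refine ((hd'.frequently_mem a).and_eventually
      (g.eventually_exists_homCoord_eq_smul hG)).mono ?_
    rintro w ⟨h1, c, hc, h2⟩ h3
    exact h1 (by simp [h2, h3])
  · refine ((hd.frequently_mem a).and_eventually
      (f.eventually_exists_homCoord_eq_smul hF)).mono ?_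
    rintro w ⟨h1, c, hc, h2⟩ h3
    exact h1 (by simp [h2, h3])

/-- The quotient of the meromorphic functions `l / l₀` on `ℙⁿ` and `l' / l₀'` on `ℙᴺ`, pulled back
by `f` and `g`. -/
noncomputable def crossRatio (f : MeromorphicMap m n) (g : MeromorphicMap m N) (l l₀ : LinForm n)
    (l' l₀' : LinForm N) (z : Fin m → ℂ) : ℂ :=
  l (f.homCoord z) * l₀' (g.homCoord z) / (l₀ (f.homCoord z) * l' (g.homCoord z))

/-- The coordinates `homCoord` are chosen pointwise and need not be continuous; the cross ratio is
homogeneous of degree zero in each map, so one local representation computes it nearby. -/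
theorem continuousAt_crossRatio (f : MeromorphicMap m n) (g : MeromorphicMap m N)
    (l l₀ : LinForm n) (l' l₀' : LinForm N) {a : Fin m → ℂ} (h₁ : l₀ (f.homCoord a) ≠ 0)
    (h₂ : l' (g.homCoord a) ≠ 0) : ContinuousAt (f.crossRatio g l l₀ l' l₀') a := by
  have hF := f.representsNear_reducedRep a
  have hG := g.representsNear_reducedRep a
  have h1 : ContinuousAt (fun z => l (f.reducedRep a z) * l₀' (g.reducedRep a z) /
      (l₀ (f.reducedRep a z) * l' (g.reducedRep a z))) a :=
    ((hF.analyticAt_apply l).continuousAt.mul (hG.analyticAt_apply l₀').continuousAt).div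
      ((hF.analyticAt_apply l₀).continuousAt.mul (hG.analyticAt_apply l').continuousAt)
      (mul_ne_zero h₁ h₂)
  refine h1.congr ?_
  filter_upwards [f.eventually_exists_homCoord_eq_smul hF, g.eventually_exists_homCoord_eq_smul hG]
    with z ⟨c, hc, h3⟩ ⟨d, hd, h4⟩
  simp only [crossRatio, h3, h4, map_smul, smul_eq_mul]
  rw [mul_mul_mul_comm c (l _), mul_mul_mul_comm c (l₀ _), mul_div_mul_left _ _ (mul_ne_zero hc hd)]

/-- Mutual bounds between the local equations survive restriction to the line, which lies in none of
the hypersurfaces because p does not. -/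
theorem exists_differentiable_eq_crossRatio (f : MeromorphicMap m n) (g : MeromorphicMap m N)
    {l l₀ : LinForm n} {l' l₀' : LinForm N} (h : f.pullbackDivisor l = g.pullbackDivisor l')
    (h₀ : f.pullbackDivisor l₀ = g.pullbackDivisor l₀') {p : Fin m → ℂ}
    (hl : l (f.homCoord p) ≠ 0) (hl' : l' (g.homCoord p) ≠ 0) (hl₀ : l₀ (f.homCoord p) ≠ 0)
    (hl₀' : l₀' (g.homCoord p) ≠ 0) (v : Fin m → ℂ) :
    ∃ U : ℂ → ℂ, Differentiable ℂ U ∧ (∀ t, U t ≠ 0) ∧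
      ∀ t : ℂ, l₀ (f.homCoord (p + t • v)) ≠ 0 → l' (g.homCoord (p + t • v)) ≠ 0 →
        U t = f.crossRatio g l l₀ l' l₀' (p + t • v) := by
  refine exists_differentiable_eq_div (α := fun t => l (f.homCoord (p + t • v)))
    (α₀ := fun t => l₀ (f.homCoord (p + t • v))) (β := fun t => l' (g.homCoord (p + t • v)))
    (β₀ := fun t => l₀' (g.homCoord (p + t • v))) fun t => ?_
  set a := p + t • v with ha
  have hF := f.representsNear_reducedRep a
  have hG := g.representsNear_reducedRep a
  have htend : Tendsto (fun s : ℂ => p + s • v) (𝓝 t) (𝓝 a) := by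
    have : Continuous fun s : ℂ => p + s • v := by fun_prop
    exact this.tendsto t
  have hFc := htend.eventually (f.eventually_exists_homCoord_eq_smul hF)
  have hGc := htend.eventually (g.eventually_exists_homCoord_eq_smul hG)
  have hfreq : ∀ l₁ : LinForm n, l₁ (f.homCoord p) ≠ 0 →
      ∃ᶠ s : ℂ in 𝓝 t, l₁ (f.reducedRep a (p + s • v)) ≠ 0 := by
    intro l₁ h₁
    have hd := ((f.locallyPrincipal_setOf_apply_homCoord_eq_zero l₁).comp_line p v).dense_compl
      (fun h => h₁ (by
        have h2 : (0 : ℂ) ∈ {t : ℂ | p + t • v ∈ {z | l₁ (f.homCoord z) = 0}} :=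
          h ▸ Set.mem_univ _
        simpa using h2))
    refine ((hd.frequently_mem t).and_eventually hFc).mono ?_
    rintro w ⟨h1, c, hc, h2⟩ h3
    exact h1 (by simp [h2, h3])
  have hO := f.isBigO_and_isBigO_of_pullbackDivisor_eq g h ⟨p, hl⟩ ⟨p, hl'⟩ a
  have hO₀ := f.isBigO_and_isBigO_of_pullbackDivisor_eq g h₀ ⟨p, hl₀⟩ ⟨p, hl₀'⟩ a
  refine ⟨fun s => l (f.reducedRep a (p + s • v)), fun s => l₀ (f.reducedRep a (p + s • v)),
    fun s => l' (g.reducedRep a (p + s • v)), fun s => l₀' (g.reducedRep a (p + s • v)),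
    analyticAt_comp_line (hF.analyticAt_apply l), analyticAt_comp_line (hF.analyticAt_apply l₀),
    analyticAt_comp_line (hG.analyticAt_apply l'), analyticAt_comp_line (hG.analyticAt_apply l₀'),
    ?_, ?_, hfreq l hl, hfreq l₀ hl₀, hO.1.comp_tendsto htend, hO.2.comp_tendsto htend,
    hO₀.1.comp_tendsto htend, hO₀.2.comp_tendsto htend⟩
  · filter_upwards [hFc] with s ⟨c, hc, h1⟩
    exact ⟨c, hc, by simp [h1], by simp [h1]⟩
  · filter_upwards [hGc] with s ⟨c, hc, h1⟩
    exact ⟨c, hc, by simp [h1], by simp [h1]⟩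

/-- The complement of the hypersurfaces where one of the given forms vanishes on `f`. -/
def regularLocus (f : MeromorphicMap m n) (H : Fin q → LinForm n) : Set (Fin m → ℂ) :=
  (⋃ j, {z | H j (f.homCoord z) = 0})ᶜ

theorem mem_regularLocus {f : MeromorphicMap m n} {H : Fin q → LinForm n} {z : Fin m → ℂ} :
    z ∈ f.regularLocus H ↔ ∀ j, H j (f.homCoord z) ≠ 0 := by
  simp [regularLocus]

theorem isOpen_regularLocus (f : MeromorphicMap m n) (H : Fin q → LinForm n) :
    IsOpen (f.regularLocus H) :=
  (LocallyPrincipal.iUnion fun j =>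
    f.locallyPrincipal_setOf_apply_homCoord_eq_zero (H j)).isOpen_compl

theorem dense_regularLocus (f : MeromorphicMap m n) {H : Fin q → LinForm n}
    (h : ∀ j, ∃ z, H j (f.homCoord z) ≠ 0) : Dense (f.regularLocus H) := by
  rw [regularLocus, Set.compl_iUnion]
  refine dense_iInter_of_isOpen
    (fun j => (f.locallyPrincipal_setOf_apply_homCoord_eq_zero (H j)).isOpen_compl) fun j => ?_
  obtain ⟨z, hz⟩ := h j
  exact (f.locallyPrincipal_setOf_apply_homCoord_eq_zero (H j)).dense_compl
    (fun h => hz (h ▸ Set.mem_univ z : z ∈ {z | H j (f.homCoord z) = 0}))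

theorem dense_setOf_line_mem_regularLocus (f : MeromorphicMap m n) (g : MeromorphicMap m N)
    {H : Fin q → LinForm n} {H' : Fin q → LinForm N} {p : Fin m → ℂ}
    (hp : p ∈ f.regularLocus H ∩ g.regularLocus H') (v : Fin m → ℂ) :
    Dense {t : ℂ | p + t • v ∈ f.regularLocus H ∩ g.regularLocus H'} := by
  have h1 := ((LocallyPrincipal.iUnion fun j =>
    f.locallyPrincipal_setOf_apply_homCoord_eq_zero (H j)).union (LocallyPrincipal.iUnion fun j =>
    g.locallyPrincipal_setOf_apply_homCoord_eq_zero (H' j))).comp_line p v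
  convert h1.dense_compl fun h => ?_ using 1
  · ext t
    simp [regularLocus]
  · have h2 := Set.eq_univ_iff_forall.1 h 0
    rw [Set.mem_ofPred_eq, zero_smul, add_zero] at h2
    exact h2.elim hp.1 hp.2

/-- There are `n + 2` of the hyperplanes for which all cross ratios are constant. -/
theorem exists_injective_crossRatio_eq (hnN : n ≤ N)
    (hq : min (N + 2 * n + 2) (max (2 * N + 1) (3 * n + 2)) ≤ q) (hq0 : 0 < q)
    {H : Fin q → LinForm n} {H' : Fin q → LinForm N}
    (hH : InGeneralPosition H) (hH' : InGeneralPosition H')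
    (f : MeromorphicMap m n) (g : MeromorphicMap m N)
    (hf : ∀ j, ∃ z, H j (f.homCoord z) ≠ 0) (hg : ∀ j, ∃ z, H' j (g.homCoord z) ≠ 0)
    (hfg : ∀ j, f.pullbackDivisor (H j) = g.pullbackDivisor (H' j)) :
    ∃ k : Fin (n + 2) → Fin q, Function.Injective k ∧
      ∀ i j, ∀ z ∈ f.regularLocus H ∩ g.regularLocus H', ∀ z' ∈ f.regularLocus H ∩ g.regularLocus H',
        f.crossRatio g (H (k i)) (H (k j)) (H' (k i)) (H' (k j)) z =
          f.crossRatio g (H (k i)) (H (k j)) (H' (k i)) (H' (k j)) z' := by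
  set Ω := f.regularLocus H ∩ g.regularLocus H' with hΩ
  have hΩo : IsOpen Ω := (f.isOpen_regularLocus H).inter (g.isOpen_regularLocus H')
  have hΩd : Dense Ω := (f.dense_regularLocus hf).inter_of_isOpen_left (g.dense_regularLocus hg)
    (f.isOpen_regularLocus H)
  have hΩf : ∀ z ∈ Ω, ∀ j, H j (f.homCoord z) ≠ 0 := fun z hz => mem_regularLocus.1 hz.1
  have hΩg : ∀ z ∈ Ω, ∀ j, H' j (g.homCoord z) ≠ 0 := fun z hz => mem_regularLocus.1 hz.2
  have hline : ∀ i j, ∀ p ∈ Ω, ∀ v : Fin m → ℂ, ∃ U : ℂ → ℂ, Differentiable ℂ U ∧ (∀ t, U t ≠ 0) ∧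
      ∀ t : ℂ, p + t • v ∈ Ω → U t = f.crossRatio g (H i) (H j) (H' i) (H' j) (p + t • v) := by
    intro i j p hp v
    obtain ⟨U, h1, h2, h3⟩ := f.exists_differentiable_eq_crossRatio g (hfg i) (hfg j)
      (hΩf p hp i) (hΩg p hp i) (hΩf p hp j) (hΩg p hp j) v
    exact ⟨U, h1, h2, fun t ht => h3 t (hΩf _ ht j) (hΩg _ ht i)⟩
  -- The points must serve all pairs of indices at once, as k will depend on them.
  obtain ⟨z₀, hz₀, z₁, hz₁, hconst⟩ := exists_forall_eq_of_norm_eq hΩo hΩd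
    (ρ := fun (ij : Fin q × Fin q) => f.crossRatio g (H ij.1) (H ij.2) (H' ij.1) (H' ij.2))
    (fun ij z hz => (f.continuousAt_crossRatio g _ _ _ _ (hΩf z hz _)
      (hΩg z hz _)).continuousWithinAt)
    (fun ij p hp v => by
      obtain ⟨U, h1, -, h3⟩ := hline ij.1 ij.2 p hp v
      exact ⟨U, h1, h3⟩)
  choose U hU hU0 hUe using fun j => hline j ⟨0, hq0⟩ z₁ hz₁ (z₀ - z₁)
  obtain ⟨k, hk, hkU⟩ := exists_injective_norm_div_eq hnN hq hH hH' hU hU0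
    ((f.dense_setOf_line_mem_regularLocus g hz₁ (z₀ - z₁)).mono fun t ht => by
      set z := z₁ + t • (z₀ - z₁) with hz
      refine ⟨(H ⟨0, hq0⟩ (f.homCoord z))⁻¹ • f.homCoord z,
        (H' ⟨0, hq0⟩ (g.homCoord z))⁻¹ • g.homCoord z, ?_, fun j => ?_⟩
      · refine smul_ne_zero (inv_ne_zero (hΩf z ht _)) fun h => hΩf z ht ⟨0, hq0⟩ ?_
        rw [h, map_zero]
      · rw [hUe j t ht, crossRatio, ← hz]
        have h1 := hΩf z ht ⟨0, hq0⟩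
        have h2 := hΩg z ht ⟨0, hq0⟩
        have h3 := hΩg z ht j
        simp only [map_smul, smul_eq_mul]
        field_simp) 1 0
  refine ⟨k, hk, fun i j => hconst (k i, k j) ?_⟩
  have hU1 : ∀ j, U j 1 = f.crossRatio g (H j) (H ⟨0, hq0⟩) (H' j) (H' ⟨0, hq0⟩) z₀ := fun j => by
    have h1 := hUe j 1 (by simpa using hz₀)
    rwa [one_smul, add_sub_cancel] at h1
  have hU2 : ∀ j, U j 0 = f.crossRatio g (H j) (H ⟨0, hq0⟩) (H' j) (H' ⟨0, hq0⟩) z₁ := fun j => by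
    have h1 := hUe j 0 (by simpa using hz₁)
    rwa [zero_smul, add_zero] at h1
  -- The reference index cancels in the quotient, so equal growth of U (k i) and U (k j) means equal
  -- moduli of their cross ratio at z₀ and z₁.
  have hdiv : ∀ z ∈ Ω, f.crossRatio g (H (k i)) (H (k j)) (H' (k i)) (H' (k j)) z =
      f.crossRatio g (H (k i)) (H ⟨0, hq0⟩) (H' (k i)) (H' ⟨0, hq0⟩) z /
        f.crossRatio g (H (k j)) (H ⟨0, hq0⟩) (H' (k j)) (H' ⟨0, hq0⟩) z := by
    intro z hz
    have h1 := hΩf z hz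
    have h2 := hΩg z hz
    simp only [crossRatio]
    have := h1 ⟨0, hq0⟩
    have := h2 ⟨0, hq0⟩
    have := h1 (k i)
    have := h2 (k i)
    have := h1 (k j)
    have := h2 (k j)
    field_simp
  have hkij := hkU i j
  have hne : ∀ j t, ‖U j t‖ ≠ 0 := fun j t => norm_ne_zero_iff.2 (hU0 j t)
  rw [div_eq_div_iff (hne _ _) (hne _ _)] at hkij
  simp only
  rw [hdiv z₀ hz₀, hdiv z₁ hz₁, ← hU1, ← hU1, ← hU2, ← hU2, norm_div, norm_div,
    div_eq_div_iff (hne _ _) (hne _ _), hkij, mul_comm]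

end MeromorphicMap


/-! ### Construction of the projective linear map. -/

section LinearAlgebra

variable {n N : ℕ}

/-- A linear relation between `n + 2` forms in general position with all coefficients nonzero. -/
theorem exists_sum_smul_eq_zero_of_linearIndependent {e : Fin (n + 2) → LinForm n}
    (he : ∀ s : Finset (Fin (n + 2)), s.card ≤ n + 1 → LinearIndependent ℂ fun j : s => e j) :
    ∃ a : Fin (n + 2) → ℂ, (∀ i, a i ≠ 0) ∧ ∑ i, a i • e i = 0 := by
  have hdep : ¬ LinearIndependent ℂ e := fun h => by
    have := h.fintype_card_le_finrank
    simp at this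
  obtain ⟨a, ha, i₀, hi₀⟩ := Fintype.not_linearIndependent_iff.1 hdep
  refine ⟨a, fun i hi => ?_, ha⟩
  have hne : i₀ ≠ i := fun h => hi₀ (h ▸ hi)
  have h1 := he (Finset.univ.erase i) (by simp)
  have h2 := Fintype.linearIndependent_iff.1 h1 (fun j => a j) ?_ ⟨i₀, by simpa using hne⟩
  · exact hi₀ h2
  · rw [← Finset.add_sum_erase _ _ (Finset.mem_univ i), hi, zero_smul, zero_add] at ha
    rw [← ha]
    exact Finset.sum_coe_sort (Finset.univ.erase i) fun j => a j • e j

theorem injective_pi_castSucc {e : Fin (n + 2) → LinForm n}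
    (he : ∀ s : Finset (Fin (n + 2)), s.card ≤ n + 1 → LinearIndependent ℂ fun j : s => e j) :
    Function.Injective (LinearMap.pi fun i : Fin (n + 1) => e i.castSucc) := by
  rw [← LinearMap.ker_eq_bot, LinearMap.ker_eq_bot']
  intro X hX
  refine eq_zero_of_forall_apply_eq_zero (a := e) he (t := Finset.univ.map Fin.castSuccEmb)
    (by simp) fun r hr => ?_
  obtain ⟨i, -, rfl⟩ := Finset.mem_map.1 hr
  exact congrFun hX i

/-- With the first n + 1 forms of each family as coordinates, L is diagonal with entries c i. The
equation for the last form follows from the two relations, since its coefficient is nonzero. -/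
theorem exists_linearEquiv_forall_apply_eq {e e' : Fin (n + 2) → LinForm n} {a c : Fin (n + 2) → ℂ}
    (he : ∀ s : Finset (Fin (n + 2)), s.card ≤ n + 1 → LinearIndependent ℂ fun j : s => e j)
    (he' : ∀ s : Finset (Fin (n + 2)), s.card ≤ n + 1 → LinearIndependent ℂ fun j : s => e' j)
    (ha : ∀ i, a i ≠ 0) (hc : ∀ i, c i ≠ 0) (hae : ∑ i, a i • e i = 0)
    (hae' : ∑ i, (a i * c i) • e' i = 0) :
    ∃ L : (Fin (n + 1) → ℂ) ≃ₗ[ℂ] (Fin (n + 1) → ℂ), ∀ i Y, e i (L Y) = c i * e' i Y := by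
  set T := LinearEquiv.ofInjectiveEndo _ (injective_pi_castSucc he)
  set T' := LinearEquiv.ofInjectiveEndo _ (injective_pi_castSucc he')
  set D : (Fin (n + 1) → ℂ) ≃ₗ[ℂ] (Fin (n + 1) → ℂ) :=
    LinearEquiv.piCongrRight fun i => LinearEquiv.smulOfNeZero ℂ ℂ (c i.castSucc) (hc _)
  have hT : ∀ X i, T X i = e i.castSucc X := fun X i => rfl
  have hT' : ∀ X i, T' X i = e' i.castSucc X := fun X i => rfl
  have hD : ∀ X i, D X i = c i.castSucc * X i := fun X i => rfl
  have hcast : ∀ i : Fin (n + 1), ∀ Y, e i.castSucc ((T' ≪≫ₗ D ≪≫ₗ T.symm) Y) =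
      c i.castSucc * e' i.castSucc Y := by
    intro i Y
    rw [← hT, LinearEquiv.trans_apply, LinearEquiv.trans_apply, LinearEquiv.apply_symm_apply, hD,
      hT']
  refine ⟨T' ≪≫ₗ D ≪≫ₗ T.symm, fun i Y => ?_⟩
  induction i using Fin.lastCases with
  | cast i => exact hcast i Y
  | last =>
    have h1 := LinearMap.congr_fun hae ((T' ≪≫ₗ D ≪≫ₗ T.symm) Y)
    have h2 := LinearMap.congr_fun hae' Y
    simp only [LinearMap.sum_apply, LinearMap.smul_apply, smul_eq_mul, LinearMap.zero_apply] at h1 h2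
    rw [Fin.sum_univ_castSucc] at h1 h2
    simp only [hcast, ← mul_assoc] at h1 h2
    refine mul_left_cancel₀ (ha (Fin.last _)) ?_
    rw [← mul_assoc]
    exact add_left_cancel (h1.trans h2.symm)

theorem image_projectiveLinearMap_hyperplane
    {L : (Fin (N + 1) → ℂ) ≃ₗ[ℂ] (Fin (n + 1) → ℂ)} {l : LinForm n} {l' : LinForm N} {c : ℂ}
    (hc : c ≠ 0) (h : ∀ Y, l (L Y) = c * l' Y) :
    projectiveLinearMap L '' hyperplane l' = hyperplane l := by
  ext p
  constructor
  · rintro ⟨p', hp', rfl⟩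
    induction p' using Projectivization.ind with
    | h v hv =>
      rw [MeromorphicMap.mem_hyperplane_mk_iff] at hp'
      rw [projectiveLinearMap, Projectivization.map_mk, MeromorphicMap.mem_hyperplane_mk_iff]
      simp [h, hp']
  · intro hp
    induction p using Projectivization.ind with
    | h v hv =>
      rw [MeromorphicMap.mem_hyperplane_mk_iff] at hp
      refine ⟨Projectivization.mk ℂ (L.symm v) (by simpa using hv), ?_, ?_⟩
      · rw [MeromorphicMap.mem_hyperplane_mk_iff]
        have h1 := h (L.symm v)
        rw [LinearEquiv.apply_symm_apply, hp] at h1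
        exact (mul_eq_zero.1 h1.symm).resolve_left hc
      · rw [projectiveLinearMap, Projectivization.map_mk]
        simp

end LinearAlgebra

/-! ### Extension from a dense set, and the theorem. -/

namespace MeromorphicMap

variable {m n N : ℕ}

theorem LinearlyNondegenerate.eq_zero_of_dense {g : MeromorphicMap m N}
    (hg : g.LinearlyNondegenerate) {l : LinForm N} {Ω : Set (Fin m → ℂ)} (hΩ : Dense Ω)
    (h : ∀ z ∈ Ω, l (g.homCoord z) = 0) : l = 0 := by
  by_contra hl
  obtain ⟨z, hz⟩ := g.exists_apply_homCoord_ne_zero (hg l hl)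
  obtain ⟨w, hw1, hw2⟩ := hΩ.inter_open_nonempty _
    (g.locallyPrincipal_setOf_apply_homCoord_eq_zero l).isOpen_compl ⟨z, hz⟩
  exact hw1 (h w hw2)

/-- Proportionality is expressed by 2×2 minors, whose vanishing is a closed condition. -/
theorem eventually_mul_apply_eq {E : Type*} [TopologicalSpace E] {F K : E → Fin (n + 1) → ℂ} {a : E}
    (hF : ∀ᶠ z in 𝓝 a, ContinuousAt F z) (hK : ∀ᶠ z in 𝓝 a, ContinuousAt K z) {Ω : Set E}
    (hΩ : Dense Ω) (h : ∀ᶠ z in 𝓝 a, z ∈ Ω → ∃ c : ℂ, F z = c • K z) :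
    ∀ᶠ z in 𝓝 a, ∀ i j, F z i * K z j = F z j * K z i := by
  filter_upwards [hF, hK, eventually_eventually_nhds.2 h] with z h1 h2 h3 i j
  by_contra hne
  have hc : ∀ i, ContinuousAt (fun z => F z i) z := fun i => (continuousAt_pi.1 h1) i
  have hc' : ∀ i, ContinuousAt (fun z => K z i) z := fun i => (continuousAt_pi.1 h2) i
  have h4 := (((hc i).mul (hc' j)).sub ((hc j).mul (hc' i))).eventually_ne (sub_ne_zero.2 hne)
  obtain ⟨w, hw, h5, h6⟩ := ((hΩ.frequently_mem z).and_eventually (h4.and h3)).exists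
  obtain ⟨c, h7⟩ := h6 hw
  apply h5
  simp only [h7, Pi.sub_apply, Pi.mul_apply, Pi.smul_apply, smul_eq_mul]
  ring

/-- If F a = 0 and K a has nonzero j-th coordinate, the minors force F to vanish wherever its j-th
coordinate does, so F vanishes on a hypersurface. -/
theorem ne_zero_of_mul_apply_eq {E : Type*} [NormedAddCommGroup E] [NormedSpace ℂ E]
    {F K : E → Fin (n + 1) → ℂ} {a : E} (hF : AnalyticAt ℂ F a) (hK : ContinuousAt K a)
    (hthin : F a = 0 → ∀ κ : E → ℂ, AnalyticAt ℂ κ a → κ a = 0 →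
      ¬ ∀ᶠ z in 𝓝 a, κ z = 0 → F z = 0)
    (h : ∀ᶠ z in 𝓝 a, ∀ i j, F z i * K z j = F z j * K z i) (hKa : K a ≠ 0) : F a ≠ 0 := by
  intro h0
  obtain ⟨j, hj⟩ := Function.ne_iff.1 hKa
  refine hthin h0 (fun z => F z j) (analyticAt_pi_iff.1 hF j) (congrFun h0 j) ?_
  filter_upwards [h, ((continuousAt_pi.1 hK) j).eventually_ne hj] with z h1 h2 h3
  ext i
  have h4 := h1 i j
  rw [h3, zero_mul] at h4
  exact (mul_eq_zero.1 h4).resolve_right h2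

/-- Both sides have local coordinates whose common zeros contain no hypersurface, so neither
vanishes where the other does not; thus the indeterminacy loci agree too. -/
theorem toPFun_eq_map_of_dense (f : MeromorphicMap m n) (g : MeromorphicMap m N)
    (L : (Fin (N + 1) → ℂ) ≃ₗ[ℂ] (Fin (n + 1) → ℂ)) {Ω : Set (Fin m → ℂ)} (hΩ : Dense Ω)
    (h : ∀ z ∈ Ω, ∃ c : ℂ, f.homCoord z = c • L (g.homCoord z)) :
    f.toPFun = PFun.map (projectiveLinearMap L) g.toPFun := by
  have key : ∀ a, (f.homCoord a ≠ 0 ↔ L (g.homCoord a) ≠ 0) ∧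
      ∀ i j, f.homCoord a i * L (g.homCoord a) j = f.homCoord a j * L (g.homCoord a) i := by
    intro a
    have hF := f.representsNear_reducedRep a
    have hG := g.representsNear_reducedRep a
    set L' := LinearMap.toContinuousLinearMap L.toLinearMap with hL'
    have hLG : AnalyticAt ℂ (fun z => L (g.reducedRep a z)) a := (L'.analyticAt _).comp hG.1
    have hmin : ∀ᶠ z in 𝓝 a, ∀ i j, f.reducedRep a z i * L (g.reducedRep a z) j =
        f.reducedRep a z j * L (g.reducedRep a z) i := by
      refine eventually_mul_apply_eq (K := fun z => L (g.reducedRep a z))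
        (hF.1.eventually_analyticAt.mono fun z hz => hz.continuousAt)
        (hLG.eventually_analyticAt.mono fun z hz => hz.continuousAt) hΩ ?_
      filter_upwards [f.eventually_exists_homCoord_eq_smul hF,
        g.eventually_exists_homCoord_eq_smul hG] with z ⟨c, hc, h1⟩ ⟨d, hd, h2⟩ hz
      obtain ⟨u, hu⟩ := h z hz
      refine ⟨c⁻¹ * (u * d), ?_⟩
      rw [h1, h2, map_smul] at hu
      rw [mul_smul, mul_smul, ← hu, inv_smul_smul₀ hc]
    refine ⟨⟨fun h0 => ?_, fun h0 => ?_⟩, hmin.self_of_nhds⟩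
    · refine ne_zero_of_mul_apply_eq (K := f.reducedRep a) (F := fun z => L (g.reducedRep a z)) hLG
        hF.1.continuousAt (fun h1 κ hκ hκ0 h2 => ?_) ?_ h0
      · refine g.not_eventually_rep_eq_zero hG (by simpa using h1) hκ hκ0 ?_
        filter_upwards [h2] with z hz h3
        simpa using hz h3
      · filter_upwards [hmin] with z hz i j
        rw [mul_comm, hz j i, mul_comm]
    · exact ne_zero_of_mul_apply_eq (F := f.reducedRep a) (K := fun z => L (g.reducedRep a z)) hF.1 hLG.continuousAt
        (fun h1 κ hκ hκ0 => f.not_eventually_rep_eq_zero hF h1 hκ hκ0) hmin h0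
  have hmem : ∀ {k : ℕ} (f : MeromorphicMap m k) (z : Fin m → ℂ) (p : ProjSpace k),
      p ∈ f.toPFun z ↔ ∃ h0 : f.homCoord z ≠ 0, p = Projectivization.mk ℂ _ h0 := by
    intro k f z p
    constructor
    · intro hp
      have h0 : f.homCoord z ≠ 0 := fun h1 =>
        f.homCoord_eq_zero_iff.1 h1 (Part.dom_iff_mem.2 ⟨p, hp⟩)
      exact ⟨h0, Part.mem_unique hp (f.mk_homCoord_mem h0)⟩
    · rintro ⟨h0, rfl⟩
      exact f.mk_homCoord_mem h0
  refine PFun.ext fun z p => ?_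
  obtain ⟨hiff, hmin⟩ := key z
  have hmk : ∀ (h1 : f.homCoord z ≠ 0) (h2 : L (g.homCoord z) ≠ 0),
      Projectivization.mk ℂ _ h1 = Projectivization.mk ℂ _ h2 := by
    intro h1 h2
    rw [Projectivization.mk_eq_mk_iff']
    obtain ⟨j, hj⟩ := Function.ne_iff.1 h2
    rw [Pi.zero_apply] at hj
    refine ⟨f.homCoord z j / L (g.homCoord z) j, ?_⟩
    ext i
    rw [Pi.smul_apply, smul_eq_mul, div_mul_eq_mul_div, div_eq_iff hj]
    exact hmin j i
  change p ∈ f.toPFun z ↔ p ∈ (g.toPFun z).map (projectiveLinearMap L)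
  rw [Part.mem_map_iff, hmem]
  constructor
  · rintro ⟨h1, rfl⟩
    have h2 : g.homCoord z ≠ 0 := fun h3 => hiff.1 h1 (by rw [h3, map_zero])
    exact ⟨_, g.mk_homCoord_mem h2, (hmk h1 (hiff.1 h1)).symm⟩
  · rintro ⟨p', hp', rfl⟩
    obtain ⟨h2, rfl⟩ := (hmem g z p').1 hp'
    have h3 : L (g.homCoord z) ≠ 0 := by simpa using h2
    exact ⟨hiff.2 h3, (hmk (hiff.2 h3) h3).symm⟩

end MeromorphicMap

theorem mainTheorem1 (m n N q : ℕ) (hn : 1 ≤ n) (hnN : n ≤ N)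
    (H : Fin q → LinForm n) (H' : Fin q → LinForm N)
    (hH : InGeneralPosition H) (hH' : InGeneralPosition H')
    (f : MeromorphicMap m n) (g : MeromorphicMap m N)
    (hf : ∀ j, ¬ f.image ⊆ hyperplane (H j))
    (hg : ∀ j, ¬ g.image ⊆ hyperplane (H' j))
    (hfg : ∀ j, f.pullbackDivisor (H j) = g.pullbackDivisor (H' j))
    (hgnd : g.LinearlyNondegenerate)
    (hq : min (N + 2 * n + 2) (max (2 * N + 1) (3 * n + 2)) ≤ q) :
    N = n ∧
      ∃ (L : (Fin (N + 1) → ℂ) ≃ₗ[ℂ] (Fin (n + 1) → ℂ)) (k : Fin (n + 2) → Fin q),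
        Function.Injective k ∧
        f.toPFun = PFun.map (projectiveLinearMap L) g.toPFun ∧
        ∀ i, projectiveLinearMap L '' hyperplane (H' (k i)) = hyperplane (H (k i)) := by
  have hq0 : 0 < q := by
    have : 0 < min (N + 2 * n + 2) (max (2 * N + 1) (3 * n + 2)) := by simp
    omega
  have hf' := fun j => f.exists_apply_homCoord_ne_zero (hf j)
  have hg' := fun j => g.exists_apply_homCoord_ne_zero (hg j)
  obtain ⟨k, hk, hconst⟩ := f.exists_injective_crossRatio_eq hnN hq hq0 hH hH' g hf' hg' hfg
  set Ω := f.regularLocus H ∩ g.regularLocus H' with hΩ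
  have hΩd : Dense Ω := (f.dense_regularLocus hf').inter_of_isOpen_left (g.dense_regularLocus hg')
    (f.isOpen_regularLocus H)
  have hΩf : ∀ z ∈ Ω, ∀ j, H j (f.homCoord z) ≠ 0 := fun z hz =>
    MeromorphicMap.mem_regularLocus.1 hz.1
  have hΩg : ∀ z ∈ Ω, ∀ j, H' j (g.homCoord z) ≠ 0 := fun z hz =>
    MeromorphicMap.mem_regularLocus.1 hz.2
  obtain ⟨w, hw⟩ := hΩd.nonempty
  set c : Fin (n + 2) → ℂ := fun i => H (k i) (f.homCoord w) / H' (k i) (g.homCoord w) with hcdef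
  have hc : ∀ i, c i ≠ 0 := fun i => div_ne_zero (hΩf w hw _) (hΩg w hw _)
  -- Constancy of the cross ratios: the quotients H (k i)(f)/H' (k i)(g) keep the proportions c i
  -- that they have at w.
  have hprop : ∀ z ∈ Ω, ∃ u : ℂ, u ≠ 0 ∧
      ∀ i, H (k i) (f.homCoord z) = u * (c i * H' (k i) (g.homCoord z)) := by
    intro z hz
    have h1 := hΩf z hz
    have h2 := hΩg z hz
    have h3 := hΩf w hw
    have h4 := hΩg w hw
    refine ⟨H (k 0) (f.homCoord z) / (c 0 * H' (k 0) (g.homCoord z)),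
      div_ne_zero (h1 _) (mul_ne_zero (hc _) (h2 _)), fun i => ?_⟩
    have h5 := hconst i 0 z hz w hw
    simp only [MeromorphicMap.crossRatio] at h5
    rw [div_eq_div_iff (mul_ne_zero (h1 _) (h2 _)) (mul_ne_zero (h3 _) (h4 _))] at h5
    rw [hcdef]
    have := h1 (k 0)
    have := h2 (k 0)
    have := h3 (k 0)
    have := h4 (k 0)
    have := h4 (k i)
    field_simp
    linear_combination h5
  have he : ∀ s : Finset (Fin (n + 2)), s.card ≤ n + 1 →
      LinearIndependent ℂ fun j : s => H (k j) := fun s hs => hH.linearIndependent_comp hk hs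
  obtain ⟨a, ha, hae⟩ := exists_sum_smul_eq_zero_of_linearIndependent (e := fun i => H (k i)) he
  have hae' : ∑ i, (a i * c i) • H' (k i) = 0 := by
    refine hgnd.eq_zero_of_dense hΩd fun z hz => ?_
    obtain ⟨u, hu, h1⟩ := hprop z hz
    have h2 := LinearMap.congr_fun hae (f.homCoord z)
    simp only [LinearMap.sum_apply, LinearMap.smul_apply, smul_eq_mul, LinearMap.zero_apply,
      h1] at h2 ⊢
    refine mul_left_cancel₀ hu ?_
    rw [mul_zero, ← h2, Finset.mul_sum]
    exact Finset.sum_congr rfl fun i _ => by ring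
  -- For N > n, the n + 2 ≤ N + 1 forms H' (k i) would be independent.
  have hN : N = n := by
    by_contra hne
    have h1 := hH'.linearIndependent_comp hk (s := Finset.univ) (by simp; omega)
    have h2 := Fintype.linearIndependent_iff.1 h1 (fun i => a i * c i)
      ((Finset.sum_coe_sort Finset.univ fun i => (a i * c i) • H' (k i)).trans hae')
      ⟨0, Finset.mem_univ _⟩
    exact mul_ne_zero (ha 0) (hc 0) h2
  refine ⟨hN, ?_⟩
  subst hN
  have hLin : ∃ L : (Fin (N + 1) → ℂ) ≃ₗ[ℂ] (Fin (N + 1) → ℂ), ∀ i Y, H (k i) (L Y) = c i * H' (k i) Y :=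
    exists_linearEquiv_forall_apply_eq (e := fun i => H (k i))
      (e' := fun i => H' (k i)) he (fun s hs => hH'.linearIndependent_comp hk hs) ha hc hae hae'
  obtain ⟨L, hL⟩ := hLin
  have h1 : f.toPFun = PFun.map (projectiveLinearMap L) g.toPFun := by
    refine f.toPFun_eq_map_of_dense g L hΩd fun z hz => ?_
    obtain ⟨u, -, hu⟩ := hprop z hz
    refine ⟨u, injective_pi_castSucc (e := fun i => H (k i)) he (funext fun i => ?_)⟩
    change H (k i.castSucc) (f.homCoord z) = H (k i.castSucc) (u • L (g.homCoord z))
    rw [map_smul, smul_eq_mul, hL, hu]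
  exact ⟨L, k, hk, h1, fun i => image_projectiveLinearMap_hyperplane (hc i) (hL i)⟩
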